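/- Let $(W_t)_{t\ge 0}$ be a standard one-dimensional Brownian motion (with almost surely continuous paths and $W_0=0$ a.s.) on a probability space $(\Omega,\mathcal F,\mathbf P)$, and let $\mathcal F_t=\sigma(\mathcal N\cup\{W_s:0\le s\le t\})$, $t\ge 0$, be the filtration generated by $W$ augmented with the class $\mathcal N$ of all subsets of $\mathbf P$-null events. For $T>0$ and $p\ge 1$ let $H^p[0,T]$ be the set of the real processes $(Y_t)_{t\in[0,T]}$ that are adapted to $(\mathcal F_t)$, measurable in $(t,\omega)$ (with respect to the completion of $dt\otimes\mathbf P$), and satisfy $\int_0^T|Y_s|^p\,ds<\infty$ a.s. For $Y\in H^2[0,T]$ and $t\in[0,T]$, the Itô integral $\int_0^tY_s\,dW_s$ is the limit in probability of $\sum_i e^n_i\,(W_{t^n_{i+1}}-W_{t^n_i})$ for any sequence of simple processes $Y^n=\sum_i e^n_i\mathbf 1_{[t^n_i,t^n_{i+1})}$ (where $0=t^n_0<t^n_1<\dots<t^n_{m_n}=t$ and $e^n_i$ is $\mathcal F_{t^n_i}$-measurable) with $\int_0^t|Y^n_s-Y_s|^2\,ds\to0$ a.s.; as a process in $t$ it is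 taken in its continuous version. A process $(X_t)_{t\in[0,T]}$ is called an Itô process with stochastic differential $dX_t=h_t\,dt+G_t\,dW_t$ if it has almost surely continuous paths, $X_0$ is $\mathcal F_0$-measurable, $h\in H^1[0,T]$, $G\in H^2[0,T]$, and almost surely, for all $t\in[0,T]$, $$X_t=X_0+\int_0^t h_s\,ds+\int_0^t G_s\,dW_s .$$ **Theorem (Itô's formula).** Let $T>0$, let $(X_t)_{t\in[0,T]}$ be an Itô process with $dX_t=h_t\,dt+G_t\,dW_t$, and let $F:[0,\infty)\times\mathbb R\to\mathbb R$ be of class $C^{1,2}$, that is, $\partial_tF$, $\partial_xF$ and $\partial_x^2F$ exist (with $\partial_tF$ one-sided at $t=0$) and, together with $F$, are continuous on $[0,\infty)\times\mathbb R$. Then $(F(t,X_t))_{t\in[0,T]}$ is an Itô process with stochastic differential $$dF(t,X_t)=\Bigl\{\partial_tF(t,X_t)+\partial_xF(t,X_t)\,h_t+\tfrac12\,\partial_x^2F(t,X_t)\,G_t^2\Bigr\}dt+\partial_xF(t,X_t)\,G_t\,dW_t .$$ In particular the coefficient of $dt$ belongs to $H^1[0,T]$ and the coefficient of $dW_t$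 belongs to $H^2[0,T]$. -/

import Mathlib

open MeasureTheory ProbabilityTheory Filter Topology Set
open scoped NNReal ENNReal

noncomputable section

namespace ItoFormula

variable {Ω : Type*} [MeasurableSpace Ω]

/-- The filtration generated by `W`, augmented with the `P`-null sets: `𝓕 t` is the σ-algebra
generated by the variables `W s`, `s ≤ t`, and by all subsets of `Ω` that are contained in an event
of probability zero (for an arbitrary set `E`, `P E` is the outer measure, so `P E = 0` says exactly
this). -/
@[reducible] def augFiltration (P : Measure Ω) (W : ℝ≥0 → Ω → ℝ) (t : ℝ) : MeasurableSpace Ω :=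
  MeasurableSpace.generateFrom
    ({E | P E = 0} ∪ {E | ∃ s : ℝ≥0, (s : ℝ) ≤ t ∧ ∃ B : Set ℝ, MeasurableSet B ∧ W s ⁻¹' B = E})

/-- The space `H^p[0,T]`: processes adapted to the augmented filtration of `W` with
`∫₀ᵀ |X_s|^p ds < ∞` almost surely. Measurability in `(s, ω)`, without which the time integrals are
meaningless, is required with respect to the completion of `ds ⊗ P` on `[0,T] × Ω`; this is implied
by joint measurability and by progressive measurability.
Processes on `[0,T]` are functions `ℝ → Ω → ℝ` of which only the values at times in `[0,T]`
matter. -/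
structure MemH (P : Measure Ω) (W : ℝ≥0 → Ω → ℝ) (p T : ℝ) (X : ℝ → Ω → ℝ) : Prop where
  adapted : ∀ t ∈ Icc 0 T, Measurable[augFiltration P W t] (X t)
  aemeasurable : AEMeasurable (fun z : ℝ × Ω => X z.1 z.2)
    ((volume.restrict (Icc 0 T)).prod P)
  lintegral_lt_top : ∀ᵐ ω ∂P, ∫⁻ s in Icc 0 T, ‖X s ω‖ₑ ^ p < ∞

/-- A simple (step) process on `[0,t]`: a partition `0 = τ 0 < τ 1 < ⋯ < τ n = t` together with
random variables `e i`, each measurable with respect to the filtration at time `τ i`. -/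
structure SimpleProcess (P : Measure Ω) (W : ℝ≥0 → Ω → ℝ) (t : ℝ) where
  n : ℕ
  τ : Fin (n + 1) → ℝ
  strictMono : StrictMono τ
  τ_zero : τ 0 = 0
  τ_last : τ (Fin.last n) = t
  e : Fin n → Ω → ℝ
  measurable_e : ∀ i, Measurable[augFiltration P W (τ i.castSucc)] (e i)

namespace SimpleProcess

variable {P : Measure Ω} {W : ℝ≥0 → Ω → ℝ} {t : ℝ}

/-- The process `∑ i, e i · 1_[τ i, τ (i+1))`. -/
def val (S : SimpleProcess P W t) (s : ℝ) (ω : Ω) : ℝ :=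
  ∑ i : Fin S.n, (Ico (S.τ i.castSucc) (S.τ i.succ)).indicator (fun _ => S.e i ω) s

/-- The stochastic integral over `[0,t]` of a simple process,
`∑ i, e i · (W (τ (i+1)) - W (τ i))`. -/
def integral (S : SimpleProcess P W t) (ω : Ω) : ℝ :=
  ∑ i : Fin S.n, S.e i ω * (W (S.τ i.succ).toNNReal ω - W (S.τ i.castSucc).toNNReal ω)

end SimpleProcess

/-- `Y` is (a version of) the Itô integral `∫₀ᵗ X_s dW_s`: there are simple processes `X^n` with
`∫₀ᵗ |X^n_s - X_s|² ds → 0` almost surely, whose stochastic integrals converge to `Y` in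
probability. -/
def HasItoIntegral (P : Measure Ω) (W : ℝ≥0 → Ω → ℝ) (t : ℝ) (X : ℝ → Ω → ℝ)
    (Y : Ω → ℝ) : Prop :=
  ∃ S : ℕ → SimpleProcess P W t,
    (∀ᵐ ω ∂P, Tendsto (fun n => ∫⁻ s in Icc 0 t, ‖(S n).val s ω - X s ω‖ₑ ^ (2 : ℝ))
      atTop (𝓝 0)) ∧
    TendstoInMeasure P (fun n => (S n).integral) atTop Y

/-- `I` is a continuous version on `[0,T]` of the process `t ↦ ∫₀ᵗ X_s dW_s`. -/
structure IsItoIntegralProcess (P : Measure Ω) (W : ℝ≥0 → Ω → ℝ) (T : ℝ)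
    (X I : ℝ → Ω → ℝ) : Prop where
  continuousOn : ∀ᵐ ω ∂P, ContinuousOn (fun t => I t ω) (Icc 0 T)
  hasItoIntegral : ∀ t ∈ Icc 0 T, HasItoIntegral P W t X (I t)

/-- `X` is an Itô process on `[0,T]` with stochastic differential `dX_t = h_t dt + G_t dW_t`. -/
structure IsItoProcess (P : Measure Ω) (W : ℝ≥0 → Ω → ℝ) (T : ℝ)
    (X h G : ℝ → Ω → ℝ) : Prop where
  continuousOn : ∀ᵐ ω ∂P, ContinuousOn (fun t => X t ω) (Icc 0 T)
  measurable_zero : Measurable[augFiltration P W 0] (X 0)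
  drift_mem : MemH P W 1 T h
  diffusion_mem : MemH P W 2 T G
  eq_integral : ∃ I : ℝ → Ω → ℝ, IsItoIntegralProcess P W T G I ∧
    ∀ᵐ ω ∂P, ∀ t ∈ Icc 0 T, X t ω = X 0 ω + (∫ s in 0..t, h s ω) + I t ω

/-- `∂F/∂t` on `[0,∞) × ℝ` (one-sided at `t = 0`). -/
def partialT (F : ℝ → ℝ → ℝ) (t x : ℝ) : ℝ := derivWithin (fun s => F s x) (Ici 0) t

/-- `∂F/∂x`. -/
def partialX (F : ℝ → ℝ → ℝ) (t x : ℝ) : ℝ := deriv (F t) x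

/-- `∂²F/∂x²`. -/
def partialXX (F : ℝ → ℝ → ℝ) (t x : ℝ) : ℝ := deriv (partialX F t) x

/-- `F : [0,∞) × ℝ → ℝ` is of class `C^{1,2}`: `∂F/∂t`, `∂F/∂x` and `∂²F/∂x²` exist on
`[0,∞) × ℝ` and are continuous there together with `F`. The values of `F` at negative times are
irrelevant. -/
structure IsC12 (F : ℝ → ℝ → ℝ) : Prop where
  differentiable_t : ∀ x, DifferentiableOn ℝ (fun t => F t x) (Ici 0)
  differentiable_x : ∀ t, 0 ≤ t → Differentiable ℝ (F t)
  differentiable_xx : ∀ t, 0 ≤ t → Differentiable ℝ (partialX F t)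
  continuousOn : ContinuousOn (fun z : ℝ × ℝ => F z.1 z.2) (Ici 0 ×ˢ univ)
  continuousOn_t : ContinuousOn (fun z : ℝ × ℝ => partialT F z.1 z.2) (Ici 0 ×ˢ univ)
  continuousOn_x : ContinuousOn (fun z : ℝ × ℝ => partialX F z.1 z.2) (Ici 0 ×ˢ univ)
  continuousOn_xx : ContinuousOn (fun z : ℝ × ℝ => partialXX F z.1 z.2) (Ici 0 ×ˢ univ)

end ItoFormula

end

noncomputable section

namespace ItoFormula

variable {Ω : Type*} [MeasurableSpace Ω] {P : Measure Ω} {W : ℝ≥0 → Ω → ℝ}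

/-! ### The augmented filtration -/

/-! Fix `t`. The Itô integral of `∂ₓF(s, X_s) G_s` over `[0,t]` is identified by exhibiting simple
processes that approximate the integrand and whose integrals converge to `F(t, X_t) - F(0, X_0)`
minus the drift integral. Let `S n` be simple processes converging to `G` in `L²[0,t]` almost
surely, and take partitions `u n` that contain the breakpoints of `S n` and have mesh tending to
zero. On a cell, with `e` the value of `S n`, the increment of `X` is `∫ h ds + e ΔW + r`, where `r`
is the cell error `∫ (G - e) dW`. The approximating simple process has the value `∂ₓF(u i, X_{u i})
e` on the cell.

Telescoping `F(t, X_t) - F(0, X_0)` and expanding to first order in time and second order in space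
shows that the Riemann-Itô sums `∑ ∂ₓF e ΔW` have the required limit along every path on which four
error sums vanish: `∑ ∂ₓF r`, `∑ r²`, and `∑ w e² ((ΔW)² - Δu)` for `w = ∂²ₓF` and `w = 1`. This is
the deterministic lemma `IsGridSeq.tendsto_sum_partialX_mul`. It is enough that the four sums tend
to zero in probability, since then they do so almost surely along a common subsequence.

The probabilistic input is a single Lenglart type inequality, `IsNoise.measure_sum_sq_ge_le`: a
discrete stochastic integral is small in probability as soon as its bracket is, with no moment
assumption on the integrand. Applied to the noise `ΔW` on refined partitions and carried from simple
processes to `G` in `measure_sum_cellError_ge_le`, it controls `r`. Applied to the noise `(ΔW)² -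
Δu`, it replaces squared increments by lengths; the bracket there is of order `∑ w² e⁴ (Δu)²`, which
vanishes for square integrable `G`. -/

theorem augFiltration_mono {s t : ℝ} (h : s ≤ t) : augFiltration P W s ≤ augFiltration P W t := by
  apply MeasurableSpace.generateFrom_mono
  apply union_subset_union_right
  rintro E ⟨r, hr, B, hB, rfl⟩
  exact ⟨r, hr.trans h, B, hB, rfl⟩

theorem measurableSet_augFiltration_of_null {t : ℝ} {E : Set Ω} (hE : P E = 0) :
    MeasurableSet[augFiltration P W t] E :=
  MeasurableSpace.measurableSet_generateFrom (Or.inl hE)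

theorem measurableSet_augFiltration_congr {t : ℝ} {E E' : Set Ω}
    (hE : MeasurableSet[augFiltration P W t] E) (h : E =ᵐ[P] E') :
    MeasurableSet[augFiltration P W t] E' := by
  have h1 : P (E \ E') = 0 := (ae_eq_set.1 h).1
  have h2 : P (E' \ E) = 0 := (ae_eq_set.1 h).2
  have : E' = (E \ (E \ E')) ∪ (E' \ E) := by
    ext x; simp only [mem_union, Set.mem_sdiff]; tauto
  rw [this]
  exact MeasurableSet.union (MeasurableSet.diff hE (measurableSet_augFiltration_of_null h1))
    (measurableSet_augFiltration_of_null h2)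

/-- All null sets belong to the σ-algebra at every time, so modifications do not affect adaptedness.
-/
theorem measurable_augFiltration_congr {β : Type*} [MeasurableSpace β] {t : ℝ} {f g : Ω → β}
    (hf : Measurable[augFiltration P W t] f) (h : f =ᵐ[P] g) :
    Measurable[augFiltration P W t] g := fun _ hs =>
  measurableSet_augFiltration_congr (hf hs) (h.preimage _)

theorem measurable_augFiltration_eval {s : ℝ≥0} {t : ℝ} (h : (s : ℝ) ≤ t) :
    Measurable[augFiltration P W t] (W s) := fun B hB =>
  MeasurableSpace.measurableSet_generateFrom (Or.inr ⟨s, h, B, hB, rfl⟩)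

theorem measurable_augFiltration_eval_toNNReal {s t : ℝ} (ht : 0 ≤ t) (h : s ≤ t) :
    Measurable[augFiltration P W t] (W s.toNNReal) :=
  measurable_augFiltration_eval (by simp [h, ht])

/-- Every augmented event agrees almost everywhere with an event of the raw past `σ(W r, r ≤ s)`.
This carries independence from the raw past to the augmented one. -/
theorem augFiltration_le_eventuallyMeasurableSpace (s : ℝ≥0) :
    augFiltration P W s ≤ eventuallyMeasurableSpace
      (MeasurableSpace.comap (fun ω (r : Iic s) => W r ω) MeasurableSpace.pi) (ae P) := by
  apply MeasurableSpace.generateFrom_le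
  rintro E (hE | ⟨r, hr, B, hB, rfl⟩)
  · exact ⟨∅, MeasurableSpace.measurableSet_empty _, ae_eq_empty.2 hE⟩
  · have hr' : r ≤ s := by exact_mod_cast hr
    refine ⟨_, ⟨(fun x : Iic s → ℝ => x ⟨r, hr'⟩) ⁻¹' B, measurable_pi_apply _ hB, rfl⟩, ?_⟩
    exact EventuallyEq.rfl

/-- The augmentation adjoins arbitrary subsets of null events, so its sets need not be measurable in
`Ω`, and the filtration need not lie below the ambient σ-algebra. Null measurability is what
survives. -/
theorem nullMeasurableSet_of_augFiltration (hW : IsBrownianReal W P) {t : ℝ} {E : Set Ω}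
    (hE : MeasurableSet[augFiltration P W t] E) : NullMeasurableSet E P := by
  have : augFiltration P W t ≤ eventuallyMeasurableSpace ‹MeasurableSpace Ω› (ae P) := by
    apply MeasurableSpace.generateFrom_le
    rintro E (hE | ⟨r, hr, B, hB, rfl⟩)
    · exact ⟨∅, MeasurableSet.empty, ae_eq_empty.2 hE⟩
    · exact (hW.aemeasurable r).nullMeasurable hB
  exact this _ hE

theorem aemeasurable_of_augFiltration (hW : IsBrownianReal W P) {t : ℝ} {f : Ω → ℝ}
    (hf : Measurable[augFiltration P W t] f) : AEMeasurable f P :=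
  NullMeasurable.aemeasurable fun _ hs => nullMeasurableSet_of_augFiltration hW (hf hs)

/-- Increments of the Brownian motion are independent of the augmented past. -/
theorem indepFun_increment (hW : IsBrownianReal W P) {s t : ℝ} (hs : 0 ≤ s)
    (hst : s ≤ t) {β : Type*} [MeasurableSpace β] {f : Ω → β}
    (hf : Measurable[augFiltration P W s] f) :
    IndepFun f (fun ω => W t.toNNReal ω - W s.toNNReal ω) P := by
  have h0 := (hW.indepFun_shift s.toNNReal).symm
  have h1 : IndepFun (fun ω (r : Iic s.toNNReal) => W r ω)
      (fun ω => W t.toNNReal ω - W s.toNNReal ω) P := by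
    have := h0.comp (φ := id) (ψ := fun x : ℝ≥0 → ℝ => x (t.toNNReal - s.toNNReal))
      measurable_id (measurable_pi_apply (X := fun _ => ℝ) (t.toNNReal - s.toNNReal))
    have e : s.toNNReal + (t.toNNReal - s.toNNReal) = t.toNNReal :=
      add_tsub_cancel_of_le (Real.toNNReal_le_toNNReal hst)
    simpa only [Function.comp_def, id, e] using this
  rw [IndepFun_iff] at h1 ⊢
  rintro E D ⟨B, hB, rfl⟩ hD
  have h2 := augFiltration_le_eventuallyMeasurableSpace (P := P) (W := W) s.toNNReal
  rw [Real.coe_toNNReal s hs] at h2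
  obtain ⟨E', hE', hEE'⟩ := h2 _ (hf hB)
  have h3 := h1 E' D hE' hD
  rw [measure_congr hEE', ← h3]
  exact measure_congr (hEE'.inter EventuallyEq.rfl)

/-- A limit in probability of random variables that are measurable with respect to the augmented
filtration at time `t` is measurable with respect to it as well. -/
theorem measurable_augFiltration_of_tendstoInMeasure {t : ℝ} {f : ℕ → Ω → ℝ} {g : Ω → ℝ}
    (hf : ∀ n, Measurable[augFiltration P W t] (f n)) (h : TendstoInMeasure P f atTop g) :
    Measurable[augFiltration P W t] g := by
  classical
  obtain ⟨ns, -, hns⟩ := h.exists_seq_tendsto_ae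
  set N : Set Ω := {ω | ¬ Tendsto (fun i => f (ns i) ω) atTop (𝓝 (g ω))} with hN
  have hN0 : P N = 0 := hns
  have hNm : MeasurableSet[augFiltration P W t] N := measurableSet_augFiltration_of_null hN0
  -- Cutting off the exceptional null set, itself an augmented event, turns almost sure convergence
  -- into convergence everywhere.
  have h1 : Measurable[augFiltration P W t] (Nᶜ.indicator g) := by
    refine @measurable_of_tendsto_metrizable Ω ℝ (augFiltration P W t) _ _ _ _
      (fun i => Nᶜ.indicator (f (ns i))) _
      (fun i => Measurable.indicator (hf _) (MeasurableSet.compl hNm)) ?_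
    rw [tendsto_pi_nhds]
    intro ω
    by_cases hω : ω ∈ N
    · simp [hω]
    · simpa [hω] using (not_not.1 hω)
  refine measurable_augFiltration_congr h1 ?_
  have : ∀ᵐ ω ∂P, ω ∉ N := hns.mono fun ω hω => not_not.2 hω
  filter_upwards [this] with ω hω
  simp [hω]

theorem measurable_augFiltration_of_tendsto_ae {t : ℝ} {f : ℕ → Ω → ℝ} {g : Ω → ℝ}
    [IsFiniteMeasure P] (hW : IsBrownianReal W P)
    (hf : ∀ n, Measurable[augFiltration P W t] (f n))
    (h : ∀ᵐ ω ∂P, Tendsto (fun n => f n ω) atTop (𝓝 (g ω))) :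
    Measurable[augFiltration P W t] g :=
  measurable_augFiltration_of_tendstoInMeasure hf <| tendstoInMeasure_of_tendsto_ae
    (fun n => (aemeasurable_of_augFiltration hW (hf n)).aestronglyMeasurable) h

/-! ### Moments of the increments -/

theorem hasLaw_increment (hW : IsBrownianReal W P) {s t : ℝ} (hs : 0 ≤ s) (hst : s ≤ t) :
    HasLaw (fun ω => W t.toNNReal ω - W s.toNNReal ω) (gaussianReal 0 (t - s).toNNReal) P := by
  have h := hW.hasLaw_sub t.toNNReal s.toNNReal
  have h1 : (t - s).toNNReal = nndist (t.toNNReal).1 (s.toNNReal).1 := by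
    refine NNReal.eq ?_
    change _ = dist (t.toNNReal : ℝ) (s.toNNReal : ℝ)
    simp [Real.dist_eq, hst, hs, hs.trans hst, abs_of_nonneg]
  rw [h1]
  exact h

theorem memLp_increment (hW : IsBrownianReal W P) (s t : ℝ) (p : ℝ≥0) :
    MemLp (fun ω => W t.toNNReal ω - W s.toNNReal ω) p P := by
  have h := hW.hasLaw_sub t.toNNReal s.toNNReal
  have h1 : MemLp id p (P.map (W t.toNNReal - W s.toNNReal)) := by
    rw [h.map_eq]
    exact memLp_id_gaussianReal p
  exact h1.comp_of_map h.aemeasurable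

theorem integral_increment (hW : IsBrownianReal W P) {s t : ℝ} (hs : 0 ≤ s) (hst : s ≤ t) :
    ∫ ω, (W t.toNNReal ω - W s.toNNReal ω) ∂P = 0 := by
  rw [(hasLaw_increment hW hs hst).integral_eq, integral_id_gaussianReal]

theorem integral_increment_sq (hW : IsBrownianReal W P) {s t : ℝ} (hs : 0 ≤ s) (hst : s ≤ t) :
    ∫ ω, (W t.toNNReal ω - W s.toNNReal ω) ^ 2 ∂P = t - s := by
  have := (hasLaw_increment hW hs hst).isProbabilityMeasure
  have h1 := (hasLaw_increment hW hs hst).variance_eq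
  rw [variance_of_integral_eq_zero (hasLaw_increment hW hs hst).aemeasurable
    (integral_increment hW hs hst), variance_id_gaussianReal] at h1
  rw [h1, Real.coe_toNNReal _ (sub_nonneg.2 hst)]

/-- The variance of `Z ^ 2` for a standard Gaussian variable `Z`. -/
def gaussianSqVar : ℝ := ∫ z, (z ^ 2 - 1) ^ 2 ∂(gaussianReal 0 1)

theorem gaussianSqVar_nonneg : 0 ≤ gaussianSqVar := integral_nonneg fun _ => sq_nonneg _

theorem integral_increment_sq_sub_sq (hW : IsBrownianReal W P) {s t : ℝ} (hs : 0 ≤ s)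
    (hst : s ≤ t) :
    ∫ ω, ((W t.toNNReal ω - W s.toNNReal ω) ^ 2 - (t - s)) ^ 2 ∂P
      = gaussianSqVar * (t - s) ^ 2 := by
  have h1 := (hasLaw_increment hW hs hst).integral_comp
    (f := fun x : ℝ => (x ^ 2 - (t - s)) ^ 2) (by fun_prop)
  have hts : 0 ≤ t - s := sub_nonneg.2 hst
  -- Scaling: the increment has the law of `√(t - s)` times a standard Gaussian, so `(t - s)²`
  -- factors out of the integral.
  have h2 : gaussianReal 0 (t - s).toNNReal = (gaussianReal 0 1).map (√(t - s) * ·) := by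
    rw [gaussianReal_map_const_mul]
    congr 1
    · simp
    · ext; simp [hts]
  simp only [Function.comp_def] at h1
  rw [h1, h2, integral_map (by fun_prop) (by fun_prop), gaussianSqVar, mul_comm,
    ← integral_const_mul]
  congr 1 with z
  rw [mul_pow, Real.sq_sqrt hts]
  ring

/-! ### Discrete stochastic integrals -/

/-- Noise variables `ξ j`, `j < N`, adapted to a discrete filtration `m`, independent of the past,
centered, and with variance at most `v j`. -/
structure IsNoise (P : Measure Ω) (N : ℕ) (m : ℕ → MeasurableSpace Ω) (ξ : ℕ → Ω → ℝ)
    (v : ℕ → ℝ) : Prop where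
  mono : Monotone m
  aemeasurable : ∀ j (f : Ω → ℝ), Measurable[m j] f → AEMeasurable f P
  measurable : ∀ j < N, Measurable[m (j + 1)] (ξ j)
  memLp : ∀ j < N, MemLp (ξ j) 2 P
  integral_eq : ∀ j < N, ∫ ω, ξ j ω ∂P = 0
  integral_sq_le : ∀ j < N, ∫ ω, ξ j ω ^ 2 ∂P ≤ v j
  indep : ∀ j < N, ∀ f : Ω → ℝ, Measurable[m j] f → IndepFun f (ξ j) P
  pos : ∀ j < N, 0 < v j

namespace IsNoise

variable {N : ℕ} {m : ℕ → MeasurableSpace Ω} {ξ : ℕ → Ω → ℝ} {v : ℕ → ℝ}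

theorem measurable_sum (hξ : IsNoise P N m ξ v) {a : ℕ → Ω → ℝ} {n : ℕ} (hn : n ≤ N)
    (ha : ∀ j < N, Measurable[m j] (a j)) :
    Measurable[m n] (fun ω => ∑ j ∈ Finset.range n, a j ω * ξ j ω) := by
  refine Finset.measurable_sum _ fun j hj => ?_
  have hj' := Finset.mem_range.1 hj
  exact ((ha j (hj'.trans_le hn)).mono (hξ.mono hj'.le) le_rfl).mul
    ((hξ.measurable j (hj'.trans_le hn)).mono (hξ.mono hj') le_rfl)

/-- Orthogonality of martingale differences. In the square of `M + a ξ` the cross term has mean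
zero, because `a M` depends on the past only and `ξ` is centered and independent of it; the last
square factors for the same reason. Bounded coefficients make every product integrable. -/
theorem memLp_sum_and_integral_sq_le [IsProbabilityMeasure P] (hξ : IsNoise P N m ξ v)
    {a : ℕ → Ω → ℝ} {K : ℕ → ℝ} (ha : ∀ j < N, Measurable[m j] (a j))
    (hK : ∀ j < N, ∀ ω, |a j ω| ≤ K j) {n : ℕ} (hn : n ≤ N) :
    MemLp (fun ω => ∑ j ∈ Finset.range n, a j ω * ξ j ω) 2 P ∧
      ∫ ω, (∑ j ∈ Finset.range n, a j ω * ξ j ω) ^ 2 ∂P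
        ≤ ∑ j ∈ Finset.range n, (∫ ω, a j ω ^ 2 ∂P) * v j := by
  induction n with
  | zero => simp
  | succ n ih =>
    have hnN : n < N := hn
    obtain ⟨ih1, ih2⟩ := ih hnN.le
    have hMm := hξ.measurable_sum (n := n) hnN.le ha
    simp only [Finset.sum_range_succ]
    set M : Ω → ℝ := fun ω => ∑ j ∈ Finset.range n, a j ω * ξ j ω with hM
    have han := ha n hnN
    have haP := (hξ.aemeasurable n _ han).aestronglyMeasurable
    have hξL := hξ.memLp n hnN
    have hbd : ∀ᵐ ω ∂P, ‖a n ω‖ ≤ K n := ae_of_all _ fun ω => hK n hnN ω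
    have h1 : MemLp (fun ω => a n ω * ξ n ω) 2 P :=
      hξL.of_le_mul (haP.mul hξL.aestronglyMeasurable) (hbd.mono fun ω h => by
        rw [norm_mul]; exact mul_le_mul_of_nonneg_right h (norm_nonneg _))
    have hMa : Integrable (fun ω => a n ω * M ω) P :=
      (ih1.integrable one_le_two).bdd_mul haP hbd
    have hMaI : IndepFun (fun ω => a n ω * M ω) (ξ n) P := hξ.indep n hnN _ (han.mul hMm)
    have haI : IndepFun (fun ω => a n ω ^ 2) (ξ n) P := hξ.indep n hnN _ (han.pow_const 2)
    have haI2 : IndepFun (fun ω => a n ω ^ 2) (fun ω => ξ n ω ^ 2) P :=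
      haI.comp (φ := id) (ψ := fun x => x ^ 2) measurable_id (by fun_prop)
    refine ⟨ih1.add h1, ?_⟩
    have i1 : Integrable (fun ω => M ω ^ 2) P := ih1.integrable_sq
    have i2 : Integrable (fun ω => (a n ω * M ω) * ξ n ω) P :=
      hMaI.integrable_mul hMa (hξL.integrable one_le_two)
    have i3 : Integrable (fun ω => (a n ω * ξ n ω) ^ 2) P := h1.integrable_sq
    have e1 : ∫ ω, (a n ω * M ω) * ξ n ω ∂P = 0 := by
      rw [hMaI.integral_fun_mul_eq_mul_integral hMa.aestronglyMeasurable hξL.aestronglyMeasurable,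
        hξ.integral_eq n hnN, mul_zero]
    have e2 : ∫ ω, (a n ω * ξ n ω) ^ 2 ∂P = (∫ ω, a n ω ^ 2 ∂P) * ∫ ω, ξ n ω ^ 2 ∂P := by
      simp only [mul_pow]
      exact haI2.integral_fun_mul_eq_mul_integral (haP.pow 2) (hξL.aestronglyMeasurable.pow 2)
    calc ∫ ω, (M ω + a n ω * ξ n ω) ^ 2 ∂P
        = ∫ ω, (M ω ^ 2 + 2 * ((a n ω * M ω) * ξ n ω)) + (a n ω * ξ n ω) ^ 2 ∂P := by
          congr 1 with ω; ring
      _ = ∫ ω, M ω ^ 2 ∂P + (∫ ω, a n ω ^ 2 ∂P) * ∫ ω, ξ n ω ^ 2 ∂P := by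
          have i12 : Integrable (fun ω => M ω ^ 2 + 2 * ((a n ω * M ω) * ξ n ω)) P :=
            i1.add (i2.const_mul 2)
          rw [integral_add i12 i3, integral_add i1 (i2.const_mul 2), integral_const_mul, e1, e2]
          ring
      _ ≤ _ := add_le_add ih2 (mul_le_mul_of_nonneg_left (hξ.integral_sq_le n hnN)
          (integral_nonneg fun _ => sq_nonneg _))

end IsNoise

/-- The retained terms form an initial segment, because partial sums of nonnegative terms increase.
The test on the term of index `j` already includes that term, so the level `δ` is never overshot. -/
theorem sum_ite_partial_sum_le {D : ℕ → ℝ} {δ : ℝ} (hδ : 0 ≤ δ) (hD : ∀ j, 0 ≤ D j) (n : ℕ) :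
    ∑ j ∈ Finset.range n, (if ∑ l ∈ Finset.range (j + 1), D l ≤ δ then D j else 0) ≤ δ := by
  induction n with
  | zero => simpa using hδ
  | succ n ih =>
    by_cases h : ∑ l ∈ Finset.range (n + 1), D l ≤ δ
    · refine (Finset.sum_le_sum fun j _ => ?_).trans h
      split_ifs
      · exact le_rfl
      · exact hD j
    · rw [Finset.sum_range_succ, if_neg h, add_zero]
      exact ih

/-- A Lenglart type inequality for (families of) discrete stochastic integrals. -/
theorem IsNoise.measure_sum_sq_ge_le [IsProbabilityMeasure P] {N : ℕ} {m : ℕ → MeasurableSpace Ω}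
    {ξ : ℕ → Ω → ℝ} {v : ℕ → ℝ} (hξ : IsNoise P N m ξ v) {ι : Type*} (B : Finset ι)
    (d : ι → ℕ → Ω → ℝ) (hd : ∀ b, ∀ j < N, Measurable[m j] (d b j)) {ε δ : ℝ} (hε : 0 < ε)
    (hδ : 0 ≤ δ) :
    P {ω | ε ≤ ∑ b ∈ B, (∑ j ∈ Finset.range N, d b j ω * ξ j ω) ^ 2}
      ≤ ENNReal.ofReal (δ / ε)
        + P {ω | δ < ∑ j ∈ Finset.range N, (∑ b ∈ B, d b j ω ^ 2) * v j} := by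
  classical
  -- Extending the bracket increments by zero beyond `N` keeps nonnegativity and measurability free
  -- of index conditions.
  set D : ℕ → Ω → ℝ := fun j ω => if j < N then (∑ b ∈ B, d b j ω ^ 2) * v j else 0 with hDdef
  have hD0 : ∀ j ω, 0 ≤ D j ω := fun j ω => by
    simp only [hDdef]
    split_ifs with hj
    · exact mul_nonneg (Finset.sum_nonneg fun _ _ => sq_nonneg _) (hξ.pos j hj).le
    · exact le_rfl
  have hDm : ∀ l j, l ≤ j → Measurable[m j] (D l) := fun l j hlj => by
    simp only [hDdef]
    split_ifs with hl
    · exact (Finset.measurable_sum _ fun b _ =>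
        (((hd b l hl).mono (hξ.mono hlj) le_rfl).pow_const 2)).mul_const _
    · exact measurable_const
  set V : ℕ → Ω → ℝ := fun j ω => ∑ l ∈ Finset.range (j + 1), D l ω with hV
  have hVm : ∀ j, Measurable[m j] (V j) := fun j =>
    Finset.measurable_sum _ fun l hl => hDm l j (Finset.mem_range_succ_iff.1 hl)
  -- Stopping: the coefficients are switched off once the bracket exceeds `δ`. The bracket up to and
  -- including index `j` is already known at time `j`, so the stopped coefficients remain adapted
  -- and their bracket is at most `δ` everywhere.
  set a : ι → ℕ → Ω → ℝ := fun b j ω => if V j ω ≤ δ then d b j ω else 0 with ha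
  have ham : ∀ b, ∀ j < N, Measurable[m j] (a b j) := fun b j hj =>
    Measurable.ite (measurableSet_le (hVm j) measurable_const) (hd b j hj) measurable_const
  have hsum : ∀ j < N, ∀ ω, (∑ b ∈ B, a b j ω ^ 2) * v j = if V j ω ≤ δ then D j ω else 0 := by
    intro j hj ω
    simp only [ha, hDdef, hj, if_true]
    split_ifs <;> simp
  have htot : ∀ ω, ∑ j ∈ Finset.range N, (∑ b ∈ B, a b j ω ^ 2) * v j ≤ δ := fun ω => by
    rw [Finset.sum_congr rfl fun j hj => hsum j (Finset.mem_range.1 hj) ω]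
    exact sum_ite_partial_sum_le hδ (fun j => hD0 j ω) N
  -- A single term `a² v j` is at most the whole bracket, hence at most `δ`. This is where `v j > 0`
  -- is needed; it makes the stopped coefficients bounded, so that the second moment estimate
  -- applies.
  have hbd : ∀ b ∈ B, ∀ j < N, ∀ ω, |a b j ω| ≤ √(δ / v j) := by
    intro b hb j hj ω
    apply Real.abs_le_sqrt
    rw [le_div_iff₀ (hξ.pos j hj)]
    refine le_trans ?_ (htot ω)
    refine le_trans ?_ (Finset.single_le_sum
      (f := fun j => (∑ b ∈ B, a b j ω ^ 2) * v j) (fun i hi => ?_) (Finset.mem_range.2 hj))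
    · exact mul_le_mul_of_nonneg_right (Finset.single_le_sum
        (f := fun b => a b j ω ^ 2) (fun _ _ => sq_nonneg _) hb) (hξ.pos j hj).le
    · exact mul_nonneg (Finset.sum_nonneg fun _ _ => sq_nonneg _)
        (hξ.pos i (Finset.mem_range.1 hi)).le
  set Z : Ω → ℝ := fun ω => ∑ b ∈ B, (∑ j ∈ Finset.range N, a b j ω * ξ j ω) ^ 2 with hZ
  have key := fun b (hb : b ∈ B) =>
    hξ.memLp_sum_and_integral_sq_le (ham b) (hbd b hb) (le_refl N)
  have hZi : Integrable Z P := integrable_finsetSum _ fun b hb => (key b hb).1.integrable_sq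
  have hai : ∀ b ∈ B, ∀ j < N, Integrable (fun ω => a b j ω ^ 2) P := fun b hb j hj =>
    (MemLp.of_bound (p := 2) (hξ.aemeasurable j _ (ham b j hj)).aestronglyMeasurable _
      (ae_of_all _ (hbd b hb j hj))).integrable_sq
  have hZle : ∫ ω, Z ω ∂P ≤ δ := by
    calc ∫ ω, Z ω ∂P
        ≤ ∑ b ∈ B, ∑ j ∈ Finset.range N, (∫ ω, a b j ω ^ 2 ∂P) * v j := by
          rw [hZ, integral_finsetSum _ fun b hb => (key b hb).1.integrable_sq]
          exact Finset.sum_le_sum fun b hb => (key b hb).2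
      _ = ∫ ω, ∑ j ∈ Finset.range N, (∑ b ∈ B, a b j ω ^ 2) * v j ∂P := by
          rw [integral_finsetSum _ fun j hj => (integrable_finsetSum _ fun b hb =>
            hai b hb j (Finset.mem_range.1 hj)).mul_const _, Finset.sum_comm]
          refine Finset.sum_congr rfl fun j hj => ?_
          rw [integral_mul_const, integral_finsetSum _ fun b hb =>
            hai b hb j (Finset.mem_range.1 hj), Finset.sum_mul]
      _ ≤ ∫ _, δ ∂P := by
          refine integral_mono (integrable_finsetSum _ fun j hj => (integrable_finsetSum _
            fun b hb => hai b hb j (Finset.mem_range.1 hj)).mul_const _) (integrable_const _) htot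
      _ = δ := by simp
  have hmarkov : P {ω | ε ≤ Z ω} ≤ ENNReal.ofReal (δ / ε) := by
    have h1 := mul_meas_ge_le_integral_of_nonneg
      (ae_of_all P fun ω => Finset.sum_nonneg fun b _ => sq_nonneg
        (∑ j ∈ Finset.range N, a b j ω * ξ j ω)) hZi ε
    rw [← ofReal_measureReal]
    apply ENNReal.ofReal_le_ofReal
    rw [le_div_iff₀ hε, mul_comm]
    exact h1.trans hZle
  refine le_trans (measure_mono ?_) ((measure_union_le _ _).trans (add_le_add_left hmarkov _))
  intro ω hω
  rw [mem_union]
  -- If the full bracket is at most `δ`, nothing is switched off and the stopped sums equal the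
  -- original ones; otherwise the point lies in the second event.
  by_cases h : ∑ j ∈ Finset.range N, (∑ b ∈ B, d b j ω ^ 2) * v j ≤ δ
  · left
    have hVle : ∀ j < N, V j ω ≤ δ := fun j hj => by
      refine le_trans ?_ h
      calc V j ω ≤ ∑ l ∈ Finset.range N, D l ω :=
            Finset.sum_le_sum_of_subset_of_nonneg (Finset.range_mono hj) fun l _ _ => hD0 l ω
        _ = _ := Finset.sum_congr rfl fun l hl => by
            simp only [hDdef, Finset.mem_range.1 hl, if_true]
    have : Z ω = ∑ b ∈ B, (∑ j ∈ Finset.range N, d b j ω * ξ j ω) ^ 2 := by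
      refine Finset.sum_congr rfl fun b _ => ?_
      congr 1
      refine Finset.sum_congr rfl fun j hj => ?_
      simp only [ha, hVle j (Finset.mem_range.1 hj), if_true]
    rw [mem_ofPred_eq, this]
    exact hω
  · right
    exact not_le.1 h

/-! ### Partitions of a time interval -/

/-- `u 0 = 0 < u 1 < ⋯ < u N = t` is a partition of `[0,t]`. -/
structure IsGrid (t : ℝ) (N : ℕ) (u : ℕ → ℝ) : Prop where
  zero : u 0 = 0
  last : u N = t
  lt : ∀ j < N, u j < u (j + 1)
  mono : Monotone u

/-- The step function with values `e j` on `[u j, u (j+1))`, `j < N`. -/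
def step (N : ℕ) (u : ℕ → ℝ) (e : ℕ → ℝ) (s : ℝ) : ℝ :=
  ∑ j ∈ Finset.range N, (Ico (u j) (u (j + 1))).indicator (fun _ => e j) s

namespace IsGrid

variable {t : ℝ} {N : ℕ} {u : ℕ → ℝ}

theorem nonneg (hu : IsGrid t N u) (j : ℕ) : 0 ≤ u j := hu.zero ▸ hu.mono (Nat.zero_le j)

theorem le_last (hu : IsGrid t N u) {j : ℕ} (hj : j ≤ N) : u j ≤ t := hu.last ▸ hu.mono hj

theorem mem_Icc (hu : IsGrid t N u) {j : ℕ} (hj : j ≤ N) : u j ∈ Icc 0 t :=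
  ⟨hu.nonneg j, hu.le_last hj⟩

/-- A point of the partition never lies strictly inside a cell. Refinements of partitions are
exploited through this dichotomy. -/
theorem le_or_le (hu : IsGrid t N u) {a : ℝ} (ha : ∃ k ≤ N, u k = a) (j : ℕ) :
    u (j + 1) ≤ a ∨ a ≤ u j := by
  obtain ⟨k, -, rfl⟩ := ha
  rcases le_or_gt k j with h | h
  · exact Or.inr (hu.mono h)
  · exact Or.inl (hu.mono h)

theorem step_eq (hu : IsGrid t N u) (e : ℕ → ℝ) {i : ℕ} (hi : i < N) {s : ℝ}
    (hs : s ∈ Ico (u i) (u (i + 1))) : step N u e s = e i := by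
  rw [step, Finset.sum_eq_single_of_mem i (Finset.mem_range.2 hi)]
  · simp [hs]
  · intro j _ hji
    apply indicator_of_notMem
    rintro ⟨h1, h2⟩
    rcases lt_or_gt_of_ne hji with h | h
    · exact absurd (hu.mono (show j + 1 ≤ i from h)) (not_le.2 (hs.1.trans_lt h2))
    · exact absurd (hu.mono (show i + 1 ≤ j from h)) (not_le.2 (h1.trans_lt hs.2))

theorem exists_mem_Ico (hu : IsGrid t N u) {s : ℝ} (hs : s ∈ Ico 0 t) :
    ∃ i < N, s ∈ Ico (u i) (u (i + 1)) := by
  classical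
  have hN : ∃ n, s < u n := ⟨N, hu.last ▸ hs.2⟩
  have h1 := Nat.find_spec hN
  have h0 : Nat.find hN ≠ 0 := fun h => by
    rw [h, hu.zero] at h1
    exact absurd hs.1 (not_le.2 h1)
  obtain ⟨i, hi⟩ := Nat.exists_eq_succ_of_ne_zero h0
  have hiN : Nat.find hN ≤ N := Nat.find_min' hN (hu.last ▸ hs.2)
  refine ⟨i, by omega, ?_, ?_⟩
  · exact not_lt.1 (Nat.find_min hN (show i < Nat.find hN by omega))
  · rw [hi] at h1; exact h1

/-- The sum telescopes once each `u j` is clamped to `[a, b]`: a cell outside `[a, b)` contributes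
zero and no cell straddles `a` or `b`. -/
theorem sum_indicator_mul_sub (hu : IsGrid t N u) {a b : ℝ} (ha0 : 0 ≤ a) (hab : a ≤ b)
    (hbt : b ≤ t) (ha : ∀ j, u (j + 1) ≤ a ∨ a ≤ u j) (hb : ∀ j, u (j + 1) ≤ b ∨ b ≤ u j)
    (e : ℝ) (w : ℝ → ℝ) :
    ∑ j ∈ Finset.range N, (Ico a b).indicator (fun _ => e) (u j) * (w (u (j + 1)) - w (u j))
      = e * (w b - w a) := by
  have key : ∀ j ∈ Finset.range N,
      (Ico a b).indicator (fun _ => e) (u j) * (w (u (j + 1)) - w (u j))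
        = e * w (max a (min (u (j + 1)) b)) - e * w (max a (min (u j) b)) := by
    intro j hj
    have hlt := hu.lt j (Finset.mem_range.1 hj)
    rcases ha j with h1 | h1
    · rw [indicator_of_notMem (fun h => absurd (h.1.trans_lt hlt) (not_lt.2 h1)),
        max_eq_left ((min_le_left _ _).trans h1), max_eq_left ((min_le_left _ _).trans
          (hlt.le.trans h1))]
      ring
    · rcases hb j with h2 | h2
      · rw [indicator_of_mem (show u j ∈ Ico a b from ⟨h1, hlt.trans_le h2⟩), min_eq_left h2,
          min_eq_left (hlt.le.trans h2), max_eq_right h1, max_eq_right (h1.trans hlt.le)]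
        ring
      · rw [indicator_of_notMem (fun h => absurd h.2 (not_lt.2 h2)), min_eq_right h2,
          min_eq_right (h2.trans hlt.le)]
        ring
  rw [Finset.sum_congr rfl key, Finset.sum_range_sub (fun j => e * w (max a (min (u j) b))),
    hu.zero, hu.last, min_eq_right hbt, max_eq_right hab, min_eq_left (ha0.trans hab),
    max_eq_left ha0]
  ring

theorem lintegral_Icc_eq_sum (hu : IsGrid t N u) (f : ℝ → ℝ≥0∞) :
    ∫⁻ s in Icc 0 t, f s = ∑ j ∈ Finset.range N, ∫⁻ s in Ico (u j) (u (j + 1)), f s := by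
  have key : ∀ n, ∫⁻ s in Ico 0 (u n), f s
      = ∑ j ∈ Finset.range n, ∫⁻ s in Ico (u j) (u (j + 1)), f s := by
    intro n
    induction n with
    | zero => simp [hu.zero]
    | succ n ih =>
      rw [Finset.sum_range_succ, ← ih, ← Ico_union_Ico_eq_Ico (hu.nonneg n)
        (hu.mono (Nat.le_succ n)), lintegral_union measurableSet_Ico]
      exact Ico_disjoint_Ico_same
  rw [← key N, hu.last]
  exact setLIntegral_congr Ico_ae_eq_Icc.symm

theorem lintegral_Icc_eq_ofReal_sum (hu : IsGrid t N u) {f : ℝ → ℝ≥0∞} {y : ℕ → ℝ}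
    (hy : ∀ j < N, 0 ≤ y j)
    (hf : ∀ j < N, ∀ s ∈ Ico (u j) (u (j + 1)), f s = ENNReal.ofReal (y j)) :
    ∫⁻ s in Icc 0 t, f s = ENNReal.ofReal (∑ j ∈ Finset.range N, y j * (u (j + 1) - u j)) := by
  rw [hu.lintegral_Icc_eq_sum, ENNReal.ofReal_sum_of_nonneg]
  · refine Finset.sum_congr rfl fun j hj => ?_
    have hj' := Finset.mem_range.1 hj
    rw [setLIntegral_congr_fun measurableSet_Ico (hf j hj'), lintegral_const,
      Measure.restrict_apply_univ, Real.volume_Ico, ENNReal.ofReal_mul (hy j hj')]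
  · intro j hj
    have hj' := Finset.mem_range.1 hj
    exact mul_nonneg (hy j hj') (sub_nonneg.2 (hu.lt j hj').le)

end IsGrid

/-- Every finite subset of `[0,t]` is contained in a partition of `[0,t]` of arbitrarily small
mesh. -/
theorem exists_isGrid {t : ℝ} (ht : 0 ≤ t) (A : Finset ℝ) (hA : ∀ a ∈ A, a ∈ Icc 0 t) {δ : ℝ}
    (hδ : 0 < δ) :
    ∃ N u, IsGrid t N u ∧ (∀ a ∈ A, ∃ j ≤ N, u j = a) ∧ ∀ j < N, u (j + 1) - u j ≤ δ := by
  classical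
  obtain ⟨K, hK⟩ := exists_nat_gt (t / δ)
  have hKt : t < K * δ := by rwa [div_lt_iff₀ hδ] at hK
  -- Besides `A` and the endpoints, all multiples of `δ` up to `t` are put in, capped at `t`.
  set A' : Finset ℝ := insert 0 (insert t (A ∪
    (Finset.range K).image fun k : ℕ => min (k * δ) t)) with hA'
  have hA'm : ∀ a ∈ A', a ∈ Icc 0 t := by
    intro a ha
    simp only [hA', Finset.mem_insert, Finset.mem_union, Finset.mem_image, Finset.mem_range] at ha
    rcases ha with rfl | rfl | ha | ⟨k, -, rfl⟩
    · exact ⟨le_rfl, ht⟩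
    · exact ⟨ht, le_rfl⟩
    · exact hA a ha
    · exact ⟨le_min (by positivity) ht, min_le_right _ _⟩
  have h0 : (0 : ℝ) ∈ A' := by simp [hA']
  have ht' : t ∈ A' := by simp [hA']
  have hcard : A'.card = (A'.card - 1) + 1 :=
    (Nat.succ_pred_eq_of_pos (Finset.card_pos.2 ⟨0, h0⟩)).symm
  set N := A'.card - 1 with hN
  set f := A'.orderEmbOfFin hcard with hf
  -- The enumeration is continued by its last value, which makes `u` monotone on all of `ℕ`.
  set u : ℕ → ℝ := fun j => f ⟨min j N, Nat.lt_succ_of_le (min_le_right _ _)⟩ with hu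
  have hmono : Monotone u := fun i j hij => f.monotone (Fin.mk_le_mk.2 (min_le_min_right N hij))
  have hsurj : ∀ a ∈ A', ∃ j ≤ N, u j = a := by
    intro a ha
    have : a ∈ range f := by rw [hf, Finset.range_orderEmbOfFin]; exact ha
    obtain ⟨i, hi⟩ := this
    have hiN : (i : ℕ) ≤ N := Nat.lt_succ_iff.1 i.2
    exact ⟨i, hiN, by simp only [hu, min_eq_left hiN]; exact hi⟩
  have humem : ∀ j, u j ∈ A' := fun j => Finset.orderEmbOfFin_mem _ _ _
  have hgrid : IsGrid t N u := by
    refine ⟨?_, ?_, ?_, hmono⟩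
    · obtain ⟨j, -, hj⟩ := hsurj 0 h0
      exact le_antisymm (hj ▸ hmono (Nat.zero_le j)) (hA'm _ (humem 0)).1
    · obtain ⟨j, hjN, hj⟩ := hsurj t ht'
      exact le_antisymm (hA'm _ (humem N)).2 (hj ▸ hmono hjN)
    · intro j hj
      apply f.strictMono
      rw [Fin.mk_lt_mk, min_eq_left hj.le, min_eq_left (show j + 1 ≤ N from hj)]
      exact Nat.lt_succ_self j
  refine ⟨N, u, hgrid, fun a ha => hsurj a (by simp [hA', ha]), fun j hj => ?_⟩
  have hj0 := hgrid.nonneg j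
  -- The first multiple of `δ` beyond `u j`, capped at `t`, is a partition point in `(u j, u j +
  -- δ]`; since it cannot lie inside the cell, the cell ends no later.
  set k : ℕ := ⌊u j / δ⌋₊ + 1 with hk
  have hk1 : u j < k * δ := by
    rw [← div_lt_iff₀ hδ, hk]; push_cast; exact Nat.lt_floor_add_one _
  have hk2 : k * δ ≤ u j + δ := by
    have : (⌊u j / δ⌋₊ : ℝ) * δ ≤ u j := by
      rw [← le_div_iff₀ hδ]; exact Nat.floor_le (by positivity)
    rw [hk]; push_cast; linarith
  have hkm : min (k * δ) t ∈ A' := by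
    rcases lt_or_ge k K with h | h
    · simp only [hA', Finset.mem_insert, Finset.mem_union, Finset.mem_image, Finset.mem_range]
      exact Or.inr (Or.inr (Or.inr ⟨k, h, rfl⟩))
    · rw [min_eq_right]
      · exact ht'
      · refine hKt.le.trans (mul_le_mul_of_nonneg_right (by exact_mod_cast h) hδ.le)
  have hlt : u j < t := (hgrid.lt j hj).trans_le (hgrid.le_last hj)
  rcases hgrid.le_or_le (hsurj _ hkm) j with h | h
  · linarith [min_le_left (k * δ) t]
  · exact absurd h (not_le.2 (lt_min hk1 hlt))

/-! ### Simple processes on partitions -/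

theorem IsGrid.isNoise_increment {t : ℝ} {N : ℕ} {u : ℕ → ℝ} (hu : IsGrid t N u)
    (hW : IsBrownianReal W P) :
    IsNoise P N (fun j => augFiltration P W (u j))
      (fun j ω => W (u (j + 1)).toNNReal ω - W (u j).toNNReal ω) (fun j => u (j + 1) - u j) where
  mono := fun _ _ hij => augFiltration_mono (hu.mono hij)
  aemeasurable := fun _ _ hf => aemeasurable_of_augFiltration hW hf
  measurable := fun j hj =>
    Measurable.sub (measurable_augFiltration_eval_toNNReal (hu.nonneg _) le_rfl)
      (measurable_augFiltration_eval_toNNReal (hu.nonneg _) (hu.lt j hj).le)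
  memLp := fun _ _ => memLp_increment hW _ _ 2
  integral_eq := fun j hj => integral_increment hW (hu.nonneg _) (hu.lt j hj).le
  integral_sq_le := fun j hj => (integral_increment_sq hW (hu.nonneg _) (hu.lt j hj).le).le
  indep := fun j hj _ hf => indepFun_increment hW (hu.nonneg _) (hu.lt j hj).le hf
  pos := fun j hj => sub_pos.2 (hu.lt j hj)

/-- The `+ 1` makes the variance bound strictly positive, as `IsNoise` demands, without evaluating
`gaussianSqVar`. -/
theorem IsGrid.isNoise_increment_sq {t : ℝ} {N : ℕ} {u : ℕ → ℝ} [IsProbabilityMeasure P]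
    (hu : IsGrid t N u) (hW : IsBrownianReal W P) :
    IsNoise P N (fun j => augFiltration P W (u j))
      (fun j ω => (W (u (j + 1)).toNNReal ω - W (u j).toNNReal ω) ^ 2 - (u (j + 1) - u j))
      (fun j => (gaussianSqVar + 1) * (u (j + 1) - u j) ^ 2) where
  mono := fun _ _ hij => augFiltration_mono (hu.mono hij)
  aemeasurable := fun _ _ hf => aemeasurable_of_augFiltration hW hf
  measurable := fun j hj => ((hu.isNoise_increment hW).measurable j hj).pow_const 2 |>.sub_const _
  memLp := fun j _ => by
    have h4 : MemLp (fun ω => W (u (j + 1)).toNNReal ω - W (u j).toNNReal ω) 4 P :=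
      memLp_increment hW _ _ 4
    refine MemLp.sub ?_ (memLp_const _)
    have := h4.norm_rpow_div 2
    have e : (4 : ℝ≥0∞) / 2 = 2 := by
      
      rw [show (4 : ℝ≥0∞) = 2 * 2 by norm_num, ENNReal.mul_div_cancel_right (by simp) (by simp)]
    rw [e] at this
    simpa using this
  integral_eq := fun j hj => by
    have h2 : MemLp (fun ω => W (u (j + 1)).toNNReal ω - W (u j).toNNReal ω) 2 P :=
      memLp_increment hW _ _ 2
    rw [integral_sub h2.integrable_sq (integrable_const _),
      integral_increment_sq hW (hu.nonneg _) (hu.lt j hj).le]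
    simp
  integral_sq_le := fun j hj => by
    rw [integral_increment_sq_sub_sq hW (hu.nonneg _) (hu.lt j hj).le]
    exact mul_le_mul_of_nonneg_right (by linarith) (sq_nonneg _)
  indep := fun j hj _ hf => (indepFun_increment hW (hu.nonneg _) (hu.lt j hj).le hf).comp
    (φ := id) (ψ := fun x => x ^ 2 - (u (j + 1) - u j)) measurable_id (by fun_prop)
  pos := fun j hj => mul_pos (by linarith [gaussianSqVar_nonneg])
    (pow_pos (sub_pos.2 (hu.lt j hj)) 2)

/-- The simple process with value `e j` on `[u j, u (j+1))`. -/
def IsGrid.simpleOfStep {t : ℝ} {N : ℕ} {u : ℕ → ℝ} (hu : IsGrid t N u) (e : ℕ → Ω → ℝ)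
    (he : ∀ j < N, Measurable[augFiltration P W (u j)] (e j)) : SimpleProcess P W t where
  n := N
  τ := fun i => u i
  strictMono := Fin.strictMono_iff_lt_succ.2 fun i => by simpa using hu.lt i i.2
  τ_zero := hu.zero
  τ_last := hu.last
  e := fun i => e i
  measurable_e := fun i => he i i.2

theorem IsGrid.simpleOfStep_val {t : ℝ} {N : ℕ} {u : ℕ → ℝ} (hu : IsGrid t N u)
    (e : ℕ → Ω → ℝ) (he : ∀ j < N, Measurable[augFiltration P W (u j)] (e j)) (s : ℝ) (ω : Ω) :
    (hu.simpleOfStep e he).val s ω = step N u (fun j => e j ω) s := by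
  rw [step, Finset.sum_range]
  rfl

theorem IsGrid.simpleOfStep_integral {t : ℝ} {N : ℕ} {u : ℕ → ℝ} (hu : IsGrid t N u)
    (e : ℕ → Ω → ℝ) (he : ∀ j < N, Measurable[augFiltration P W (u j)] (e j)) (ω : Ω) :
    (hu.simpleOfStep e he).integral ω
      = ∑ j ∈ Finset.range N, e j ω * (W (u (j + 1)).toNNReal ω - W (u j).toNNReal ω) := by
  rw [Finset.sum_range]
  rfl

theorem measurable_step {t : ℝ} {N : ℕ} {u : ℕ → ℝ} {e : ℕ → Ω → ℝ}
    (he : ∀ j < N, Measurable[augFiltration P W (u j)] (e j)) (s : ℝ) (hst : s ≤ t) :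
    Measurable[augFiltration P W t] (fun ω => step N u (fun j => e j ω) s) := by
  refine Finset.measurable_sum _ fun j hj => ?_
  by_cases h : s ∈ Ico (u j) (u (j + 1))
  · simp only [indicator_of_mem h]
    exact (he j (Finset.mem_range.1 hj)).mono (augFiltration_mono (h.1.trans hst)) le_rfl
  · simp only [indicator_of_notMem h]
    exact measurable_const

namespace SimpleProcess

variable {b : ℝ}

theorem τ_mem (S : SimpleProcess P W b) (i : Fin (S.n + 1)) : S.τ i ∈ Icc 0 b :=
  ⟨S.τ_zero.symm.trans_le <| S.strictMono.monotone (Fin.zero_le i),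
    (S.strictMono.monotone (Fin.le_last i)).trans_eq S.τ_last⟩

/-- The stochastic integral over `[0,c]`. -/
def upTo (S : SimpleProcess P W b) (c : ℝ) (ω : Ω) : ℝ :=
  ∑ i : Fin S.n, S.e i ω *
    (W (min (S.τ i.succ) c).toNNReal ω - W (min (S.τ i.castSucc) c).toNNReal ω)

theorem upTo_self (S : SimpleProcess P W b) : S.upTo b = S.integral := by
  funext ω
  refine Finset.sum_congr rfl fun i _ => ?_
  rw [min_eq_left (S.τ_mem _).2, min_eq_left (S.τ_mem _).2]

theorem measurable_val (S : SimpleProcess P W b) {s t : ℝ} (hst : s ≤ t) :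
    Measurable[augFiltration P W t] (S.val s) := by
  refine Finset.measurable_sum _ fun i _ => ?_
  by_cases h : s ∈ Ico (S.τ i.castSucc) (S.τ i.succ)
  · simp only [indicator_of_mem h]
    exact (S.measurable_e i).mono (augFiltration_mono (h.1.trans hst)) le_rfl
  · simp only [indicator_of_notMem h]
    exact measurable_const

theorem measurable_upTo (S : SimpleProcess P W b) {c : ℝ} (hc : 0 ≤ c) :
    Measurable[augFiltration P W c] (S.upTo c) := by
  refine Finset.measurable_sum _ fun i _ => ?_
  by_cases h : S.τ i.castSucc ≤ c
  · exact ((S.measurable_e i).mono (augFiltration_mono h) le_rfl).mul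
      (Measurable.sub (measurable_augFiltration_eval_toNNReal hc (min_le_right _ _))
        (measurable_augFiltration_eval_toNNReal hc (min_le_right _ _)))
  · have h1 : c ≤ S.τ i.castSucc := (not_le.1 h).le
    have h2 : c ≤ S.τ i.succ := h1.trans (S.strictMono.monotone (Fin.castSucc_le_succ i))
    simp only [min_eq_right h1, min_eq_right h2, sub_self, mul_zero]
    exact measurable_const

theorem measurable_integral (S : SimpleProcess P W b) :
    Measurable[augFiltration P W b] S.integral := by
  rw [← upTo_self]
  exact S.measurable_upTo ((S.τ_mem 0).1.trans (S.τ_mem 0).2)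

variable {t : ℝ} {N : ℕ} {u : ℕ → ℝ}

theorem val_eq_of_mem_Ico (S : SimpleProcess P W b) (hu : IsGrid t N u)
    (hS : ∀ i, ∃ j ≤ N, u j = S.τ i) {j : ℕ} {s : ℝ}
    (hs : s ∈ Ico (u j) (u (j + 1))) (ω : Ω) : S.val s ω = S.val (u j) ω := by
  refine Finset.sum_congr rfl fun i _ => ?_
  have h : s ∈ Ico (S.τ i.castSucc) (S.τ i.succ) ↔ u j ∈ Ico (S.τ i.castSucc) (S.τ i.succ) := by
    have h1 := hu.le_or_le (hS i.castSucc) j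
    have h2 := hu.le_or_le (hS i.succ) j
    constructor
    · rintro ⟨h3, h4⟩
      exact ⟨h1.resolve_left fun h => absurd (h3.trans_lt hs.2) (not_lt.2 h), hs.1.trans_lt h4⟩
    · rintro ⟨h3, h4⟩
      exact ⟨h3.trans hs.1, hs.2.trans_le (h2.resolve_right (not_le.2 h4))⟩
  by_cases hm : u j ∈ Ico (S.τ i.castSucc) (S.τ i.succ)
  · rw [indicator_of_mem hm, indicator_of_mem (h.2 hm)]
  · rw [indicator_of_notMem hm, indicator_of_notMem (fun h' => hm (h.1 h'))]

/-- Each increment of `W` over `[τ i ∧ c, τ (i+1) ∧ c]` is split along the partition and the two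
sums are exchanged. This brings integrals of different simple processes, up to different times, to a
common partition. -/
theorem upTo_eq_sum (S : SimpleProcess P W b) (hu : IsGrid t N u)
    (hS : ∀ i, ∃ j ≤ N, u j = S.τ i) {c : ℝ} (hc : ∃ j ≤ N, u j = c) (ω : Ω) :
    S.upTo c ω = ∑ j ∈ Finset.range N, (if u j < c then S.val (u j) ω else 0) *
      (W (u (j + 1)).toNNReal ω - W (u j).toNNReal ω) := by
  have hc' := hu.le_or_le hc
  have hcI : c ∈ Icc 0 t := by
    obtain ⟨k, hk, rfl⟩ := hc
    exact hu.mem_Icc hk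
  have hτ : ∀ i, ∀ j, u (j + 1) ≤ min (S.τ i) c ∨ min (S.τ i) c ≤ u j := fun i j => by
    rcases hu.le_or_le (hS i) j with h | h
    · rcases hc' j with h2 | h2
      · exact Or.inl (le_min h h2)
      · exact Or.inr ((min_le_right _ _).trans h2)
    · exact Or.inr ((min_le_left _ _).trans h)
  have key : ∀ i : Fin S.n, S.e i ω *
      (W (min (S.τ i.succ) c).toNNReal ω - W (min (S.τ i.castSucc) c).toNNReal ω)
      = ∑ j ∈ Finset.range N,
        (if u j < c then (Ico (S.τ i.castSucc) (S.τ i.succ)).indicator (fun _ => S.e i ω) (u j)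
          else 0) * (W (u (j + 1)).toNNReal ω - W (u j).toNNReal ω) := by
    intro i
    rw [← hu.sum_indicator_mul_sub (le_min (S.τ_mem _).1 hcI.1)
      (min_le_min_right _ (S.strictMono.monotone (Fin.castSucc_le_succ i)))
      ((min_le_right _ _).trans hcI.2) (hτ _) (hτ _) _ (fun s => W s.toNNReal ω)]
    refine Finset.sum_congr rfl fun j _ => ?_
    congr 1
    split_ifs with h
    · by_cases hm : u j ∈ Ico (S.τ i.castSucc) (S.τ i.succ)
      · rw [indicator_of_mem hm, indicator_of_mem]
        exact ⟨(min_le_left _ _).trans hm.1, lt_min hm.2 h⟩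
      · rw [indicator_of_notMem hm, indicator_of_notMem]
        rintro ⟨h1, h2⟩
        refine hm ⟨?_, h2.trans_le (min_le_left _ _)⟩
        rcases min_le_iff.1 h1 with h3 | h3
        · exact h3
        · exact absurd h (not_lt.2 h3)
    · exact indicator_of_notMem (fun h1 => h (h1.2.trans_le (min_le_right _ _))) _
  rw [upTo, Finset.sum_congr rfl fun i _ => key i, Finset.sum_comm]
  refine Finset.sum_congr rfl fun j _ => ?_
  rw [← Finset.sum_mul]
  congr 1
  split_ifs
  · rfl
  · simp

theorem aemeasurable_val (S : SimpleProcess P W b) (hW : IsBrownianReal W P)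
    (ν : Measure ℝ) [SFinite ν] [SFinite P] :
    AEMeasurable (fun z : ℝ × Ω => S.val z.1 z.2) (ν.prod P) := by
  refine Finset.aemeasurable_fun_sum _ fun i _ => ?_
  have h1 : AEMeasurable (fun z : ℝ × Ω => S.e i z.2) (ν.prod P) :=
    (aemeasurable_of_augFiltration hW (S.measurable_e i)).comp_quasiMeasurePreserving
      Measure.quasiMeasurePreserving_snd
  have h2 := h1.indicator (measurable_fst
    (measurableSet_Ico (a := S.τ i.castSucc) (b := S.τ i.succ)))
  exact h2

end SimpleProcess

/-! ### Convergence in probability -/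

/-- Dominated convergence for the indicators of the events. -/
theorem tendsto_measure_lt_of_tendsto_ae [IsFiniteMeasure P] {f : ℕ → Ω → ℝ≥0∞}
    (hf : ∀ n, AEMeasurable (f n) P) (h : ∀ᵐ ω ∂P, Tendsto (fun n => f n ω) atTop (𝓝 0))
    {δ : ℝ≥0∞} (hδ : 0 < δ) : Tendsto (fun n => P {ω | δ < f n ω}) atTop (𝓝 0) := by
  have hm : ∀ n, NullMeasurableSet {ω | δ < f n ω} P := fun n =>
    nullMeasurableSet_lt aemeasurable_const (hf n)
  have key := tendsto_lintegral_of_dominated_convergence' (μ := P)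
    (F := fun n => {ω | δ < f n ω}.indicator 1) (f := fun _ => 0) (fun _ => 1)
    (fun n => aemeasurable_one.indicator₀ (hm n))
    (fun n => ae_of_all _ fun ω => indicator_le_self _ _ ω) (by simp) (by
      filter_upwards [h] with ω hω
      refine tendsto_const_nhds.congr' ?_
      filter_upwards [hω.eventually (gt_mem_nhds hδ)] with n hn
      rw [indicator_of_notMem]
      exact not_lt.2 hn.le)
  simpa only [lintegral_indicator_one₀ (hm _), lintegral_zero] using key

theorem tendsto_measure_le_of_tendsto_ae [IsFiniteMeasure P] {f : ℕ → Ω → ℝ}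
    (hf : ∀ n, AEMeasurable (f n) P) (h : ∀ᵐ ω ∂P, Tendsto (fun n => f n ω) atTop (𝓝 0))
    {ε : ℝ} (hε : 0 < ε) : Tendsto (fun n => P {ω | ε ≤ f n ω}) atTop (𝓝 0) := by
  have h1 := tendsto_measure_lt_of_tendsto_ae (P := P) (f := fun n ω => ENNReal.ofReal (f n ω))
    (fun n => (hf n).ennreal_ofReal) (by
      filter_upwards [h] with ω hω
      simpa using ENNReal.tendsto_ofReal hω) (ENNReal.ofReal_pos.2 (half_pos hε))
  refine tendsto_of_tendsto_of_tendsto_of_le_of_le tendsto_const_nhds h1 (fun _ => zero_le) ?_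
  intro n
  refine measure_mono fun ω (hω : ε ≤ f n ω) => ?_
  change ENNReal.ofReal (ε / 2) < ENNReal.ofReal (f n ω)
  exact (ENNReal.ofReal_lt_ofReal_iff (hε.trans_le hω)).2 ((half_lt_self hε).trans_le hω)

/-- Finitely many sequences converging in probability have a common subsequence along which they
converge almost surely. -/
theorem exists_strictMono_tendsto_ae {f : ℕ → ℕ → Ω → ℝ} {g : ℕ → Ω → ℝ} (n : ℕ)
    (h : ∀ j < n, TendstoInMeasure P (f j) atTop (g j)) :
    ∃ ns : ℕ → ℕ, StrictMono ns ∧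
      ∀ j < n, ∀ᵐ ω ∂P, Tendsto (fun k => f j (ns k) ω) atTop (𝓝 (g j ω)) := by
  induction n with
  | zero => exact ⟨id, strictMono_id, by simp⟩
  | succ n ih =>
    obtain ⟨ns, hns, hlim⟩ := ih fun j hj => h j (hj.trans n.lt_succ_self)
    obtain ⟨ms, hms, hlim'⟩ :=
      ((h n n.lt_succ_self).comp hns.tendsto_atTop).exists_seq_tendsto_ae
    refine ⟨ns ∘ ms, hns.comp hms, fun j hj => ?_⟩
    rcases Nat.lt_succ_iff_lt_or_eq.1 hj with hj | rfl
    · filter_upwards [hlim j hj] with ω hω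
      exact hω.comp hms.tendsto_atTop
    · exact hlim'

/-- A domination principle of Lenglart type. -/
theorem tendsto_measure_le_of_lenglart {Z : ℕ → Ω → ℝ} {A : ℕ → Ω → ℝ≥0∞}
    (h : ∀ n, ∀ ε > 0, ∀ δ > 0, P {ω | 4 * ε ≤ Z n ω}
      ≤ ENNReal.ofReal (δ / ε) + P {ω | ENNReal.ofReal (δ / 4) < A n ω})
    (hA : ∀ δ > 0, Tendsto (fun n => P {ω | δ < A n ω}) atTop (𝓝 0)) {ε : ℝ} (hε : 0 < ε) :
    Tendsto (fun n => P {ω | ε ≤ Z n ω}) atTop (𝓝 0) := by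
  rw [ENNReal.tendsto_nhds_zero]
  intro r hr
  obtain ⟨r', hr', hr'r⟩ : ∃ r' : ℝ, 0 < r' ∧ ENNReal.ofReal r' + ENNReal.ofReal r' ≤ r := by
    rcases eq_or_ne r ∞ with rfl | hr_top
    · exact ⟨1, one_pos, le_top⟩
    · have h0 := ENNReal.toReal_pos hr.ne' hr_top
      refine ⟨r.toReal / 2, half_pos h0, ?_⟩
      rw [← ENNReal.ofReal_add (by positivity) (by positivity), add_halves,
        ENNReal.ofReal_toReal hr_top]
  -- With this `δ` and `ε / 4` in place of `ε`, the first term of the hypothesis is exactly `r'`.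
  have hδ : 0 < r' * (ε / 4) := by positivity
  filter_upwards [(hA _ (ENNReal.ofReal_pos.2 (show 0 < r' * (ε / 4) / 4 by
    positivity))).eventually (gt_mem_nhds (ENNReal.ofReal_pos.2 hr'))] with n hn
  have h1 := h n (ε / 4) (by positivity) _ hδ
  rw [mul_div_cancel₀ ε (by norm_num), mul_div_cancel_right₀ r' (by positivity)] at h1
  exact h1.trans ((add_le_add_right hn.le _).trans hr'r)

/-! ### Measurability and norms of integrands -/

theorem enorm_rpow_two (x : ℝ) : ‖x‖ₑ ^ (2 : ℝ) = ENNReal.ofReal (x ^ 2) := by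
  rw [Real.enorm_eq_ofReal_abs, ENNReal.ofReal_rpow_of_nonneg (abs_nonneg x) (by norm_num)]
  norm_num

theorem enorm_sub_rpow_two_le (x y z : ℝ) :
    ‖x - z‖ₑ ^ (2 : ℝ) ≤ 2 * ‖x - y‖ₑ ^ (2 : ℝ) + 2 * ‖y - z‖ₑ ^ (2 : ℝ) := by
  simp only [enorm_rpow_two]
  rw [show (2 : ℝ≥0∞) = ENNReal.ofReal 2 by simp, ← ENNReal.ofReal_mul (by norm_num),
    ← ENNReal.ofReal_mul (by norm_num), ← ENNReal.ofReal_add (by positivity) (by positivity)]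
  apply ENNReal.ofReal_le_ofReal
  nlinarith [sq_nonneg (x - y - (y - z))]

theorem aemeasurable_prod_mono {s s' : Set ℝ} (hs : s ⊆ s') [SFinite P] {X : ℝ × Ω → ℝ}
    (hX : AEMeasurable X ((volume.restrict s').prod P)) :
    AEMeasurable X ((volume.restrict s).prod P) :=
  hX.mono_ac (Measure.AbsolutelyContinuous.prod
    (Measure.absolutelyContinuous_of_le (Measure.restrict_mono_set _ hs))
    Measure.AbsolutelyContinuous.rfl)

theorem ae_aemeasurable_path [SFinite P] {ν : Measure ℝ} [SFinite ν] {X : ℝ × Ω → ℝ}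
    (hX : AEMeasurable X (ν.prod P)) : ∀ᵐ ω ∂P, AEMeasurable (fun s => X (s, ω)) ν := by
  filter_upwards [hX.prod_swap.aestronglyMeasurable.prodMk_left] with ω hω
  exact hω.aemeasurable

theorem aemeasurable_lintegral_path [SFinite P] {ν : Measure ℝ} [SFinite ν] {X : ℝ × Ω → ℝ}
    (hX : AEMeasurable X (ν.prod P)) :
    AEMeasurable (fun ω => ∫⁻ s, ‖X (s, ω)‖ₑ ^ (2 : ℝ) ∂ν) P :=
  (hX.enorm.pow_const 2).lintegral_prod_left'

/-! ### The integral of approximating simple processes -/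

theorem SimpleProcess.exists_isGrid {b c t : ℝ} (ht : 0 ≤ t) (hb : b ≤ t) (hc : c ≤ t)
    (S : SimpleProcess P W b) (S' : SimpleProcess P W c) (A : Finset ℝ)
    (hA : ∀ a ∈ A, a ∈ Icc 0 t) :
    ∃ N u, IsGrid t N u ∧ (∀ i, ∃ j ≤ N, u j = S.τ i) ∧ (∀ i, ∃ j ≤ N, u j = S'.τ i) ∧
      ∀ a ∈ A, ∃ j ≤ N, u j = a := by
  classical
  obtain ⟨N, u, hu, h, -⟩ := ItoFormula.exists_isGrid ht
    ((Finset.univ.image S.τ ∪ Finset.univ.image S'.τ) ∪ A) (by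
      intro a ha
      simp only [Finset.mem_union, Finset.mem_image, Finset.mem_univ, true_and] at ha
      rcases ha with (⟨i, rfl⟩ | ⟨i, rfl⟩) | ha
      · exact ⟨(S.τ_mem i).1, (S.τ_mem i).2.trans hb⟩
      · exact ⟨(S'.τ_mem i).1, (S'.τ_mem i).2.trans hc⟩
      · exact hA a ha) one_pos
  exact ⟨N, u, hu, fun i => h _ (by simp), fun i => h _ (by simp),
    fun a ha => h _ (by simp [ha])⟩

/-- On a partition containing `c` and both sets of breakpoints, the difference is one discrete
integral with integrand `S - A` cut off at `c`. Its bracket is the squared `L²[0,c]` distance, so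
the Lenglart inequality for a one-element family applies. -/
theorem measure_upTo_sub_integral_sq_ge_le [IsProbabilityMeasure P] (hW : IsBrownianReal W P)
    {c t : ℝ} (hc : c ∈ Icc 0 t) (S : SimpleProcess P W t) (A : SimpleProcess P W c) {ε δ : ℝ}
    (hε : 0 < ε) (hδ : 0 ≤ δ) :
    P {ω | ε ≤ (S.upTo c ω - A.integral ω) ^ 2} ≤ ENNReal.ofReal (δ / ε)
      + P {ω | ENNReal.ofReal δ < ∫⁻ s in Icc 0 c, ‖S.val s ω - A.val s ω‖ₑ ^ (2 : ℝ)} := by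
  obtain ⟨N, u, hu, hS, hA, hcu⟩ := S.exists_isGrid (hc.1.trans hc.2) le_rfl hc.2 A {c}
    (by simpa using hc)
  replace hcu := hcu c (by simp)
  set d : Unit → ℕ → Ω → ℝ := fun _ j ω =>
    if u j < c then S.val (u j) ω - A.val (u j) ω else 0 with hd
  have key := (hu.isNoise_increment hW).measure_sum_sq_ge_le {()} d (fun _ j _ => by
    simp only [hd]
    split_ifs
    · exact Measurable.sub (S.measurable_val le_rfl) (A.measurable_val le_rfl)
    · exact measurable_const) hε hδ
  simp only [Finset.sum_singleton] at key
  have h1 : ∀ ω, S.upTo c ω - A.integral ω = ∑ j ∈ Finset.range N, d () j ω *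
      (W (u (j + 1)).toNNReal ω - W (u j).toNNReal ω) := fun ω => by
    rw [← A.upTo_self, S.upTo_eq_sum hu hS hcu, A.upTo_eq_sum hu hA hcu,
      ← Finset.sum_sub_distrib]
    refine Finset.sum_congr rfl fun j _ => ?_
    simp only [hd]
    split_ifs <;> ring
  have h2 : ∀ ω, ∫⁻ s in Icc 0 c, ‖S.val s ω - A.val s ω‖ₑ ^ (2 : ℝ)
      = ENNReal.ofReal (∑ j ∈ Finset.range N, d () j ω ^ 2 * (u (j + 1) - u j)) := fun ω => by
    -- The integral over `[0,c]` is moved to `[0,t]`, where the partition lives, through the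
    -- indicator of `s < c`.
    have h3 : ∫⁻ s in Icc 0 c, ‖S.val s ω - A.val s ω‖ₑ ^ (2 : ℝ)
        = ∫⁻ s in Icc 0 t, (Iio c).indicator
          (fun s => ‖S.val s ω - A.val s ω‖ₑ ^ (2 : ℝ)) s := by
      rw [setLIntegral_indicator measurableSet_Iio]
      have : Iio c ∩ Icc 0 t = Ico 0 c := by
        ext x
        simp only [mem_inter_iff, mem_Iio, mem_Icc, mem_Ico]
        exact ⟨fun h => ⟨h.2.1, h.1⟩, fun h => ⟨h.2, h.1, h.2.le.trans hc.2⟩⟩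
      rw [this]
      exact setLIntegral_congr Ico_ae_eq_Icc.symm
    rw [h3, hu.lintegral_Icc_eq_ofReal_sum (y := fun j => d () j ω ^ 2) (fun _ _ => sq_nonneg _)]
    intro j hj s hs
    have hiff : s < c ↔ u j < c := ⟨fun h => hs.1.trans_lt h, fun h => hs.2.trans_le
      ((hu.le_or_le hcu j).resolve_right (not_le.2 h))⟩
    simp only [hd]
    split_ifs with h
    · rw [indicator_of_mem (show s ∈ Iio c from hiff.2 h), enorm_rpow_two,
        S.val_eq_of_mem_Ico hu hS hs, A.val_eq_of_mem_Ico hu hA hs]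
    · rw [indicator_of_notMem (show s ∉ Iio c from fun h' => h (hiff.1 h'))]
      simp
  simpa only [h1, h2, ENNReal.ofReal_lt_ofReal_iff_of_nonneg hδ] using key

/-- `HasItoIntegral` at time `c` comes with its own simple processes on `[0,c]`. They and the `S n`
approximate the same `G` in `L²[0,c]`, so the two sequences of integrals have the same limit in
probability. Hence one sequence on `[0,t]` serves all intermediate times at once. -/
theorem tendstoInMeasure_upTo [IsProbabilityMeasure P] (hW : IsBrownianReal W P) {c t : ℝ}
    (hc : c ∈ Icc 0 t) {G : ℝ → Ω → ℝ}
    (hG : AEMeasurable (fun z : ℝ × Ω => G z.1 z.2) ((volume.restrict (Icc 0 t)).prod P))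
    {S : ℕ → SimpleProcess P W t}
    (hS : ∀ᵐ ω ∂P, Tendsto (fun n => ∫⁻ s in Icc 0 t, ‖(S n).val s ω - G s ω‖ₑ ^ (2 : ℝ))
      atTop (𝓝 0)) {Y : Ω → ℝ} (hY : HasItoIntegral P W c G Y) :
    TendstoInMeasure P (fun n => (S n).upTo c) atTop Y := by
  obtain ⟨A, hA, hAY⟩ := hY
  have hGc := aemeasurable_prod_mono (Icc_subset_Icc_right hc.2) hG
  have hSA : ∀ δ > 0, Tendsto (fun n => P {ω | δ < ∫⁻ s in Icc 0 c,
      ‖(S n).val s ω - (A n).val s ω‖ₑ ^ (2 : ℝ)}) atTop (𝓝 0) := by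
    intro δ hδ
    refine tendsto_measure_lt_of_tendsto_ae (fun n => ?_) ?_ hδ
    · exact aemeasurable_lintegral_path
        (((S n).aemeasurable_val hW _).sub ((A n).aemeasurable_val hW _))
    · have hm := ae_all_iff.2 fun n =>
        ae_aemeasurable_path (((A n).aemeasurable_val hW (volume.restrict (Icc 0 c))).sub hGc)
      filter_upwards [hS, hA, hm] with ω h1 h2 h3
      have h4 := (ENNReal.Tendsto.const_mul h1 (Or.inr (show (2 : ℝ≥0∞) ≠ ∞ by simp))).add
        (ENNReal.Tendsto.const_mul h2 (Or.inr (show (2 : ℝ≥0∞) ≠ ∞ by simp)))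
      simp only [mul_zero, add_zero] at h4
      refine tendsto_of_tendsto_of_tendsto_of_le_of_le tendsto_const_nhds h4
        (fun _ => zero_le) fun n => ?_
      refine (lintegral_mono fun s => enorm_sub_rpow_two_le _ (G s ω) _).trans ?_
      have h5 : AEMeasurable (fun s => 2 * ‖G s ω - (A n).val s ω‖ₑ ^ (2 : ℝ))
          (volume.restrict (Icc 0 c)) := by
        simp only [← enorm_neg (G _ ω - _), neg_sub]
        exact ((h3 n).enorm.pow_const 2).const_mul 2
      rw [lintegral_add_right' _ h5, lintegral_const_mul' _ _ (by simp),
        lintegral_const_mul' _ _ (by simp)]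
      refine add_le_add (mul_le_mul_right (lintegral_mono_set (Icc_subset_Icc_right hc.2)) _)
        (mul_le_mul_right (le_of_eq ?_) _)
      refine lintegral_congr fun s => ?_
      rw [← enorm_neg, neg_sub]
  have hdiff : ∀ ε > 0, Tendsto (fun n => P {ω | ε ≤ ((S n).upTo c ω - (A n).integral ω) ^ 2})
      atTop (𝓝 0) := fun ε hε => tendsto_measure_le_of_lenglart (fun n ε hε δ hδ =>
    (measure_mono fun ω (hω : 4 * ε ≤ _) => show ε ≤ _ by linarith).trans
      ((measure_upTo_sub_integral_sq_ge_le hW hc (S n) (A n) hε hδ.le).trans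
        (add_le_add_right (measure_mono fun ω (hω : _ < _) => show _ < _ from
          (ENNReal.ofReal_le_ofReal (by linarith)).trans_lt hω) _))) hSA hε
  rw [tendstoInMeasure_iff_norm] at hAY ⊢
  intro ε hε
  have h1 := (hdiff ((ε / 2) ^ 2) (by positivity)).add (hAY (ε / 2) (by positivity))
  rw [add_zero] at h1
  refine tendsto_of_tendsto_of_tendsto_of_le_of_le tendsto_const_nhds h1 (fun _ => zero_le)
    fun n => (measure_mono ?_).trans (measure_union_le _ _)
  intro ω hω
  rw [mem_ofPred_eq, Real.norm_eq_abs] at hω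
  rw [mem_union, mem_ofPred_eq, mem_ofPred_eq, Real.norm_eq_abs]
  by_contra! hcon
  have h3 := abs_lt_of_sq_lt_sq hcon.1 (by positivity)
  have h2 : |(S n).upTo c ω - Y ω| ≤
    |(S n).upTo c ω - (A n).integral ω| + |(A n).integral ω - Y ω| := abs_sub_le _ _ _
  linarith [hcon.2, h3]

/-! ### Errors on the cells of a partition -/

/-- The error made on the cell `[u i, u (i+1)]` when the increment of `I` is replaced by `e i` times
the increment of `W`. -/
def cellError (W : ℝ≥0 → Ω → ℝ) (u : ℕ → ℝ) (e : ℕ → Ω → ℝ) (I : ℝ → Ω → ℝ) (i : ℕ) (ω : Ω) : ℝ :=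
  I (u (i + 1)) ω - I (u i) ω - e i ω * (W (u (i + 1)).toNNReal ω - W (u i).toNNReal ω)

theorem step_mul_sub_step {t : ℝ} {N : ℕ} {u : ℕ → ℝ} (hu : IsGrid t N u) (c e : ℕ → ℝ) (y : ℝ)
    {s : ℝ} (hs : s ∈ Ico 0 t) :
    step N u c s * (y - step N u e s)
      = ∑ i ∈ Finset.range N, (Ico (u i) (u (i + 1))).indicator (fun _ => c i * (y - e i)) s := by
  obtain ⟨i, hi, his⟩ := hu.exists_mem_Ico hs
  rw [hu.step_eq c hi his, hu.step_eq e hi his]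
  exact (hu.step_eq (fun i => c i * (y - e i)) hi his).symm

theorem step_eq_of_mem_Ico {t : ℝ} {N M : ℕ} {u v : ℕ → ℝ} (hu : IsGrid t N u)
    (hv : IsGrid t M v) (huv : ∀ i ≤ N, ∃ j ≤ M, v j = u i) (c : ℕ → ℝ) {j : ℕ} (hj : j < M)
    {s : ℝ} (hs : s ∈ Ico (v j) (v (j + 1))) : step N u c s = step N u c (v j) := by
  obtain ⟨i, hi, his⟩ := hu.exists_mem_Ico
    (⟨hv.nonneg j, (hv.lt j hj).trans_le (hv.le_last hj)⟩ : v j ∈ Ico 0 t)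
  rw [hu.step_eq c hi his, hu.step_eq c hi ⟨his.1.trans hs.1, hs.2.trans_le
    ((hv.le_or_le (huv (i + 1) hi) j).resolve_right (not_le.2 his.2))⟩]

/-- Over a cell of `u` the coefficients `c i` and `e i` are constant, while the increment of
`S.upTo` is a sum over the finer cells of `v`. The weighted errors therefore add up to a discrete
integral along `v` of `c (S - e)`. -/
theorem sum_mul_cellError_upTo {t : ℝ} {N M : ℕ} {u v : ℕ → ℝ} (hu : IsGrid t N u)
    (hv : IsGrid t M v) (huv : ∀ i ≤ N, ∃ j ≤ M, v j = u i) (S : SimpleProcess P W t)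
    (hS : ∀ i, ∃ j ≤ M, v j = S.τ i) (c e : ℕ → Ω → ℝ) (ω : Ω) :
    ∑ i ∈ Finset.range N, c i ω * cellError W u e S.upTo i ω
      = ∑ j ∈ Finset.range M, step N u (fun i => c i ω) (v j) *
          (S.val (v j) ω - step N u (fun i => e i ω) (v j)) *
          (W (v (j + 1)).toNNReal ω - W (v j).toNNReal ω) := by
  have h1 : ∀ i ∈ Finset.range N, c i ω * cellError W u e S.upTo i ω
      = ∑ j ∈ Finset.range M,
        (Ico (u i) (u (i + 1))).indicator (fun _ => c i ω * (S.val (v j) ω - e i ω)) (v j) *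
          (W (v (j + 1)).toNNReal ω - W (v j).toNNReal ω) := by
    intro i hi
    have hi' := Finset.mem_range.1 hi
    have h2 := hv.sum_indicator_mul_sub (hu.nonneg i) (hu.lt i hi').le (hu.le_last hi')
      (hv.le_or_le (huv i hi'.le)) (hv.le_or_le (huv _ hi')) (e i ω) (fun s => W s.toNNReal ω)
    rw [cellError, ← h2, S.upTo_eq_sum hv hS (huv i hi'.le), S.upTo_eq_sum hv hS (huv _ hi'),
      ← Finset.sum_sub_distrib, ← Finset.sum_sub_distrib, Finset.mul_sum]
    refine Finset.sum_congr rfl fun j _ => ?_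
    by_cases ha : u i ≤ v j
    · by_cases hb : v j < u (i + 1)
      · rw [if_pos hb, if_neg (not_lt.2 ha), indicator_of_mem (show v j ∈ Ico _ _ from ⟨ha, hb⟩),
          indicator_of_mem (show v j ∈ Ico _ _ from ⟨ha, hb⟩)]
        ring
      · rw [if_neg hb, if_neg (not_lt.2 ha),
          indicator_of_notMem (show v j ∉ Ico _ _ from fun h => hb h.2),
          indicator_of_notMem (show v j ∉ Ico _ _ from fun h => hb h.2)]
        ring
    · have ha' := not_le.1 ha
      rw [if_pos ha', if_pos (ha'.trans (hu.lt i hi')),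
        indicator_of_notMem (show v j ∉ Ico _ _ from fun h => ha h.1),
        indicator_of_notMem (show v j ∉ Ico _ _ from fun h => ha h.1)]
      ring
  rw [Finset.sum_congr rfl h1, Finset.sum_comm]
  refine Finset.sum_congr rfl fun j hj => ?_
  have hj' := Finset.mem_range.1 hj
  rw [← Finset.sum_mul, step_mul_sub_step hu _ _ _
    ⟨hv.nonneg j, (hv.lt j hj').trans_le (hv.le_last hj')⟩]

/-- Weighted squared distance between `X` and the step process `e`. -/
def weightedDist {ι : Type*} (B : Finset ι) (t : ℝ) (N : ℕ) (u : ℕ → ℝ) (c : ι → ℕ → Ω → ℝ)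
    (e : ℕ → Ω → ℝ) (X : ℝ → Ω → ℝ) (ω : Ω) : ℝ≥0∞ :=
  ∫⁻ s in Icc 0 t, ENNReal.ofReal (∑ b ∈ B, step N u (fun i => c b i ω) s ^ 2) *
    ‖X s ω - step N u (fun i => e i ω) s‖ₑ ^ (2 : ℝ)

/-- Along a partition refining `u` and the breakpoints of `S`, the bracket of the discrete integral
of `c (S - e)`, summed over `B`, is exactly `weightedDist`. -/
theorem measure_sum_cellError_upTo_ge_le [IsProbabilityMeasure P] (hW : IsBrownianReal W P)
    {t : ℝ} (ht : 0 ≤ t) {N : ℕ} {u : ℕ → ℝ} (hu : IsGrid t N u) (S : SimpleProcess P W t)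
    {ι : Type*} (B : Finset ι) (c : ι → ℕ → Ω → ℝ) (e : ℕ → Ω → ℝ)
    (hc : ∀ b, ∀ i < N, Measurable[augFiltration P W (u i)] (c b i))
    (he : ∀ i < N, Measurable[augFiltration P W (u i)] (e i)) {ε δ : ℝ} (hε : 0 < ε)
    (hδ : 0 ≤ δ) :
    P {ω | ε ≤ ∑ b ∈ B, (∑ i ∈ Finset.range N, c b i ω * cellError W u e S.upTo i ω) ^ 2}
      ≤ ENNReal.ofReal (δ / ε) + P {ω | ENNReal.ofReal δ < weightedDist B t N u c e S.val ω} := by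
  classical
  obtain ⟨M, v, hv, hS, -, huv⟩ := S.exists_isGrid ht le_rfl le_rfl S
    ((Finset.range (N + 1)).image u) (fun a ha => by
      obtain ⟨i, hi, rfl⟩ := Finset.mem_image.1 ha
      exact hu.mem_Icc (Finset.mem_range_succ_iff.1 hi))
  replace huv : ∀ i ≤ N, ∃ j ≤ M, v j = u i := fun i hi =>
    huv _ (Finset.mem_image_of_mem _ (Finset.mem_range_succ_iff.2 hi))
  set d : ι → ℕ → Ω → ℝ := fun b j ω => step N u (fun i => c b i ω) (v j) *
    (S.val (v j) ω - step N u (fun i => e i ω) (v j)) with hd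
  have key := (hv.isNoise_increment hW).measure_sum_sq_ge_le B d (fun b j _ =>
    Measurable.mul (measurable_step (hc b) _ le_rfl)
      (Measurable.sub (S.measurable_val le_rfl) (measurable_step he _ le_rfl))) hε hδ
  have h2 : ∀ ω, weightedDist B t N u c e S.val ω = ENNReal.ofReal
      (∑ j ∈ Finset.range M, (∑ b ∈ B, d b j ω ^ 2) * (v (j + 1) - v j)) := fun ω => by
    refine hv.lintegral_Icc_eq_ofReal_sum (fun _ _ => Finset.sum_nonneg fun _ _ => sq_nonneg _) ?_
    intro j hj s hs
    simp only [hd, mul_pow, ← Finset.sum_mul]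
    rw [enorm_rpow_two, ← ENNReal.ofReal_mul (Finset.sum_nonneg fun _ _ => sq_nonneg _)]
    simp only [step_eq_of_mem_Ico hu hv huv _ hj hs, S.val_eq_of_mem_Ico hv hS hs]
  simpa only [sum_mul_cellError_upTo hu hv huv S hS, h2,
    ENNReal.ofReal_lt_ofReal_iff_of_nonneg hδ] using key

/-- Passage to the limit from simple processes to `G`, along a subsequence on which `(S n).upTo`
converges to `I` almost surely at the finitely many points of `u`. The factors `4` and `1 / 4` pay
for `(a + b)² ≤ 2a² + 2b²`, used once for the sums and once for `weightedDist`. -/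
theorem measure_sum_cellError_ge_le [IsProbabilityMeasure P] (hW : IsBrownianReal W P)
    {t : ℝ} (ht : 0 ≤ t) {G I : ℝ → Ω → ℝ}
    (hG : AEMeasurable (fun z : ℝ × Ω => G z.1 z.2) ((volume.restrict (Icc 0 t)).prod P))
    (hI : ∀ s ∈ Icc 0 t, HasItoIntegral P W s G (I s))
    {N : ℕ} {u : ℕ → ℝ} (hu : IsGrid t N u)
    {ι : Type*} (B : Finset ι) (c : ι → ℕ → Ω → ℝ) (e : ℕ → Ω → ℝ)
    (hc : ∀ b, ∀ i < N, Measurable[augFiltration P W (u i)] (c b i))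
    (he : ∀ i < N, Measurable[augFiltration P W (u i)] (e i)) {ε δ : ℝ} (hε : 0 < ε)
    (hδ : 0 < δ) :
    P {ω | 4 * ε ≤ ∑ b ∈ B, (∑ i ∈ Finset.range N, c b i ω * cellError W u e I i ω) ^ 2}
      ≤ ENNReal.ofReal (δ / ε)
        + P {ω | ENNReal.ofReal (δ / 4) < weightedDist B t N u c e G ω} := by
  obtain ⟨S₀, hS₀, -⟩ := hI t ⟨ht, le_rfl⟩
  obtain ⟨ns, hns, hlim⟩ := exists_strictMono_tendsto_ae (P := P)
    (f := fun j n => (S₀ n).upTo (u j)) (g := fun j => I (u j)) (N + 1) (fun j hj =>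
      tendstoInMeasure_upTo hW (hu.mem_Icc (Nat.lt_succ_iff.1 hj)) hG hS₀
        (hI _ (hu.mem_Icc (Nat.lt_succ_iff.1 hj))))
  set S : ℕ → SimpleProcess P W t := fun n => S₀ (ns n) with hSdef
  have hS : ∀ᵐ ω ∂P, Tendsto (fun n => ∫⁻ s in Icc 0 t, ‖(S n).val s ω - G s ω‖ₑ ^ (2 : ℝ))
      atTop (𝓝 0) := hS₀.mono fun ω hω => hω.comp hns.tendsto_atTop
  set Z : ι → Ω → ℝ := fun b ω => ∑ i ∈ Finset.range N, c b i ω * cellError W u e I i ω with hZ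
  set Zn : ℕ → ι → Ω → ℝ := fun n b ω =>
    ∑ i ∈ Finset.range N, c b i ω * cellError W u e (S n).upTo i ω with hZn
  have hcm : ∀ b, ∀ i < N, AEMeasurable (c b i) P := fun b i hi =>
    aemeasurable_of_augFiltration hW (hc b i hi)
  have hem : ∀ i < N, AEMeasurable (e i) P := fun i hi =>
    aemeasurable_of_augFiltration hW (he i hi)
  have hWm : ∀ s, AEMeasurable (W s) P := hW.aemeasurable
  have hcell : ∀ J : ℝ → Ω → ℝ, (∀ j ≤ N, AEMeasurable (J (u j)) P) → ∀ b,
      AEMeasurable (fun ω => ∑ i ∈ Finset.range N, c b i ω * cellError W u e J i ω) P := by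
    intro J hJ b
    refine Finset.aemeasurable_fun_sum _ fun i hi => ?_
    have hi' := Finset.mem_range.1 hi
    exact (hcm b i hi').mul (((hJ _ hi').sub (hJ _ hi'.le)).sub
      ((hem i hi').mul ((hWm _).sub (hWm _))))
  have hSm : ∀ n, ∀ j ≤ N, AEMeasurable ((S n).upTo (u j)) P := fun n j _ =>
    aemeasurable_of_augFiltration hW ((S n).measurable_upTo (hu.nonneg j))
  have hIm : ∀ j ≤ N, AEMeasurable (I (u j)) P := fun j hj =>
    aemeasurable_of_tendsto_metrizable_ae atTop (fun n => hSm n j hj)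
      (hlim j (Nat.lt_succ_of_le hj))
  have hlim' : ∀ᵐ ω ∂P, ∀ j ∈ Finset.range (N + 1),
      Tendsto (fun n => (S n).upTo (u j) ω) atTop (𝓝 (I (u j) ω)) :=
    (Finset.eventually_all _).2 fun j hj => hlim j (Finset.mem_range.1 hj)
  have hdiff : Tendsto (fun n => P {ω | ε ≤ ∑ b ∈ B, (Z b ω - Zn n b ω) ^ 2}) atTop (𝓝 0) := by
    refine tendsto_measure_le_of_tendsto_ae (fun n => ?_) ?_ hε
    · exact Finset.aemeasurable_fun_sum _ fun b _ =>
        ((hcell I hIm b).sub (hcell _ (hSm n) b)).pow_const 2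
    · filter_upwards [hlim'] with ω hω
      have h1 : ∀ b ∈ B, Tendsto (fun n => (Z b ω - Zn n b ω) ^ 2) atTop (𝓝 0) := by
        intro b _
        have h2 : Tendsto (fun n => Zn n b ω) atTop (𝓝 (Z b ω)) := by
          refine tendsto_finsetSum _ fun i hi => tendsto_const_nhds.mul ?_
          have hi' := Finset.mem_range.1 hi
          exact ((hω _ (Finset.mem_range.2 (by omega))).sub
            (hω _ (Finset.mem_range.2 (by omega)))).sub tendsto_const_nhds
        simpa using (h2.const_sub (Z b ω)).pow 2
      simpa using tendsto_finsetSum _ h1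
  -- A crude bound for the weights. It only has to be finite and independent of `n`, since it
  -- multiplies a quantity tending to zero.
  set Q : Ω → ℝ≥0∞ := fun ω => ∑ i ∈ Finset.range N, ENNReal.ofReal (∑ b ∈ B, c b i ω ^ 2) with hQ
  have hQstep : ∀ ω, ∀ s ∈ Ico 0 t,
      ENNReal.ofReal (∑ b ∈ B, step N u (fun i => c b i ω) s ^ 2) ≤ Q ω := by
    intro ω s hs
    obtain ⟨i, hi, his⟩ := hu.exists_mem_Ico hs
    simp only [hu.step_eq _ hi his]
    exact Finset.single_le_sum (f := fun i => ENNReal.ofReal (∑ b ∈ B, c b i ω ^ 2))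
      (fun _ _ => zero_le) (Finset.mem_range.2 hi)
  set R : ℕ → Ω → ℝ≥0∞ := fun n ω =>
    Q ω * ∫⁻ s in Icc 0 t, ‖(S n).val s ω - G s ω‖ₑ ^ (2 : ℝ) with hR
  have hRlim : Tendsto (fun n => P {ω | ENNReal.ofReal (δ / 4) < R n ω}) atTop (𝓝 0) := by
    refine tendsto_measure_lt_of_tendsto_ae (fun n => ?_) ?_ (ENNReal.ofReal_pos.2 (by positivity))
    · refine AEMeasurable.mul ?_
        (aemeasurable_lintegral_path (((S n).aemeasurable_val hW _).sub hG))
      exact Finset.aemeasurable_fun_sum _ fun i hi => (Finset.aemeasurable_fun_sum _ fun b _ =>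
        (hcm b i (Finset.mem_range.1 hi)).pow_const 2).ennreal_ofReal
    · filter_upwards [hS] with ω hω
      have hQtop : Q ω ≠ ∞ := ENNReal.sum_ne_top.2 fun _ _ => ENNReal.ofReal_ne_top
      simpa [hR] using ENNReal.Tendsto.const_mul hω (Or.inr hQtop)
  have hwd : ∀ n, ∀ᵐ ω ∂P, weightedDist B t N u c e (S n).val ω
      ≤ 2 * R n ω + 2 * weightedDist B t N u c e G ω := by
    intro n
    filter_upwards [ae_aemeasurable_path (((S n).aemeasurable_val hW _).sub hG)] with ω hω
    have h3 : AEMeasurable (fun s => 2 * (Q ω * ‖(S n).val s ω - G s ω‖ₑ ^ (2 : ℝ)))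
        (volume.restrict (Icc 0 t)) := ((hω.enorm.pow_const 2).const_mul _).const_mul _
    have hQtop : Q ω ≠ ∞ := ENNReal.sum_ne_top.2 fun _ _ => ENNReal.ofReal_ne_top
    calc weightedDist B t N u c e (S n).val ω
        ≤ ∫⁻ s in Icc 0 t, (2 * (Q ω * ‖(S n).val s ω - G s ω‖ₑ ^ (2 : ℝ)) +
            2 * (ENNReal.ofReal (∑ b ∈ B, step N u (fun i => c b i ω) s ^ 2) *
              ‖G s ω - step N u (fun i => e i ω) s‖ₑ ^ (2 : ℝ))) := by
          rw [weightedDist, ← restrict_Ico_eq_restrict_Icc]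
          refine setLIntegral_mono' measurableSet_Ico fun s hs => ?_
          refine (mul_le_mul_right (enorm_sub_rpow_two_le _ (G s ω) _) _).trans ?_
          rw [mul_add, mul_left_comm, mul_left_comm _ (2 : ℝ≥0∞)]
          gcongr
          exact hQstep ω s hs
      _ = 2 * R n ω + 2 * weightedDist B t N u c e G ω := by
          rw [lintegral_add_left' h3, lintegral_const_mul' _ _ (by simp),
            lintegral_const_mul' _ _ hQtop, lintegral_const_mul' _ _ (by simp)]
          rfl
  have hbound : ∀ n, P {ω | 4 * ε ≤ ∑ b ∈ B, Z b ω ^ 2} ≤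
      P {ω | ε ≤ ∑ b ∈ B, (Z b ω - Zn n b ω) ^ 2} +
      (ENNReal.ofReal (δ / ε) + (P {ω | ENNReal.ofReal (δ / 4) < R n ω} +
        P {ω | ENNReal.ofReal (δ / 4) < weightedDist B t N u c e G ω})) := by
    intro n
    have h1 : P {ω | 4 * ε ≤ ∑ b ∈ B, Z b ω ^ 2} ≤
        P {ω | ε ≤ ∑ b ∈ B, (Z b ω - Zn n b ω) ^ 2} + P {ω | ε ≤ ∑ b ∈ B, Zn n b ω ^ 2} := by
      refine (measure_mono ?_).trans (measure_union_le _ _)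
      intro ω hω
      rw [mem_union, mem_ofPred_eq, mem_ofPred_eq]
      rw [mem_ofPred_eq] at hω
      by_contra! hcon
      have h2 : ∑ b ∈ B, Z b ω ^ 2
          ≤ 2 * ∑ b ∈ B, (Z b ω - Zn n b ω) ^ 2 + 2 * ∑ b ∈ B, Zn n b ω ^ 2 := by
        rw [Finset.mul_sum, Finset.mul_sum, ← Finset.sum_add_distrib]
        refine Finset.sum_le_sum fun b _ => ?_
        nlinarith [sq_nonneg (Z b ω - Zn n b ω - Zn n b ω)]
      linarith
    have h2 := measure_sum_cellError_upTo_ge_le hW ht hu (S n) B c e hc he hε hδ.le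
    have h3 : P {ω | ENNReal.ofReal δ < weightedDist B t N u c e (S n).val ω} ≤
        P {ω | ENNReal.ofReal (δ / 4) < R n ω} +
        P {ω | ENNReal.ofReal (δ / 4) < weightedDist B t N u c e G ω} := by
      have h4 : ∀ᵐ ω ∂P, ω ∈ {ω | ENNReal.ofReal δ < weightedDist B t N u c e (S n).val ω} →
          ω ∈ {ω | ENNReal.ofReal (δ / 4) < R n ω} ∪
            {ω | ENNReal.ofReal (δ / 4) < weightedDist B t N u c e G ω} := by
        filter_upwards [hwd n] with ω hω hlt
        rw [mem_union, mem_ofPred_eq, mem_ofPred_eq]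
        by_contra! hcon
        refine absurd (hlt.trans_le (hω.trans (add_le_add (mul_le_mul_right hcon.1 2)
          (mul_le_mul_right hcon.2 2)))) (not_lt.2 (le_of_eq ?_))
        rw [show (2 : ℝ≥0∞) = ENNReal.ofReal 2 by simp, ← ENNReal.ofReal_mul (by norm_num),
          ← ENNReal.ofReal_add (by positivity) (by positivity)]
        congr 1
        ring
      exact (measure_mono_ae h4).trans (measure_union_le _ _)
    exact h1.trans (add_le_add_right (h2.trans (add_le_add_right h3 _)) _)
  have hfinal := hdiff.add ((tendsto_const_nhds (x := ENNReal.ofReal (δ / ε))).add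
    (hRlim.add (tendsto_const_nhds
      (x := P {ω | ENNReal.ofReal (δ / 4) < weightedDist B t N u c e G ω}))))
  rw [zero_add, zero_add] at hfinal
  -- The left side does not depend on `n`, and the terms that do tend to zero.
  exact ge_of_tendsto' hfinal hbound

/-! ### Adaptedness of time integrals -/

/-- Conditional expectations need a sub-σ-algebra of the ambient one. Intersecting with it loses
nothing up to null sets. -/
theorem augFiltration_aestronglyMeasurable (hW : IsBrownianReal W P) {t : ℝ} {f : Ω → ℝ}
    (hf : Measurable[augFiltration P W t] f) :
    AEStronglyMeasurable[augFiltration P W t ⊓ ‹MeasurableSpace Ω›] f P := by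
  have hfP := aemeasurable_of_augFiltration hW hf
  have h1 : Measurable[augFiltration P W t] (hfP.mk f) :=
    measurable_augFiltration_congr hf hfP.ae_eq_mk
  have h2 : Measurable[augFiltration P W t ⊓ ‹MeasurableSpace Ω›] (hfP.mk f) := fun s hs =>
    MeasurableSpace.measurableSet_inf.2 ⟨h1 hs, hfP.measurable_mk hs⟩
  exact ⟨hfP.mk f, h2.stronglyMeasurable, hfP.ae_eq_mk⟩

theorem integral_mul_sub_condExp_eq_zero {Ω : Type*} {m mΩ : MeasurableSpace Ω} {P : Measure Ω}
    [IsProbabilityMeasure P] {f Y : Ω → ℝ} (hm : m ≤ mΩ) (hf : AEStronglyMeasurable[m] f P) {K : ℝ}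
    (hK : ∀ᵐ ω ∂P, ‖f ω‖ ≤ K) (hY : Integrable Y P) :
    ∫ ω, f ω * (Y ω - P[Y|m] ω) ∂P = 0 := by
  have hD : Integrable (Y - P[Y|m]) P := hY.sub integrable_condExp
  have hfD : Integrable (f * (Y - P[Y|m])) P := hD.bdd_mul (hf.mono hm) hK
  have h1 := condExp_mul_of_aestronglyMeasurable_left (m := m) hf hfD hD
  have h2 : P[Y - P[Y|m]|m] =ᵐ[P] 0 := by
    filter_upwards [condExp_sub hY integrable_condExp m, condExp_condExp_of_le (μ := P) (f := Y)
      (le_refl m) hm] with ω h3 h4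
    rw [h3, Pi.sub_apply, h4, sub_self, Pi.zero_apply]
  calc ∫ ω, f ω * (Y ω - P[Y|m] ω) ∂P = ∫ ω, P[f * (Y - P[Y|m])|m] ω ∂P :=
        (integral_condExp hm).symm
    _ = ∫ _, 0 ∂P := by
        apply integral_congr_ae
        filter_upwards [h1, h2] with ω h3 h4
        rw [h3, Pi.mul_apply, h4, Pi.zero_apply, mul_zero]
    _ = 0 := by simp

/-- The time integral of a bounded jointly measurable process that is measurable with respect to
`m` at almost all times is measurable with respect to `m`, up to a modification. -/
theorem integral_ae_eq_condExp_of_bounded {Ω : Type*} {m mΩ : MeasurableSpace Ω}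
    {P : Measure Ω} [IsProbabilityMeasure P] (hm : m ≤ mΩ)
    {ν : Measure ℝ} [IsFiniteMeasure ν] {g : ℝ → Ω → ℝ}
    (hg : AEMeasurable (fun z : ℝ × Ω => g z.1 z.2) (ν.prod P))
    (hgm : ∀ᵐ s ∂ν, AEStronglyMeasurable[m] (g s) P) {K : ℝ} (hK : ∀ s ω, |g s ω| ≤ K) :
    (fun ω => ∫ s, g s ω ∂ν) =ᵐ[P] P[fun ω => ∫ s, g s ω ∂ν|m] := by
  set Y : Ω → ℝ := fun ω => ∫ s, g s ω ∂ν with hY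
  have hgs : AEStronglyMeasurable (fun z : Ω × ℝ => g z.2 z.1) (P.prod ν) :=
    hg.prod_swap.aestronglyMeasurable
  have hYm : AEStronglyMeasurable Y P := hgs.integral_prod_right'
  have hYb : ∀ ω, ‖Y ω‖ ≤ K * ν.real univ := fun ω =>
    norm_integral_le_of_norm_le_const (ae_of_all _ fun s => hK s ω)
  have hYi : Integrable Y P := Integrable.of_bound hYm _ (ae_of_all _ hYb)
  set Z : Ω → ℝ := P[Y|m] with hZ
  have hZm : StronglyMeasurable[m] Z := stronglyMeasurable_condExp
  have hZi : Integrable Z P := integrable_condExp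
  have hZb : ∀ᵐ ω ∂P, ‖Z ω‖ ≤ K * ν.real univ :=
    ae_bdd_abs_condExp_of_ae_bdd_abs (ae_of_all _ hYb)
  have hD : Integrable (fun ω => Y ω - Z ω) P := hYi.sub hZi
  -- The claim is `E[(Y - Z)²] = 0`. The difference `Y - Z` is orthogonal to `Z`, and by Fubini also
  -- to `Y = ∫ g s dν`, because it is orthogonal to `g s` for almost every `s`.
  have hZD : ∫ ω, Z ω * (Y ω - Z ω) ∂P = 0 :=
    integral_mul_sub_condExp_eq_zero hm hZm.aestronglyMeasurable hZb hYi
  have hYD : ∫ ω, Y ω * (Y ω - Z ω) ∂P = 0 := by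
    have hint : Integrable (fun z : Ω × ℝ => g z.2 z.1 * (Y z.1 - Z z.1)) (P.prod ν) :=
      (hD.comp_fst ν).bdd_mul hgs (ae_of_all _ fun z => hK z.2 z.1)
    calc ∫ ω, Y ω * (Y ω - Z ω) ∂P = ∫ ω, ∫ s, g s ω * (Y ω - Z ω) ∂ν ∂P := by
          congr 1 with ω
          rw [integral_mul_const]
      _ = ∫ s, ∫ ω, g s ω * (Y ω - Z ω) ∂P ∂ν := integral_integral_swap hint
      _ = ∫ _, 0 ∂ν := by
          apply integral_congr_ae
          filter_upwards [hgm] with s hs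
          exact integral_mul_sub_condExp_eq_zero hm hs (ae_of_all _ (hK s)) hYi
      _ = 0 := by simp
  have hYDi : Integrable (fun ω => Y ω * (Y ω - Z ω)) P := hD.bdd_mul hYm (ae_of_all _ hYb)
  have hZDi : Integrable (fun ω => Z ω * (Y ω - Z ω)) P :=
    hD.bdd_mul hZi.aestronglyMeasurable hZb
  have hsq : ∫ ω, (Y ω - Z ω) * (Y ω - Z ω) ∂P = 0 := by
    simp only [sub_mul (Y _) (Z _) (Y _ - Z _)]
    rw [integral_sub hYDi hZDi, hYD, hZD, sub_zero]
  have hsqi : Integrable (fun ω => (Y ω - Z ω) * (Y ω - Z ω)) P := by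
    refine (hYDi.sub hZDi).congr (ae_of_all _ fun ω => ?_)
    simp only [Pi.sub_apply]
    ring
  have h0 := (integral_eq_zero_iff_of_nonneg (fun ω => mul_self_nonneg _) hsqi).1 hsq
  filter_upwards [h0] with ω hω
  exact sub_eq_zero.1 (mul_self_eq_zero.1 hω)

theorem measurable_augFiltration_integral_of_bounded [IsProbabilityMeasure P]
    (hW : IsBrownianReal W P) {t : ℝ} {ν : Measure ℝ} [IsFiniteMeasure ν] {g : ℝ → Ω → ℝ}
    (hg : AEMeasurable (fun z : ℝ × Ω => g z.1 z.2) (ν.prod P))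
    (hgt : ∀ᵐ s ∂ν, Measurable[augFiltration P W t] (g s)) {K : ℝ} (hK : ∀ s ω, |g s ω| ≤ K) :
    Measurable[augFiltration P W t] (fun ω => ∫ s, g s ω ∂ν) := by
  have h1 := integral_ae_eq_condExp_of_bounded
    (m := augFiltration P W t ⊓ ‹MeasurableSpace Ω›) inf_le_right hg
    (hgt.mono fun s hs => augFiltration_aestronglyMeasurable hW hs) hK
  exact measurable_augFiltration_congr
    (stronglyMeasurable_condExp.measurable.mono inf_le_left le_rfl) h1.symm

/-- Truncation at levels `±n` reduces to the bounded case. The conditional expectation argument uses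
adaptedness and joint measurability only, so no progressively measurable version of `h` is required.
-/
theorem measurable_augFiltration_intervalIntegral [IsProbabilityMeasure P]
    (hW : IsBrownianReal W P) {t : ℝ} (ht : 0 ≤ t) {h : ℝ → Ω → ℝ}
    (hh : AEMeasurable (fun z : ℝ × Ω => h z.1 z.2) ((volume.restrict (Icc 0 t)).prod P))
    (hht : ∀ s ∈ Icc 0 t, Measurable[augFiltration P W s] (h s))
    (hint : ∀ᵐ ω ∂P, IntegrableOn (fun s => h s ω) (Icc 0 t)) :
    Measurable[augFiltration P W t] (fun ω => ∫ s in 0..t, h s ω) := by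
  have hh' := aemeasurable_prod_mono Ioc_subset_Icc_self hh
  refine measurable_augFiltration_of_tendsto_ae hW
    (f := fun n ω => ∫ s in Ioc 0 t, max (-(n : ℝ)) (min n (h s ω))) (fun n => ?_) ?_
  · refine measurable_augFiltration_integral_of_bounded hW (K := n)
      (g := fun s ω => max (-(n : ℝ)) (min n (h s ω))) ?_ ?_ fun s ω => ?_
    · exact aemeasurable_const.max (aemeasurable_const.min hh')
    · refine (ae_restrict_iff' measurableSet_Ioc).2 (ae_of_all _ fun s hs => ?_)
      have h1 := (hht s (Ioc_subset_Icc_self hs)).mono (augFiltration_mono hs.2) le_rfl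
      exact measurable_const.max (measurable_const.min h1)
    · have hn : (0 : ℝ) ≤ n := Nat.cast_nonneg n
      exact abs_le.2 ⟨le_max_left _ _, max_le (by linarith) (min_le_left _ _)⟩
  · filter_upwards [hint] with ω hω
    rw [intervalIntegral.integral_of_le ht]
    have hω' : IntegrableOn (fun s => h s ω) (Ioc 0 t) := hω.mono_set Ioc_subset_Icc_self
    refine tendsto_integral_of_dominated_convergence (fun s => ‖h s ω‖) (fun n => ?_) hω'.norm
      (fun n => ae_of_all _ fun s => ?_) (ae_of_all _ fun s => ?_)
    · exact (aemeasurable_const.max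
        (aemeasurable_const.min hω'.aestronglyMeasurable.aemeasurable)).aestronglyMeasurable
    · have hn : (0 : ℝ) ≤ n := Nat.cast_nonneg n
      rw [Real.norm_eq_abs, Real.norm_eq_abs]
      refine abs_le.2 ⟨le_max_of_le_right (le_min ?_ (neg_abs_le _)), max_le ?_ ?_⟩
      · linarith [abs_nonneg (h s ω)]
      · linarith [abs_nonneg (h s ω)]
      · exact (min_le_right _ _).trans (le_abs_self _)
    · refine tendsto_const_nhds.congr' ?_
      obtain ⟨n₀, hn₀⟩ := exists_nat_ge |h s ω|
      filter_upwards [eventually_ge_atTop n₀] with n hn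
      have h1 : |h s ω| ≤ n := hn₀.trans (by exact_mod_cast hn)
      rw [min_eq_right ((le_abs_self _).trans h1), max_eq_right (neg_le_of_abs_le h1)]

/-! ### Joint measurability of continuous processes -/

/-- Freezing the path at the times `⌊(n+1)s⌋ / (n+1)`, capped at `T`, gives processes that take
values from countably many random variables and converge to `X` by continuity. -/
theorem aemeasurable_prod_of_continuousOn [SFinite P] {T : ℝ} {X : ℝ → Ω → ℝ}
    (hX : ∀ᵐ ω ∂P, ContinuousOn (fun t => X t ω) (Icc 0 T))
    (hXm : ∀ t ∈ Icc 0 T, AEMeasurable (X t) P) :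
    AEMeasurable (fun z : ℝ × Ω => X z.1 z.2) ((volume.restrict (Icc 0 T)).prod P) := by
  rcases lt_or_ge T 0 with hT | hT
  · rw [Icc_eq_empty (not_le.2 hT), Measure.restrict_empty, Measure.zero_prod]
    exact aemeasurable_zero_measure
  set p : ℕ → ℕ → ℝ := fun n k => min (k / ((n : ℝ) + 1)) T with hp
  have hpm : ∀ n k, p n k ∈ Icc 0 T := fun n k => ⟨le_min (by positivity) hT, min_le_right _ _⟩
  set q : ℕ → ℝ → ℝ := fun n s => p n ⌊((n : ℝ) + 1) * s⌋₊ with hq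
  have hqlim : ∀ s ∈ Icc 0 T, Tendsto (fun n => q n s) atTop (𝓝 s) := by
    intro s hs
    have h1 : Tendsto (fun n : ℕ => s - 1 / ((n : ℝ) + 1)) atTop (𝓝 s) := by
      simpa using tendsto_one_div_add_atTop_nhds_zero_nat.const_sub s
    refine tendsto_of_tendsto_of_tendsto_of_le_of_le h1 tendsto_const_nhds (fun n => ?_)
      fun n => ?_
    · have hn : (0 : ℝ) < n + 1 := by positivity
      have h2 := Nat.lt_floor_add_one (((n : ℝ) + 1) * s)
      refine le_min ?_ ?_
      · rw [le_div_iff₀ hn, sub_mul, one_div, inv_mul_cancel₀ hn.ne']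
        linarith
      · have : 0 ≤ 1 / ((n : ℝ) + 1) := by positivity
        linarith [hs.2]
    · have hn : (0 : ℝ) < n + 1 := by positivity
      refine (min_le_left _ _).trans ?_
      rw [div_le_iff₀ hn]
      exact (Nat.floor_le (mul_nonneg hn.le hs.1)).trans_eq (mul_comm _ _)
  refine aemeasurable_of_tendsto_metrizable_ae atTop
    (f := fun (n : ℕ) (z : ℝ × Ω) => X (q n z.1) z.2) (fun n => ?_) ?_
  · choose X' hX'm hX' using fun k => hXm _ (hpm n k)
    have h1 : Measurable (fun z : ℕ × Ω => X' z.1 z.2) :=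
      measurable_from_prod_countable_right hX'm
    have h2 : Measurable (fun z : ℝ × Ω => (⌊((n : ℝ) + 1) * z.1⌋₊, z.2)) :=
      (Nat.measurable_floor.comp (measurable_fst.const_mul _)).prodMk measurable_snd
    refine ⟨fun z => X' ⌊((n : ℝ) + 1) * z.1⌋₊ z.2, h1.comp h2, ?_⟩
    have h3 : ∀ᵐ ω ∂P, ∀ k, X (p n k) ω = X' k ω :=
      ae_all_iff.2 hX'
    filter_upwards [Measure.quasiMeasurePreserving_snd.ae h3] with z hz
    exact hz _
  · have h4 : ∀ᵐ z ∂((volume.restrict (Icc 0 T)).prod P), (z : ℝ × Ω).1 ∈ Icc 0 T :=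
      Measure.quasiMeasurePreserving_fst.ae (ae_restrict_mem measurableSet_Icc)
    filter_upwards [h4, Measure.quasiMeasurePreserving_snd.ae hX] with z hz hzX
    exact (hzX z.1 hz).tendsto.comp (tendsto_nhdsWithin_iff.2 ⟨hqlim z.1 hz,
      Eventually.of_forall fun n => hpm n _⟩)

/-! ### Compositions with functions continuous on `[0,∞) × ℝ` -/

variable {ψ : ℝ → ℝ → ℝ}

/-- Clamping negative times to zero gives a globally continuous, hence Borel, function without
changing values at times in `[0,∞)`. -/
theorem continuous_clamp (hψ : ContinuousOn (fun z : ℝ × ℝ => ψ z.1 z.2) (Ici 0 ×ˢ univ)) :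
    Continuous (fun z : ℝ × ℝ => ψ (max z.1 0) z.2) :=
  hψ.comp_continuous (f := fun z : ℝ × ℝ => (max z.1 0, z.2)) (by fun_prop)
    fun z => ⟨le_max_right z.1 0, mem_univ _⟩

theorem continuous_section (hψ : ContinuousOn (fun z : ℝ × ℝ => ψ z.1 z.2) (Ici 0 ×ˢ univ))
    {t : ℝ} (ht : 0 ≤ t) : Continuous (ψ t) :=
  hψ.comp_continuous (f := fun x : ℝ => (t, x)) (by fun_prop) fun _ => ⟨ht, mem_univ _⟩

theorem continuousOn_comp_path
    (hψ : ContinuousOn (fun z : ℝ × ℝ => ψ z.1 z.2) (Ici 0 ×ˢ univ)) {T : ℝ} {x : ℝ → ℝ}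
    (hx : ContinuousOn x (Icc 0 T)) : ContinuousOn (fun s => ψ s (x s)) (Icc 0 T) :=
  hψ.comp (f := fun s => (s, x s)) (continuousOn_id.prodMk hx) fun _ hs => ⟨hs.1, mem_univ _⟩

theorem aemeasurable_comp_prod
    (hψ : ContinuousOn (fun z : ℝ × ℝ => ψ z.1 z.2) (Ici 0 ×ˢ univ)) {T : ℝ} [SFinite P]
    {X : ℝ → Ω → ℝ}
    (hX : AEMeasurable (fun z : ℝ × Ω => X z.1 z.2) ((volume.restrict (Icc 0 T)).prod P)) :
    AEMeasurable (fun z : ℝ × Ω => ψ z.1 (X z.1 z.2)) ((volume.restrict (Icc 0 T)).prod P) := by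
  have h1 := (continuous_clamp hψ).measurable.comp_aemeasurable
    (measurable_fst.aemeasurable.prodMk hX)
  refine h1.congr ?_
  have h4 : ∀ᵐ z ∂((volume.restrict (Icc 0 T)).prod P), (z : ℝ × Ω).1 ∈ Icc 0 T :=
    Measure.quasiMeasurePreserving_fst.ae (ae_restrict_mem measurableSet_Icc)
  filter_upwards [h4] with z hz
  simp [max_eq_left hz.1]

/-! ### The spaces `H^p` and Itô processes -/

theorem MemH.ae_integrableOn {T : ℝ} [SFinite P] {h : ℝ → Ω → ℝ} (hh : MemH P W 1 T h) :
    ∀ᵐ ω ∂P, IntegrableOn (fun s => h s ω) (Icc 0 T) := by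
  filter_upwards [hh.lintegral_lt_top, ae_aemeasurable_path hh.aemeasurable] with ω h1 h2
  refine ⟨h2.aestronglyMeasurable, ?_⟩
  simpa [HasFiniteIntegral] using h1

theorem MemH.ae_memLp {T : ℝ} [SFinite P] {G : ℝ → Ω → ℝ} (hG : MemH P W 2 T G) :
    ∀ᵐ ω ∂P, MemLp (fun s => G s ω) 2 (volume.restrict (Icc 0 T)) := by
  filter_upwards [hG.lintegral_lt_top, ae_aemeasurable_path hG.aemeasurable] with ω h1 h2
  refine ⟨h2.aestronglyMeasurable, ?_⟩
  rw [eLpNorm_lt_top_iff_lintegral_rpow_enorm_lt_top (by simp) (by simp)]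
  simpa using h1

theorem MemH.of_integrableOn {T : ℝ} {h : ℝ → Ω → ℝ}
    (h1 : ∀ t ∈ Icc 0 T, Measurable[augFiltration P W t] (h t))
    (h2 : AEMeasurable (fun z : ℝ × Ω => h z.1 z.2) ((volume.restrict (Icc 0 T)).prod P))
    (h3 : ∀ᵐ ω ∂P, IntegrableOn (fun s => h s ω) (Icc 0 T)) : MemH P W 1 T h := by
  refine ⟨h1, h2, ?_⟩
  filter_upwards [h3] with ω hω
  simpa [HasFiniteIntegral] using hω.2

theorem MemH.of_memLp {T : ℝ} {G : ℝ → Ω → ℝ}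
    (h1 : ∀ t ∈ Icc 0 T, Measurable[augFiltration P W t] (G t))
    (h2 : AEMeasurable (fun z : ℝ × Ω => G z.1 z.2) ((volume.restrict (Icc 0 T)).prod P))
    (h3 : ∀ᵐ ω ∂P, MemLp (fun s => G s ω) 2 (volume.restrict (Icc 0 T))) : MemH P W 2 T G := by
  refine ⟨h1, h2, ?_⟩
  filter_upwards [h3] with ω hω
  have := (eLpNorm_lt_top_iff_lintegral_rpow_enorm_lt_top (by simp) (by simp)).1 hω.2
  simpa using this

theorem HasItoIntegral.measurable {t : ℝ} {G : ℝ → Ω → ℝ} {Y : Ω → ℝ}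
    (h : HasItoIntegral P W t G Y) : Measurable[augFiltration P W t] Y := by
  obtain ⟨S, -, hS⟩ := h
  exact measurable_augFiltration_of_tendstoInMeasure (fun n => (S n).measurable_integral) hS

/-- Only `X 0` is assumed measurable with respect to the filtration; adaptedness at later times is
read off from the integral equation. -/
theorem IsItoProcess.measurable [IsProbabilityMeasure P] (hW : IsBrownianReal W P) {T : ℝ}
    {X h G : ℝ → Ω → ℝ} (hX : IsItoProcess P W T X h G) {t : ℝ} (ht : t ∈ Icc 0 T) :
    Measurable[augFiltration P W t] (X t) := by
  obtain ⟨I, hI, hXI⟩ := hX.eq_integral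
  have hsub : Icc 0 t ⊆ Icc 0 T := Icc_subset_Icc_right ht.2
  have h1 := measurable_augFiltration_intervalIntegral hW ht.1
    (aemeasurable_prod_mono hsub hX.drift_mem.aemeasurable)
    (fun s hs => hX.drift_mem.adapted s (hsub hs))
    (hX.drift_mem.ae_integrableOn.mono fun ω hω => hω.mono_set hsub)
  have h2 := (hI.hasItoIntegral t ht).measurable
  have h3 := hX.measurable_zero.mono (augFiltration_mono ht.1) le_rfl
  refine measurable_augFiltration_congr (Measurable.add (Measurable.add h3 h1) h2) ?_
  filter_upwards [hXI] with ω hω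
  exact (hω t ht).symm

/-! ### Riemann sums along partitions -/

section Riemann

variable {t : ℝ}

theorem IsGrid.intervalIntegrable {N : ℕ} {u : ℕ → ℝ} (hu : IsGrid t N u) {f : ℝ → ℝ}
    (hf : IntegrableOn f (Icc 0 t)) {i : ℕ} (hi : i < N) :
    IntervalIntegrable f volume (u i) (u (i + 1)) := by
  refine IntegrableOn.intervalIntegrable (hf.mono_set ?_)
  rw [uIcc_of_le (hu.lt i hi).le]
  exact Icc_subset_Icc (hu.nonneg i) (hu.le_last hi)

theorem IsGrid.sum_integral {N : ℕ} {u : ℕ → ℝ} (hu : IsGrid t N u) {f : ℝ → ℝ}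
    (hf : IntegrableOn f (Icc 0 t)) :
    ∑ i ∈ Finset.range N, ∫ s in u i..u (i + 1), f s = ∫ s in 0..t, f s := by
  rw [intervalIntegral.sum_integral_adjacent_intervals (a := u)
    fun i hi => hu.intervalIntegrable hf hi, hu.zero, hu.last]

theorem IsGrid.mem_Icc_of_mem_cell {N : ℕ} {u : ℕ → ℝ} (hu : IsGrid t N u) {i : ℕ} (hi : i < N)
    {s : ℝ} (hs : s ∈ Icc (u i) (u (i + 1))) : s ∈ Icc 0 t :=
  ⟨(hu.nonneg i).trans hs.1, hs.2.trans (hu.le_last hi)⟩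

/-- The weights `c i` need not be values of `w`; closeness on the cell suffices. This also covers
the intermediate points produced by the mean value theorem. -/
theorem IsGrid.abs_sum_mul_integral_sub_le {N : ℕ} {u : ℕ → ℝ} (hu : IsGrid t N u)
    {f w : ℝ → ℝ} (hf : IntegrableOn f (Icc 0 t)) (hw : ContinuousOn w (Icc 0 t)) {c : ℕ → ℝ}
    {η : ℝ} (hc : ∀ i < N, ∀ s ∈ Icc (u i) (u (i + 1)), |c i - w s| ≤ η) :
    |∑ i ∈ Finset.range N, c i * (∫ s in u i..u (i + 1), f s) - ∫ s in 0..t, w s * f s|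
      ≤ η * ∫ s in 0..t, |f s| := by
  have hwf : IntegrableOn (fun s => w s * f s) (Icc 0 t) := hf.continuousOn_mul hw isCompact_Icc
  have hfa : IntegrableOn (fun s => |f s|) (Icc 0 t) := hf.abs
  rw [← hu.sum_integral hwf, ← hu.sum_integral hfa, ← Finset.sum_sub_distrib, Finset.mul_sum]
  refine (Finset.abs_sum_le_sum_abs _ _).trans (Finset.sum_le_sum fun i hi => ?_)
  have hi' := Finset.mem_range.1 hi
  have hle := (hu.lt i hi').le
  rw [← intervalIntegral.integral_const_mul, ← intervalIntegral.integral_sub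
    ((hu.intervalIntegrable hf hi').const_mul _) (hu.intervalIntegrable hwf hi'),
    ← intervalIntegral.integral_const_mul]
  refine intervalIntegral.norm_integral_le_of_norm_le (E := ℝ) hle (ae_of_all _ fun s hs => ?_)
    ((hu.intervalIntegrable hfa hi').const_mul _)
  rw [← sub_mul, norm_mul, Real.norm_eq_abs, Real.norm_eq_abs]
  exact mul_le_mul_of_nonneg_right (hc i hi' s (Ioc_subset_Icc_self hs)) (abs_nonneg _)

/-- A sequence of partitions of `[0,t]` whose mesh tends to zero. -/
structure IsGridSeq (t : ℝ) (N : ℕ → ℕ) (u : ℕ → ℕ → ℝ) : Prop where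
  grid : ∀ n, IsGrid t (N n) (u n)
  mesh : ∀ δ > 0, ∀ᶠ n in atTop, ∀ j < N n, u n (j + 1) - u n j ≤ δ

variable {N : ℕ → ℕ} {u : ℕ → ℕ → ℝ}

theorem IsGridSeq.comp (hu : IsGridSeq t N u) {ns : ℕ → ℕ} (hns : StrictMono ns) :
    IsGridSeq t (N ∘ ns) (u ∘ ns) :=
  ⟨fun n => hu.grid (ns n), fun δ hδ => hns.tendsto_atTop.eventually (hu.mesh δ hδ)⟩

/-- Uniform continuity of a continuous function near the graph of a continuous path. -/
theorem exists_forall_abs_sub_le {ψ : ℝ → ℝ → ℝ}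
    (hψ : ContinuousOn (fun z : ℝ × ℝ => ψ z.1 z.2) (Ici 0 ×ˢ univ)) {x : ℝ → ℝ}
    (hx : ContinuousOn x (Icc 0 t)) {η : ℝ} (hη : 0 < η) :
    ∃ δ > 0, ∀ s ∈ Icc 0 t, ∀ r ∈ Icc 0 t, ∀ a ∈ Icc 0 t, ∀ b ∈ Icc 0 t,
      ∀ y ∈ uIcc (x a) (x b), |s - r| ≤ δ → |a - r| ≤ δ → |b - r| ≤ δ →
        |ψ s y - ψ r (x r)| ≤ η := by
  obtain ⟨C, hC⟩ := isCompact_Icc.exists_bound_of_continuousOn hx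
  have hK : IsCompact (Icc (0 : ℝ) t ×ˢ Icc (-C) C) := isCompact_Icc.prod isCompact_Icc
  have hψK := hK.uniformContinuousOn_of_continuous (hψ.mono fun z hz => ⟨hz.1.1, mem_univ _⟩)
  have hxK := isCompact_Icc.uniformContinuousOn_of_continuous hx
  rw [Metric.uniformContinuousOn_iff] at hψK hxK
  obtain ⟨δ₁, hδ₁, h1⟩ := hψK η hη
  obtain ⟨δ₂, hδ₂, h2⟩ := hxK δ₁ hδ₁
  have hδ : 0 < min δ₁ δ₂ / 2 := by positivity
  refine ⟨min δ₁ δ₂ / 2, hδ, fun s hs r hr a ha b hb y hy hsr har hbr => ?_⟩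
  have hlt : min δ₁ δ₂ / 2 < min δ₁ δ₂ := half_lt_self (lt_min hδ₁ hδ₂)
  have hxa := h2 a ha r hr ((har.trans_lt hlt).trans_le (min_le_right _ _))
  have hxb := h2 b hb r hr ((hbr.trans_lt hlt).trans_le (min_le_right _ _))
  have hxC : ∀ a ∈ Icc 0 t, x a ∈ Icc (-C) C := fun a ha => abs_le.1 (hC a ha)
  have hyC : y ∈ Icc (-C) C := uIcc_subset_Icc (hxC a ha) (hxC b hb) hy
  have hyr : dist y (x r) < δ₁ := by
    rw [Real.dist_eq] at *
    rw [abs_lt] at *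
    rcases mem_uIcc.1 hy with h | h <;> constructor <;> linarith [h.1, h.2, hxa.1, hxa.2]
  have h3 := h1 (s, y) ⟨hs, hyC⟩ (r, x r) ⟨hr, hxC r hr⟩ (by
    rw [Prod.dist_eq]
    exact max_lt ((hsr.trans_lt hlt).trans_le (min_le_left _ _)) hyr)
  exact h3.le

theorem exists_forall_abs_sub_le_of_continuousOn {w : ℝ → ℝ} (hw : ContinuousOn w (Icc 0 t))
    {η : ℝ} (hη : 0 < η) :
    ∃ δ > 0, ∀ s ∈ Icc 0 t, ∀ r ∈ Icc 0 t, |s - r| ≤ δ → |w s - w r| ≤ η := by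
  have h := isCompact_Icc.uniformContinuousOn_of_continuous hw
  rw [Metric.uniformContinuousOn_iff] at h
  obtain ⟨δ, hδ, h1⟩ := h η hη
  exact ⟨δ / 2, half_pos hδ, fun s hs r hr hsr =>
    (h1 s hs r hr (hsr.trans_lt (half_lt_self hδ))).le⟩

theorem abs_sub_le_of_mem_cell {a b δ r s : ℝ} (h : b - a ≤ δ) (hr : r ∈ Icc a b)
    (hs : s ∈ Icc a b) : |r - s| ≤ δ :=
  abs_le.2 ⟨by linarith [hr.1, hs.2], by linarith [hr.2, hs.1]⟩

theorem tendsto_of_forall_eventually_abs_sub_le {y : ℕ → ℝ} {l M : ℝ}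
    (h : ∀ η > 0, ∀ᶠ n in atTop, |y n - l| ≤ η * M) : Tendsto y atTop (𝓝 l) := by
  rw [Metric.tendsto_nhds]
  intro ε hε
  have hM : 0 < |M| + 1 := by positivity
  filter_upwards [h (ε / (|M| + 1) / 2) (by positivity)] with n hn
  rw [Real.dist_eq]
  have h1 : ε / (|M| + 1) / 2 * M ≤ ε / (|M| + 1) / 2 * (|M| + 1) :=
    mul_le_mul_of_nonneg_left (by linarith [le_abs_self M]) (by positivity)
  have h2 : ε / (|M| + 1) / 2 * (|M| + 1) = ε / 2 := by field_simp
  linarith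

theorem IsGridSeq.tendsto_sum_mul_integral (hu : IsGridSeq t N u) {f w : ℝ → ℝ}
    (hf : IntegrableOn f (Icc 0 t)) (hw : ContinuousOn w (Icc 0 t)) :
    Tendsto (fun n => ∑ i ∈ Finset.range (N n), w (u n i) * ∫ s in u n i..u n (i + 1), f s)
      atTop (𝓝 (∫ s in 0..t, w s * f s)) := by
  refine tendsto_of_forall_eventually_abs_sub_le (M := ∫ s in 0..t, |f s|) fun η hη => ?_
  obtain ⟨δ, hδ, h1⟩ := exists_forall_abs_sub_le_of_continuousOn hw hη
  filter_upwards [hu.mesh δ hδ] with n hn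
  refine (hu.grid n).abs_sum_mul_integral_sub_le hf hw fun i hi s hs => ?_
  have hle := ((hu.grid n).lt i hi).le
  exact h1 _ ((hu.grid n).mem_Icc hi.le) s ((hu.grid n).mem_Icc_of_mem_cell hi hs)
    (abs_sub_le_of_mem_cell (hn i hi) ⟨le_rfl, hle⟩ hs)

/-- The primitive of `|f|` is uniformly continuous on `[0,t]`. -/
theorem IsGridSeq.eventually_integral_abs_le (hu : IsGridSeq t N u) {f : ℝ → ℝ}
    (hf : IntegrableOn f (Icc 0 t)) {η : ℝ} (hη : 0 < η) :
    ∀ᶠ n in atTop, ∀ i < N n, ∫ s in u n i..u n (i + 1), |f s| ≤ η := by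
  have ht : 0 ≤ t := by
    have := (hu.grid 0).le_last (Nat.zero_le _)
    rwa [(hu.grid 0).zero] at this
  have hfa : IntegrableOn (fun s => |f s|) (Icc 0 t) := hf.abs
  have hcont : ContinuousOn (fun s => ∫ r in 0..s, |f r|) (Icc 0 t) := by
    have := intervalIntegral.continuousOn_primitive_interval (μ := volume) (f := fun s => |f s|)
      (a := 0) (b := t) (by rwa [uIcc_of_le ht])
    rwa [uIcc_of_le ht] at this
  obtain ⟨δ, hδ, h1⟩ := exists_forall_abs_sub_le_of_continuousOn hcont hη
  filter_upwards [hu.mesh δ hδ] with n hn i hi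
  have hg := hu.grid n
  have hle := (hg.lt i hi).le
  have hI : ∀ j ≤ N n, IntervalIntegrable (fun s => |f s|) volume 0 (u n j) := fun j hj => by
    refine IntegrableOn.intervalIntegrable (hfa.mono_set ?_)
    rw [uIcc_of_le (hg.nonneg j)]
    exact Icc_subset_Icc_right (hg.le_last hj)
  rw [← intervalIntegral.integral_interval_sub_left (hI _ hi) (hI _ hi.le)]
  exact (le_abs_self _).trans (h1 _ (hg.mem_Icc hi) _ (hg.mem_Icc hi.le)
    (abs_sub_le_of_mem_cell (hn i hi) ⟨hle, le_rfl⟩ ⟨le_rfl, hle⟩))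

/-- The sum is at most the largest cell integral of `|f|` times `∫ |f|`. -/
theorem IsGridSeq.tendsto_sum_integral_sq (hu : IsGridSeq t N u) {f : ℝ → ℝ}
    (hf : IntegrableOn f (Icc 0 t)) :
    Tendsto (fun n => ∑ i ∈ Finset.range (N n), (∫ s in u n i..u n (i + 1), f s) ^ 2)
      atTop (𝓝 0) := by
  refine tendsto_of_forall_eventually_abs_sub_le (M := ∫ s in 0..t, |f s|) fun η hη => ?_
  filter_upwards [hu.eventually_integral_abs_le hf hη] with n hn
  have hg := hu.grid n
  have hfa : IntegrableOn (fun s => |f s|) (Icc 0 t) := hf.abs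
  rw [sub_zero, abs_of_nonneg (Finset.sum_nonneg fun _ _ => sq_nonneg _), ← hg.sum_integral hfa,
    Finset.mul_sum]
  refine Finset.sum_le_sum fun i hi => ?_
  have hi' := Finset.mem_range.1 hi
  have h1 : |∫ s in u n i..u n (i + 1), f s| ≤ ∫ s in u n i..u n (i + 1), |f s| :=
    intervalIntegral.abs_integral_le_integral_abs (hg.lt i hi').le
  rw [← sq_abs, sq]
  exact mul_le_mul (h1.trans (hn i hi')) h1 (abs_nonneg _) hη.le

/-- If `|y n| ≤ κ A n + (1 + 1/κ) B n` for all `κ > 0`, `A` converges and `B` tends to zero, then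
`y` tends to zero. -/
theorem tendsto_zero_of_forall_abs_le {y A B : ℕ → ℝ} {a : ℝ}
    (h : ∀ κ > 0, ∀ n, |y n| ≤ κ * A n + (1 + 1 / κ) * B n) (hA : Tendsto A atTop (𝓝 a))
    (hB : Tendsto B atTop (𝓝 0)) : Tendsto y atTop (𝓝 0) := by
  refine tendsto_of_forall_eventually_abs_sub_le (M := a + 2) fun η hη => ?_
  have hB' : Tendsto (fun n => (1 + 1 / η) * B n) atTop (𝓝 0) := by
    simpa using hB.const_mul (1 + 1 / η)
  filter_upwards [hA.eventually (gt_mem_nhds (lt_add_one a)),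
    hB'.eventually (gt_mem_nhds hη)] with n h1 h2
  rw [sub_zero]
  nlinarith [h η hη n]

theorem abs_two_mul_add_sq_le {κ : ℝ} (hκ : 0 < κ) (a b : ℝ) :
    |2 * a * b + b ^ 2| ≤ κ * a ^ 2 + (1 + 1 / κ) * b ^ 2 := by
  have h1 : 2 * |a| * |b| ≤ κ * a ^ 2 + 1 / κ * b ^ 2 := by
    have h2 : 0 ≤ 1 / κ * (κ * |a| - |b|) ^ 2 := by positivity
    have h3 : 1 / κ * (κ * |a| - |b|) ^ 2 = κ * |a| ^ 2 - 2 * |a| * |b| + 1 / κ * |b| ^ 2 := by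
      field_simp
      ring
    rw [h3, sq_abs, sq_abs] at h2
    linarith
  have h4 : |2 * a * b + b ^ 2| ≤ 2 * |a| * |b| + b ^ 2 := by
    refine (abs_add_le _ _).trans ?_
    rw [abs_mul, abs_mul, abs_two, abs_of_nonneg (sq_nonneg b)]
  linarith

/-! ### Approximation of a square integrable path by step functions -/

variable {g : ℝ → ℝ} {e : ℕ → ℕ → ℝ}

/-- Write `e² - g² = 2g(e - g) + (e - g)²` and absorb the mixed term by Young's inequality with a
free parameter `κ`. -/
theorem IsGridSeq.tendsto_sum_abs_sq_mul_sub (hu : IsGridSeq t N u)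
    (hg : MemLp g 2 (volume.restrict (Icc 0 t)))
    (he : Tendsto (fun n => ∑ i ∈ Finset.range (N n), ∫ s in u n i..u n (i + 1), (e n i - g s) ^ 2)
      atTop (𝓝 0)) :
    Tendsto (fun n => ∑ i ∈ Finset.range (N n),
      |e n i ^ 2 * (u n (i + 1) - u n i) - ∫ s in u n i..u n (i + 1), g s ^ 2|) atTop (𝓝 0) := by
  have hg2 : IntegrableOn (fun s => g s ^ 2) (Icc 0 t) := hg.integrable_sq
  refine tendsto_zero_of_forall_abs_le (A := fun _ => ∫ s in 0..t, g s ^ 2) (fun κ hκ n => ?_)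
    tendsto_const_nhds he
  have hgr := hu.grid n
  rw [abs_of_nonneg (Finset.sum_nonneg fun _ _ => abs_nonneg _), ← hgr.sum_integral hg2,
    Finset.mul_sum, Finset.mul_sum, ← Finset.sum_add_distrib]
  refine Finset.sum_le_sum fun i hi => ?_
  have hi' := Finset.mem_range.1 hi
  have hd2 : IntegrableOn (fun s => (e n i - g s) ^ 2) (Icc 0 t) :=
    ((memLp_const (e n i)).sub hg).integrable_sq
  have hc2 : IntegrableOn (fun _ => e n i ^ 2) (Icc 0 t) :=
    integrableOn_const (by simp)
  have i1 := hgr.intervalIntegrable hg2 hi'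
  have i2 := hgr.intervalIntegrable hd2 hi'
  have i3 := hgr.intervalIntegrable hc2 hi'
  have h1 : e n i ^ 2 * (u n (i + 1) - u n i) - ∫ s in u n i..u n (i + 1), g s ^ 2
      = ∫ s in u n i..u n (i + 1), (e n i ^ 2 - g s ^ 2) := by
    rw [intervalIntegral.integral_sub i3 i1, intervalIntegral.integral_const, smul_eq_mul, mul_comm]
  rw [h1, ← intervalIntegral.integral_const_mul, ← intervalIntegral.integral_const_mul,
    ← intervalIntegral.integral_add (i1.const_mul _) (i2.const_mul _)]
  refine intervalIntegral.norm_integral_le_of_norm_le (E := ℝ) (hgr.lt i hi').le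
    (ae_of_all _ fun s _ => ?_) ((i1.const_mul _).add (i2.const_mul _))
  rw [Real.norm_eq_abs, show e n i ^ 2 - g s ^ 2 = 2 * g s * (e n i - g s) + (e n i - g s) ^ 2 by
    ring]
  exact abs_two_mul_add_sq_le hκ _ _

theorem IsGridSeq.tendsto_sum_mul_sq_mul (hu : IsGridSeq t N u)
    (hg : MemLp g 2 (volume.restrict (Icc 0 t)))
    (he : Tendsto (fun n => ∑ i ∈ Finset.range (N n), ∫ s in u n i..u n (i + 1), (e n i - g s) ^ 2)
      atTop (𝓝 0)) {w : ℝ → ℝ} (hw : ContinuousOn w (Icc 0 t)) :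
    Tendsto (fun n => ∑ i ∈ Finset.range (N n), w (u n i) *
      (e n i ^ 2 * (u n (i + 1) - u n i))) atTop (𝓝 (∫ s in 0..t, w s * g s ^ 2)) := by
  have hg2 : IntegrableOn (fun s => g s ^ 2) (Icc 0 t) := hg.integrable_sq
  obtain ⟨C, hC⟩ := isCompact_Icc.exists_bound_of_continuousOn hw
  have h1 := hu.tendsto_sum_mul_integral hg2 hw
  have h2 : Tendsto (fun n => ∑ i ∈ Finset.range (N n), w (u n i) *
      (e n i ^ 2 * (u n (i + 1) - u n i) - ∫ s in u n i..u n (i + 1), g s ^ 2)) atTop (𝓝 0) := by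
    have h3 := (hu.tendsto_sum_abs_sq_mul_sub hg he).const_mul C
    rw [mul_zero] at h3
    refine squeeze_zero_norm (fun n => ?_) h3
    rw [Real.norm_eq_abs, Finset.mul_sum]
    refine (Finset.abs_sum_le_sum_abs _ _).trans (Finset.sum_le_sum fun i hi => ?_)
    rw [abs_mul]
    exact mul_le_mul_of_nonneg_right (hC _ ((hu.grid n).mem_Icc (Finset.mem_range.1 hi).le))
      (abs_nonneg _)
  have h4 := h1.add h2
  rw [add_zero] at h4
  refine h4.congr fun n => ?_
  rw [← Finset.sum_add_distrib]
  exact Finset.sum_congr rfl fun i _ => by ring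

/-- Each `e² Δu` is uniformly small, being close to `∫ g²` over a cell, while the weighted sum of
the `e² Δu` stays bounded. The bracket of the noise `(ΔW)² - Δu` with coefficients `w e²` has this
form, so square integrability of `g` suffices. -/
theorem IsGridSeq.tendsto_sum_mul_sq_mul_sq (hu : IsGridSeq t N u)
    (hg : MemLp g 2 (volume.restrict (Icc 0 t)))
    (he : Tendsto (fun n => ∑ i ∈ Finset.range (N n), ∫ s in u n i..u n (i + 1), (e n i - g s) ^ 2)
      atTop (𝓝 0)) {w : ℝ → ℝ} (hw : ContinuousOn w (Icc 0 t)) :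
    Tendsto (fun n => ∑ i ∈ Finset.range (N n), w (u n i) *
      (e n i ^ 2 * (u n (i + 1) - u n i)) ^ 2) atTop (𝓝 0) := by
  have hg2 : IntegrableOn (fun s => g s ^ 2) (Icc 0 t) := hg.integrable_sq
  have h1 := hu.tendsto_sum_abs_sq_mul_sub hg he
  have h2 := hu.tendsto_sum_mul_sq_mul hg he (hw.abs)
  refine tendsto_of_forall_eventually_abs_sub_le
    (M := 2 * ((∫ s in 0..t, |w s| * g s ^ 2) + 1)) fun η hη => ?_
  filter_upwards [h1.eventually (gt_mem_nhds hη), h2.eventually (gt_mem_nhds (lt_add_one _)),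
    hu.eventually_integral_abs_le hg2 hη] with n h3 h4 h5
  have hgr := hu.grid n
  have hsmall : ∀ i ∈ Finset.range (N n), e n i ^ 2 * (u n (i + 1) - u n i) ≤ 2 * η := by
    intro i hi
    have h6 := (Finset.single_le_sum (f := fun i => |e n i ^ 2 * (u n (i + 1) - u n i) -
      ∫ s in u n i..u n (i + 1), g s ^ 2|) (fun _ _ => abs_nonneg _) hi).trans h3.le
    have h7 := h5 i (Finset.mem_range.1 hi)
    simp only [abs_of_nonneg (sq_nonneg (g _))] at h7
    linarith [(abs_le.1 h6).2]
  have hpos : ∀ i ∈ Finset.range (N n), 0 ≤ e n i ^ 2 * (u n (i + 1) - u n i) := fun i hi =>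
    mul_nonneg (sq_nonneg _) (sub_nonneg.2 (hgr.lt i (Finset.mem_range.1 hi)).le)
  rw [sub_zero]
  calc |∑ i ∈ Finset.range (N n), w (u n i) * (e n i ^ 2 * (u n (i + 1) - u n i)) ^ 2|
      ≤ ∑ i ∈ Finset.range (N n), 2 * η *
        (|w (u n i)| * (e n i ^ 2 * (u n (i + 1) - u n i))) := by
        refine (Finset.abs_sum_le_sum_abs _ _).trans (Finset.sum_le_sum fun i hi => ?_)
        rw [abs_mul, abs_of_nonneg (sq_nonneg (e n i ^ 2 * (u n (i + 1) - u n i))), sq]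
        nlinarith [mul_le_mul_of_nonneg_left (hsmall i hi)
          (mul_nonneg (abs_nonneg (w (u n i))) (hpos i hi))]
    _ ≤ η * (2 * ((∫ s in 0..t, |w s| * g s ^ 2) + 1)) := by
        rw [← Finset.mul_sum]
        nlinarith

end Riemann

/-! ### Taylor expansions -/

theorem IsC12.exists_partialT_eq {F : ℝ → ℝ → ℝ} (hF : IsC12 F) {a b : ℝ} (ha : 0 ≤ a)
    (hab : a < b) (y : ℝ) : ∃ θ ∈ Ioo a b, F b y - F a y = partialT F θ y * (b - a) := by
  have hsub : Icc a b ⊆ Ici 0 := fun s hs => ha.trans hs.1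
  obtain ⟨θ, hθ, h⟩ := exists_hasDerivAt_eq_slope (fun s => F s y) (fun s => partialT F s y) hab
    -- At interior points `s > a ≥ 0` the one-sided derivative is a genuine derivative.
    ((hF.differentiable_t y).continuousOn.mono hsub) (fun s hs => by
      have hs0 : 0 < s := ha.trans_lt hs.1
      exact (((hF.differentiable_t y) s hs0.le).hasDerivWithinAt).hasDerivAt (Ici_mem_nhds hs0))
  refine ⟨θ, hθ, ?_⟩
  rw [h]
  field_simp [(sub_pos.2 hab).ne']

/-- The mean value inequality is applied twice to `f` minus its quadratic Taylor polynomial at `a`;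
the sharper constant `η / 2` is not needed. -/
theorem abs_taylor_two_le {f f' f'' : ℝ → ℝ} (hf : ∀ y, HasDerivAt f (f' y) y)
    (hf' : ∀ y, HasDerivAt f' (f'' y) y) {a b η : ℝ}
    (hη : ∀ y ∈ uIcc a b, |f'' y - f'' a| ≤ η) :
    |f b - f a - f' a * (b - a) - 1 / 2 * f'' a * (b - a) ^ 2| ≤ η * (b - a) ^ 2 := by
  have hη0 : 0 ≤ η := (abs_nonneg _).trans (hη a left_mem_uIcc)
  set k' : ℝ → ℝ := fun y => f' y - f' a - f'' a * (y - a) with hk'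
  have d1 : ∀ y, HasDerivAt k' (f'' y - f'' a) y := fun y => by
    have := ((hf' y).sub_const (f' a)).sub (((hasDerivAt_id y).sub_const a).const_mul (f'' a))
    exact this.congr_deriv (by simp)
  set k : ℝ → ℝ := fun y => f y - f' a * (y - a) - 1 / 2 * f'' a * (y - a) ^ 2 with hk
  have d0 : ∀ y, HasDerivAt k (k' y) y := fun y => by
    have h1 := (((hasDerivAt_id y).sub_const a).pow 2).const_mul (1 / 2 * f'' a)
    have h2 := ((hasDerivAt_id y).sub_const a).const_mul (f' a)
    refine (((hf y).sub h2).sub h1).congr_deriv ?_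
    simp only [hk', id, mul_one, Nat.cast_ofNat, Nat.add_one_sub_one, pow_one]
    ring
  have hconv : Convex ℝ (uIcc a b) := convex_uIcc a b
  have b1 : ∀ y ∈ uIcc a b, ‖k' y‖ ≤ η * |b - a| := by
    intro y hy
    have h1 := hconv.norm_image_sub_le_of_norm_hasDerivWithin_le (f := k')
      (fun z _ => (d1 z).hasDerivWithinAt) (fun z hz => hη z hz) left_mem_uIcc hy
    have h2 : k' a = 0 := by simp [hk']
    rw [h2, sub_zero, Real.norm_eq_abs (y - a)] at h1
    exact h1.trans (mul_le_mul_of_nonneg_left (abs_sub_left_of_mem_uIcc hy) hη0)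
  have h3 := hconv.norm_image_sub_le_of_norm_hasDerivWithin_le (f := k)
    (fun z _ => (d0 z).hasDerivWithinAt) b1 left_mem_uIcc right_mem_uIcc
  have h4 : k b - k a = f b - f a - f' a * (b - a) - 1 / 2 * f'' a * (b - a) ^ 2 := by
    simp only [hk]; ring
  rw [h4, Real.norm_eq_abs, Real.norm_eq_abs] at h3
  have h5 : η * |b - a| * |b - a| = η * (b - a) ^ 2 := by
    rw [mul_assoc, ← sq, sq_abs]
  exact h3.trans_eq h5

/-! ### The pathwise part of Itô's formula -/

section Pathwise

variable {t : ℝ} {N : ℕ → ℕ} {u : ℕ → ℕ → ℝ} {F : ℝ → ℝ → ℝ} {x : ℝ → ℝ}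

theorem IsGridSeq.tendsto_sum_time (hu : IsGridSeq t N u) (hF : IsC12 F)
    (hx : ContinuousOn x (Icc 0 t)) :
    Tendsto (fun n => ∑ i ∈ Finset.range (N n),
      (F (u n (i + 1)) (x (u n (i + 1))) - F (u n i) (x (u n (i + 1))))) atTop
      (𝓝 (∫ s in 0..t, partialT F s (x s))) := by
  have hone : IntegrableOn (fun _ : ℝ => (1 : ℝ)) (Icc 0 t) := integrableOn_const (by simp)
  refine tendsto_of_forall_eventually_abs_sub_le (M := ∫ s in 0..t, |(1 : ℝ)|) fun η hη => ?_
  obtain ⟨δ, hδ, h1⟩ := exists_forall_abs_sub_le hF.continuousOn_t hx hη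
  filter_upwards [hu.mesh δ hδ] with n hn
  have hg := hu.grid n
  have hθ : ∀ i, ∃ θ, i < N n → θ ∈ Ioo (u n i) (u n (i + 1)) ∧
      F (u n (i + 1)) (x (u n (i + 1))) - F (u n i) (x (u n (i + 1)))
        = partialT F θ (x (u n (i + 1))) * (u n (i + 1) - u n i) := fun i => by
    by_cases hi : i < N n
    · obtain ⟨θ, h2, h3⟩ := hF.exists_partialT_eq (hg.nonneg i) (hg.lt i hi) (x (u n (i + 1)))
      exact ⟨θ, fun _ => ⟨h2, h3⟩⟩
    · exact ⟨0, fun h => absurd h hi⟩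
  choose θ hθ using hθ
  have h4 := hg.abs_sum_mul_integral_sub_le hone (continuousOn_comp_path hF.continuousOn_t hx)
    (c := fun i => partialT F (θ i) (x (u n (i + 1)))) (η := η) (fun i hi s hs => by
      have hle := (hg.lt i hi).le
      have hθi := Ioo_subset_Icc_self (hθ i hi).1
      exact h1 _ (hg.mem_Icc_of_mem_cell hi hθi) s (hg.mem_Icc_of_mem_cell hi hs) _
        (hg.mem_Icc hi) _ (hg.mem_Icc hi) _ left_mem_uIcc
        (abs_sub_le_of_mem_cell (hn i hi) hθi hs)
        (abs_sub_le_of_mem_cell (hn i hi) ⟨hle, le_rfl⟩ hs)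
        (abs_sub_le_of_mem_cell (hn i hi) ⟨hle, le_rfl⟩ hs))
  simp only [mul_one] at h4
  rwa [Finset.sum_congr rfl fun i hi => by
    rw [intervalIntegral.integral_const, smul_eq_mul, mul_one,
      ← (hθ i (Finset.mem_range.1 hi)).2]] at h4

/-- The remainder is at most `η ∑ (Δx)²`, with `η` the oscillation of `∂²ₓF` near the graph, so a
bound on the quadratic variation sums is enough. -/
theorem IsGridSeq.tendsto_sum_taylor (hu : IsGridSeq t N u) (hF : IsC12 F)
    (hx : ContinuousOn x (Icc 0 t)) {q : ℝ} (hq : ∀ᶠ n in atTop,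
      ∑ i ∈ Finset.range (N n), (x (u n (i + 1)) - x (u n i)) ^ 2 ≤ q) :
    Tendsto (fun n => ∑ i ∈ Finset.range (N n),
      (F (u n i) (x (u n (i + 1))) - F (u n i) (x (u n i))
        - partialX F (u n i) (x (u n i)) * (x (u n (i + 1)) - x (u n i))
        - 1 / 2 * partialXX F (u n i) (x (u n i)) * (x (u n (i + 1)) - x (u n i)) ^ 2))
      atTop (𝓝 0) := by
  refine tendsto_of_forall_eventually_abs_sub_le (M := q) fun η hη => ?_
  obtain ⟨δ, hδ, h1⟩ := exists_forall_abs_sub_le hF.continuousOn_xx hx hη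
  filter_upwards [hu.mesh δ hδ, hq] with n hn hqn
  have hg := hu.grid n
  rw [sub_zero]
  refine le_trans ?_ (mul_le_mul_of_nonneg_left hqn hη.le)
  rw [Finset.mul_sum]
  refine (Finset.abs_sum_le_sum_abs _ _).trans (Finset.sum_le_sum fun i hi => ?_)
  have hi' := Finset.mem_range.1 hi
  have hle := (hg.lt i hi').le
  refine abs_taylor_two_le (f := F (u n i)) (f' := partialX F (u n i))
    (f'' := partialXX F (u n i))
    (fun y => (hF.differentiable_x _ (hg.nonneg i) y).hasDerivAt)
    (fun y => (hF.differentiable_xx _ (hg.nonneg i) y).hasDerivAt) fun y hy => ?_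
  exact h1 _ (hg.mem_Icc hi'.le) _ (hg.mem_Icc hi'.le) _ (hg.mem_Icc hi'.le) _ (hg.mem_Icc hi')
    _ hy (by simpa using hδ.le) (by simpa using hδ.le)
    (abs_sub_le_of_mem_cell (hn i hi') ⟨hle, le_rfl⟩ ⟨le_rfl, hle⟩)

/-- The deterministic part of the proof of Itô's formula: if the cell errors of the approximation
of the increments of `x` by `∫ h ds + e ξ` are negligible, and the squares of the increments `ξ` may
be replaced by the lengths of the cells, then the Riemann-Itô sums `∑ ∂ₓF e ξ` converge. -/
theorem IsGridSeq.tendsto_sum_partialX_mul (hu : IsGridSeq t N u) (hF : IsC12 F)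
    (hx : ContinuousOn x (Icc 0 t)) {h g : ℝ → ℝ} {e ξ r : ℕ → ℕ → ℝ}
    (hh : IntegrableOn h (Icc 0 t)) (hg : MemLp g 2 (volume.restrict (Icc 0 t)))
    (he : Tendsto (fun n => ∑ i ∈ Finset.range (N n), ∫ s in u n i..u n (i + 1), (e n i - g s) ^ 2)
      atTop (𝓝 0))
    (hr : ∀ n, ∀ i < N n, x (u n (i + 1)) - x (u n i)
      = (∫ s in u n i..u n (i + 1), h s) + e n i * ξ n i + r n i)
    (h1 : Tendsto (fun n => ∑ i ∈ Finset.range (N n), partialX F (u n i) (x (u n i)) * r n i)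
      atTop (𝓝 0))
    (h2 : Tendsto (fun n => ∑ i ∈ Finset.range (N n), r n i ^ 2) atTop (𝓝 0))
    (h3 : Tendsto (fun n => ∑ i ∈ Finset.range (N n), partialXX F (u n i) (x (u n i)) *
      e n i ^ 2 * (ξ n i ^ 2 - (u n (i + 1) - u n i))) atTop (𝓝 0))
    (h4 : Tendsto (fun n => ∑ i ∈ Finset.range (N n),
      e n i ^ 2 * (ξ n i ^ 2 - (u n (i + 1) - u n i))) atTop (𝓝 0)) :
    Tendsto (fun n => ∑ i ∈ Finset.range (N n),
      partialX F (u n i) (x (u n i)) * e n i * ξ n i) atTop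
      (𝓝 (F t (x t) - F 0 (x 0) - ∫ s in 0..t, (partialT F s (x s) + partialX F s (x s) * h s
        + 1 / 2 * partialXX F s (x s) * g s ^ 2))) := by
  have ht : 0 ≤ t := by
    have := (hu.grid 0).le_last (Nat.zero_le _)
    rwa [(hu.grid 0).zero] at this
  have hct := continuousOn_comp_path hF.continuousOn_t hx
  have hcx := continuousOn_comp_path hF.continuousOn_x hx
  have hcxx := continuousOn_comp_path hF.continuousOn_xx hx
  have hg2 : IntegrableOn (fun s => g s ^ 2) (Icc 0 t) := hg.integrable_sq
  -- `b` is the part of the increment of `x` other than `e ξ`; it is negligible in the sense of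
  -- square sums.
  set b : ℕ → ℕ → ℝ := fun n i => (∫ s in u n i..u n (i + 1), h s) + r n i with hb
  have hB : Tendsto (fun n => ∑ i ∈ Finset.range (N n), b n i ^ 2) atTop (𝓝 0) := by
    have h5 := ((hu.tendsto_sum_integral_sq hh).const_mul 2).add (h2.const_mul 2)
    rw [mul_zero, add_zero] at h5
    refine squeeze_zero (fun n => Finset.sum_nonneg fun _ _ => sq_nonneg _) (fun n => ?_) h5
    rw [Finset.mul_sum, Finset.mul_sum, ← Finset.sum_add_distrib]
    refine Finset.sum_le_sum fun i _ => ?_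
    simp only [hb]
    nlinarith [sq_nonneg ((∫ s in u n i..u n (i + 1), h s) - r n i)]
  -- Replacing `ξ²` by the cell length turns the sum into a Riemann sum for `∫ w g²`; it is used
  -- with `w = 1` and with `w = ∂²ₓF` along the path.
  have hA : ∀ {w : ℝ → ℝ}, ContinuousOn w (Icc 0 t) →
      Tendsto (fun n => ∑ i ∈ Finset.range (N n), w (u n i) *
        e n i ^ 2 * (ξ n i ^ 2 - (u n (i + 1) - u n i))) atTop (𝓝 0) →
      Tendsto (fun n => ∑ i ∈ Finset.range (N n), w (u n i) * (e n i * ξ n i) ^ 2) atTop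
        (𝓝 (∫ s in 0..t, w s * g s ^ 2)) := by
    intro w hw hlim
    have h5 := (hu.tendsto_sum_mul_sq_mul hg he hw).add hlim
    rw [add_zero] at h5
    refine h5.congr fun n => ?_
    rw [← Finset.sum_add_distrib]
    exact Finset.sum_congr rfl fun i _ => by ring
  have hA1 : Tendsto (fun n => ∑ i ∈ Finset.range (N n), (e n i * ξ n i) ^ 2) atTop
      (𝓝 (∫ s in 0..t, g s ^ 2)) := by
    simpa only [one_mul] using hA (w := fun _ => 1) continuousOn_const
      (by simpa only [one_mul] using h4)
  have hAxx := hA hcxx h3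
  have hdx : ∀ n, ∀ i ∈ Finset.range (N n),
      x (u n (i + 1)) - x (u n i) = e n i * ξ n i + b n i := fun n i hi => by
    rw [hr n i (Finset.mem_range.1 hi)]
    simp only [hb]
    ring
  have hq : ∀ᶠ n in atTop, ∑ i ∈ Finset.range (N n), (x (u n (i + 1)) - x (u n i)) ^ 2
      ≤ 2 * ((∫ s in 0..t, g s ^ 2) + 1) + 2 := by
    filter_upwards [hA1.eventually (gt_mem_nhds (lt_add_one _)),
      hB.eventually (gt_mem_nhds one_pos)] with n h5 h6
    have h7 : ∑ i ∈ Finset.range (N n), (x (u n (i + 1)) - x (u n i)) ^ 2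
        ≤ 2 * ∑ i ∈ Finset.range (N n), (e n i * ξ n i) ^ 2
          + 2 * ∑ i ∈ Finset.range (N n), b n i ^ 2 := by
      rw [Finset.mul_sum, Finset.mul_sum, ← Finset.sum_add_distrib]
      refine Finset.sum_le_sum fun i hi => ?_
      rw [hdx n i hi]
      nlinarith [sq_nonneg (e n i * ξ n i - b n i)]
    linarith
  -- The difference between `(Δx)²` and `(e ξ)²` is `2 (e ξ) b + b²`. Young's inequality suffices,
  -- as `∑ (e ξ)²` converges and `∑ b²` vanishes.
  have hcross : Tendsto (fun n => ∑ i ∈ Finset.range (N n), partialXX F (u n i) (x (u n i)) *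
      (2 * (e n i * ξ n i) * b n i + b n i ^ 2)) atTop (𝓝 0) := by
    obtain ⟨C, hC⟩ := isCompact_Icc.exists_bound_of_continuousOn hcxx
    have hC0 : 0 ≤ C := (norm_nonneg _).trans (hC 0 ⟨le_rfl, ht⟩)
    refine tendsto_zero_of_forall_abs_le (fun κ hκ n => ?_) (hA1.const_mul C)
      (by simpa using hB.const_mul C)
    rw [mul_left_comm, mul_left_comm _ C, ← mul_add, Finset.mul_sum _ _ κ,
      Finset.mul_sum _ _ (1 + 1 / κ), ← Finset.sum_add_distrib, Finset.mul_sum]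
    refine (Finset.abs_sum_le_sum_abs _ _).trans (Finset.sum_le_sum fun i hi => ?_)
    rw [abs_mul]
    exact mul_le_mul (hC _ ((hu.grid n).mem_Icc (Finset.mem_range.1 hi).le))
      (abs_two_mul_add_sq_le hκ _ _) (abs_nonneg _) hC0
  have hlim := (((hu.tendsto_sum_time hF hx).add (hu.tendsto_sum_taylor hF hx hq)).add
    (((hu.tendsto_sum_mul_integral hh hcx).add h1).add
      ((hAxx.add hcross).const_mul (1 / 2)))).const_sub (F t (x t) - F 0 (x 0))
  have hI : ∫ s in 0..t, (partialT F s (x s) + partialX F s (x s) * h s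
        + 1 / 2 * partialXX F s (x s) * g s ^ 2)
      = (∫ s in 0..t, partialT F s (x s)) + (∫ s in 0..t, partialX F s (x s) * h s)
        + 1 / 2 * ∫ s in 0..t, partialXX F s (x s) * g s ^ 2 := by
    have hII : ∀ {f : ℝ → ℝ}, IntegrableOn f (Icc 0 t) → IntervalIntegrable f volume 0 t :=
      fun hf => IntegrableOn.intervalIntegrable (by rwa [uIcc_of_le ht])
    have i1 := hII (hct.integrableOn_Icc)
    have i2 := hII (hh.continuousOn_mul hcx isCompact_Icc)
    have i3 := hII (hg2.continuousOn_mul hcxx isCompact_Icc)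
    rw [← intervalIntegral.integral_const_mul, ← intervalIntegral.integral_add i1 i2,
      ← intervalIntegral.integral_add (i1.add i2) (i3.const_mul _)]
    simp only [mul_assoc]
  rw [hI]
  -- For each `n` this is an algebraic identity: the telescoped increment of `F` minus the time
  -- terms, the Taylor remainders, `∂ₓF (∫ h + r)` and the second order terms leaves exactly `∂ₓF e
  -- ξ`.
  convert hlim using 2 with n
  · have htel : F t (x t) - F 0 (x 0) = ∑ i ∈ Finset.range (N n),
        (F (u n (i + 1)) (x (u n (i + 1))) - F (u n i) (x (u n i))) := by
      rw [Finset.sum_range_sub (fun i => F (u n i) (x (u n i))), (hu.grid n).zero,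
        (hu.grid n).last]
    rw [htel]
    simp only [Finset.mul_sum, ← Finset.sum_add_distrib, ← Finset.sum_sub_distrib]
    refine Finset.sum_congr rfl fun i hi => ?_
    rw [hdx n i hi]
    simp only [hb]
    ring
  · ring

end Pathwise

/-! ### Convergence in probability of the error terms -/

theorem tendstoInMeasure_zero_of_sq {f : ℕ → Ω → ℝ}
    (h : ∀ ε > 0, Tendsto (fun n => P {ω | ε ≤ f n ω ^ 2}) atTop (𝓝 0)) :
    TendstoInMeasure P f atTop (fun _ => 0) := by
  rw [tendstoInMeasure_iff_norm]
  intro ε hε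
  refine tendsto_of_tendsto_of_tendsto_of_le_of_le tendsto_const_nhds (h (ε ^ 2) (by positivity))
    (fun _ => zero_le) fun n => measure_mono fun ω hω => ?_
  rw [mem_ofPred_eq, sub_zero, Real.norm_eq_abs] at hω
  rw [mem_ofPred_eq, ← sq_abs (f n ω)]
  exact pow_le_pow_left₀ hε.le hω 2

theorem aemeasurable_step [SFinite P] {N : ℕ} {u : ℕ → ℝ} {c : ℕ → Ω → ℝ}
    (hc : ∀ i < N, AEMeasurable (c i) P) (ν : Measure ℝ) [SFinite ν] :
    AEMeasurable (fun z : ℝ × Ω => step N u (fun i => c i z.2) z.1) (ν.prod P) := by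
  refine Finset.aemeasurable_fun_sum _ fun i hi => ?_
  have h1 : AEMeasurable (fun z : ℝ × Ω => c i z.2) (ν.prod P) :=
    (hc i (Finset.mem_range.1 hi)).comp_snd
  exact h1.indicator (measurable_fst (measurableSet_Ico (a := u i) (b := u (i + 1))))

section weightedDist

variable {ι : Type*} {B : Finset ι} {t : ℝ} {N : ℕ} {u : ℕ → ℝ} {c : ι → ℕ → Ω → ℝ}
  {e : ℕ → Ω → ℝ} {G : ℝ → Ω → ℝ}

theorem aemeasurable_weightedDist [SFinite P] (hc : ∀ b, ∀ i < N, AEMeasurable (c b i) P)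
    (he : ∀ i < N, AEMeasurable (e i) P)
    (hG : AEMeasurable (fun z : ℝ × Ω => G z.1 z.2) ((volume.restrict (Icc 0 t)).prod P)) :
    AEMeasurable (weightedDist B t N u c e G) P := by
  have h1 : AEMeasurable (fun z : ℝ × Ω =>
      ENNReal.ofReal (∑ b ∈ B, step N u (fun i => c b i z.2) z.1 ^ 2) *
      ‖G z.1 z.2 - step N u (fun i => e i z.2) z.1‖ₑ ^ (2 : ℝ))
      ((volume.restrict (Icc 0 t)).prod P) :=
    (Finset.aemeasurable_fun_sum _ fun b _ =>
      (aemeasurable_step (hc b) _).pow_const 2).ennreal_ofReal.mul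
      ((hG.sub (aemeasurable_step he _)).enorm.pow_const 2)
  exact h1.lintegral_prod_left'

theorem weightedDist_le (hu : IsGrid t N u) {ω : Ω} {K : ℝ}
    (hK : ∀ i < N, ∑ b ∈ B, c b i ω ^ 2 ≤ K) {E : ℝ → ℝ}
    (hE : ∀ i < N, ∀ s ∈ Ico (u i) (u (i + 1)), E s = e i ω) :
    weightedDist B t N u c e G ω
      ≤ ENNReal.ofReal K * ∫⁻ s in Icc 0 t, ‖E s - G s ω‖ₑ ^ (2 : ℝ) := by
  rw [weightedDist, ← lintegral_const_mul' _ _ ENNReal.ofReal_ne_top,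
    ← restrict_Ico_eq_restrict_Icc]
  refine setLIntegral_mono' measurableSet_Ico fun s hs => ?_
  obtain ⟨i, hi, his⟩ := hu.exists_mem_Ico hs
  simp only [hu.step_eq _ hi his, hE i hi s his]
  rw [← enorm_neg (G s ω - e i ω), neg_sub]
  exact mul_le_mul_left (ENNReal.ofReal_le_ofReal (hK i hi)) _

end weightedDist

section Limits

variable [IsProbabilityMeasure P] {t : ℝ} {N : ℕ → ℕ} {u : ℕ → ℕ → ℝ} {G I : ℝ → Ω → ℝ}
  {S : ℕ → SimpleProcess P W t}

/-- Since `e` consists of the values of `S n` at the partition points, `weightedDist` is at most `K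
∫ |S n - G|²`. The bound `K` may depend on the path, as only convergence in probability of the
bracket is used. -/
theorem tendsto_measure_sum_cellError (hW : IsBrownianReal W P) (ht : 0 ≤ t)
    (hG : AEMeasurable (fun z : ℝ × Ω => G z.1 z.2) ((volume.restrict (Icc 0 t)).prod P))
    (hI : ∀ s ∈ Icc 0 t, HasItoIntegral P W s G (I s))
    (hS : ∀ᵐ ω ∂P, Tendsto (fun n => ∫⁻ s in Icc 0 t, ‖(S n).val s ω - G s ω‖ₑ ^ (2 : ℝ))
      atTop (𝓝 0))
    (hu : ∀ n, IsGrid t (N n) (u n)) (hSu : ∀ n i, ∃ j ≤ N n, u n j = (S n).τ i)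
    {ι : Type*} (B : ℕ → Finset ι) (c : ℕ → ι → ℕ → Ω → ℝ)
    (hc : ∀ n b, ∀ i < N n, Measurable[augFiltration P W (u n i)] (c n b i))
    (hcK : ∀ᵐ ω ∂P, ∃ K, ∀ n, ∀ i < N n, ∑ b ∈ B n, c n b i ω ^ 2 ≤ K) {ε : ℝ} (hε : 0 < ε) :
    Tendsto (fun n => P {ω | ε ≤ ∑ b ∈ B n, (∑ i ∈ Finset.range (N n),
      c n b i ω * cellError W (u n) (fun j => (S n).val (u n j)) I i ω) ^ 2}) atTop (𝓝 0) := by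
  refine tendsto_measure_le_of_lenglart
    (A := fun n => weightedDist (B n) t (N n) (u n) (c n) (fun j => (S n).val (u n j)) G)
    (fun n ε hε δ hδ => measure_sum_cellError_ge_le hW ht hG hI (hu n) (B n) (c n) _ (hc n)
      (fun i _ => (S n).measurable_val le_rfl) hε hδ)
    (fun δ hδ => tendsto_measure_lt_of_tendsto_ae (fun n => ?_) ?_ hδ) hε
  · exact aemeasurable_weightedDist
      (fun b i hi => aemeasurable_of_augFiltration hW (hc n b i hi))
      (fun i _ => aemeasurable_of_augFiltration hW ((S n).measurable_val le_rfl)) hG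
  · filter_upwards [hS, hcK] with ω h1 ⟨K, hK⟩
    have h2 := ENNReal.Tendsto.const_mul h1 (Or.inr (show ENNReal.ofReal K ≠ ∞ by simp))
    rw [mul_zero] at h2
    exact tendsto_of_tendsto_of_tendsto_of_le_of_le tendsto_const_nhds h2 (fun _ => zero_le)
      fun n => weightedDist_le (hu n) (hK n) fun i _ s hs =>
        (S n).val_eq_of_mem_Ico (hu n) (hSu n) hs ω

/-- The Lenglart inequality for the noise `(ΔW)² - Δu`. Its bracket is a constant times `∑ w² e⁴
(Δu)²`, which vanishes by `IsGridSeq.tendsto_sum_mul_sq_mul_sq`. -/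
theorem tendstoInMeasure_sum_quadratic (hW : IsBrownianReal W P) (hu : IsGridSeq t N u)
    (e : ℕ → ℕ → Ω → ℝ) (he : ∀ n, ∀ i < N n, Measurable[augFiltration P W (u n i)] (e n i))
    (hG : ∀ᵐ ω ∂P, MemLp (fun s => G s ω) 2 (volume.restrict (Icc 0 t)))
    (heG : ∀ᵐ ω ∂P, Tendsto (fun n => ∑ i ∈ Finset.range (N n),
      ∫ s in u n i..u n (i + 1), (e n i ω - G s ω) ^ 2) atTop (𝓝 0))
    (w : ℝ → Ω → ℝ) (hwm : ∀ s ∈ Icc 0 t, Measurable[augFiltration P W s] (w s))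
    (hwc : ∀ᵐ ω ∂P, ContinuousOn (fun s => w s ω) (Icc 0 t)) :
    TendstoInMeasure P (fun n ω => ∑ i ∈ Finset.range (N n), w (u n i) ω * e n i ω ^ 2 *
      ((W (u n (i + 1)).toNNReal ω - W (u n i).toNNReal ω) ^ 2 - (u n (i + 1) - u n i)))
      atTop (fun _ => 0) := by
  have hdm : ∀ n, ∀ i < N n, Measurable[augFiltration P W (u n i)]
      (fun ω => w (u n i) ω * e n i ω ^ 2) := fun n i hi =>
    (hwm _ ((hu.grid n).mem_Icc hi.le)).mul ((he n i hi).pow_const 2)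
  have key := fun n ε (hε : 0 < ε) δ (hδ : 0 ≤ δ) =>
    ((hu.grid n).isNoise_increment_sq hW).measure_sum_sq_ge_le {()}
      (fun _ i ω => w (u n i) ω * e n i ω ^ 2) (fun _ => hdm n) (ε := ε) (δ := δ) hε hδ
  simp only [Finset.sum_singleton] at key
  refine tendstoInMeasure_zero_of_sq fun ε hε => tendsto_measure_le_of_lenglart
    (A := fun n ω => ENNReal.ofReal (∑ i ∈ Finset.range (N n), (w (u n i) ω * e n i ω ^ 2) ^ 2 *
      ((gaussianSqVar + 1) * (u n (i + 1) - u n i) ^ 2)))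
    (fun n ε hε δ hδ => ?_)
    (fun δ hδ => tendsto_measure_lt_of_tendsto_ae (fun n => ?_) ?_ hδ) hε
  · refine (measure_mono fun ω hω => ?_).trans ((key n ε hε δ hδ.le).trans
      (add_le_add_right (measure_mono fun ω hω => ?_) _))
    · rw [mem_ofPred_eq] at hω ⊢
      linarith
    · rw [mem_ofPred_eq] at hω ⊢
      exact (ENNReal.ofReal_lt_ofReal_iff_of_nonneg (by positivity)).2 (by linarith)
  · exact (Finset.aemeasurable_fun_sum _ fun i hi =>
      ((aemeasurable_of_augFiltration hW (hdm n i (Finset.mem_range.1 hi))).pow_const 2).mul_const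
        _).ennreal_ofReal
  · filter_upwards [hG, heG, hwc] with ω h1 h2 h3
    have h4 := hu.tendsto_sum_mul_sq_mul_sq h1 h2
      (w := fun s => (gaussianSqVar + 1) * w s ω ^ 2) (continuousOn_const.mul (h3.pow 2))
    rw [← ENNReal.ofReal_zero]
    refine ENNReal.tendsto_ofReal (h4.congr fun n => Finset.sum_congr rfl fun i _ => ?_)
    ring

end Limits

/-! ### Approximation of the integrand -/

theorem IsGrid.lintegral_sub_eq_ofReal {t : ℝ} {N : ℕ} {u : ℕ → ℝ} (hu : IsGrid t N u) {g : ℝ → ℝ}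
    (hg : MemLp g 2 (volume.restrict (Icc 0 t))) {e : ℕ → ℝ} {E : ℝ → ℝ}
    (hE : ∀ i < N, ∀ s ∈ Ico (u i) (u (i + 1)), E s = e i) :
    ∫⁻ s in Icc 0 t, ‖E s - g s‖ₑ ^ (2 : ℝ)
      = ENNReal.ofReal (∑ i ∈ Finset.range N, ∫ s in u i..u (i + 1), (e i - g s) ^ 2) := by
  rw [hu.lintegral_Icc_eq_sum, ENNReal.ofReal_sum_of_nonneg fun i hi =>
    intervalIntegral.integral_nonneg (hu.lt i (Finset.mem_range.1 hi)).le fun _ _ => sq_nonneg _]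
  refine Finset.sum_congr rfl fun i hi => ?_
  have hi' := Finset.mem_range.1 hi
  have hd2 : IntegrableOn (fun s => (e i - g s) ^ 2) (Icc 0 t) :=
    ((memLp_const (e i)).sub hg).integrable_sq
  have h1 := hd2.mono_set (fun s hs => hu.mem_Icc_of_mem_cell hi' (Ioc_subset_Icc_self hs))
  rw [intervalIntegral.integral_of_le (hu.lt i hi').le,
    ofReal_integral_eq_lintegral_ofReal h1 (ae_of_all _ fun _ => sq_nonneg _),
    setLIntegral_congr (Ioc_ae_eq_Icc.trans Ico_ae_eq_Icc.symm)]
  refine setLIntegral_congr_fun measurableSet_Ico fun s hs => ?_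
  rw [hE i hi' s hs, enorm_rpow_two]

theorem memLp_continuousOn_mul {t : ℝ} {p g : ℝ → ℝ} (hp : ContinuousOn p (Icc 0 t))
    (hg : MemLp g 2 (volume.restrict (Icc 0 t))) :
    MemLp (fun s => p s * g s) 2 (volume.restrict (Icc 0 t)) := by
  obtain ⟨C, hC⟩ := isCompact_Icc.exists_bound_of_continuousOn hp
  refine hg.of_le_mul ((hp.aestronglyMeasurable measurableSet_Icc).mul hg.1) (c := C) ?_
  filter_upwards [ae_restrict_mem measurableSet_Icc] with s hs
  rw [norm_mul]
  exact mul_le_mul_of_nonneg_right (hC s hs) (norm_nonneg _)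

/-- Split `p(u i) e - p g = p(u i)(e - g) + (p(u i) - p) g`: the first part is controlled by
boundedness of `p`, the second by its uniform continuity. Thus `∂ₓF e` approximates `∂ₓF G`. -/
theorem IsGridSeq.tendsto_sum_integral_mul_sub_sq {t : ℝ} {N : ℕ → ℕ} {u : ℕ → ℕ → ℝ}
    (hu : IsGridSeq t N u) {p g : ℝ → ℝ} (hp : ContinuousOn p (Icc 0 t))
    (hg : MemLp g 2 (volume.restrict (Icc 0 t))) {e : ℕ → ℕ → ℝ}
    (he : Tendsto (fun n => ∑ i ∈ Finset.range (N n), ∫ s in u n i..u n (i + 1), (e n i - g s) ^ 2)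
      atTop (𝓝 0)) :
    Tendsto (fun n => ∑ i ∈ Finset.range (N n),
      ∫ s in u n i..u n (i + 1), (p (u n i) * e n i - p s * g s) ^ 2) atTop (𝓝 0) := by
  have hg2 : IntegrableOn (fun s => g s ^ 2) (Icc 0 t) := hg.integrable_sq
  obtain ⟨C, hC⟩ := isCompact_Icc.exists_bound_of_continuousOn hp
  have he' : Tendsto (fun n => 2 * C ^ 2 * ∑ i ∈ Finset.range (N n),
      ∫ s in u n i..u n (i + 1), (e n i - g s) ^ 2) atTop (𝓝 0) := by
    simpa using he.const_mul (2 * C ^ 2)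
  refine tendsto_of_forall_eventually_abs_sub_le (M := 1 + 2 * ∫ s in 0..t, g s ^ 2)
    fun η hη => ?_
  obtain ⟨δ, hδ, h1⟩ := exists_forall_abs_sub_le_of_continuousOn hp (Real.sqrt_pos.2 hη)
  filter_upwards [hu.mesh δ hδ, he'.eventually (gt_mem_nhds hη)] with n hn h2
  have hgr := hu.grid n
  rw [sub_zero, abs_of_nonneg (Finset.sum_nonneg fun i hi => intervalIntegral.integral_nonneg
    (hgr.lt i (Finset.mem_range.1 hi)).le fun _ _ => sq_nonneg _)]
  have h3 : ∑ i ∈ Finset.range (N n),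
      ∫ s in u n i..u n (i + 1), (p (u n i) * e n i - p s * g s) ^ 2
      ≤ 2 * C ^ 2 * (∑ i ∈ Finset.range (N n), ∫ s in u n i..u n (i + 1), (e n i - g s) ^ 2)
        + 2 * η * ∫ s in 0..t, g s ^ 2 := by
    rw [← hgr.sum_integral hg2, Finset.mul_sum, Finset.mul_sum, ← Finset.sum_add_distrib]
    refine Finset.sum_le_sum fun i hi => ?_
    have hi' := Finset.mem_range.1 hi
    have hle := (hgr.lt i hi').le
    have hd2 : IntegrableOn (fun s => (e n i - g s) ^ 2) (Icc 0 t) :=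
      ((memLp_const (e n i)).sub hg).integrable_sq
    have hp2 : IntegrableOn (fun s => (p (u n i) * e n i - p s * g s) ^ 2) (Icc 0 t) :=
      ((memLp_const (p (u n i) * e n i)).sub (memLp_continuousOn_mul hp hg)).integrable_sq
    have i1 := hgr.intervalIntegrable hg2 hi'
    have i2 := hgr.intervalIntegrable hd2 hi'
    rw [← intervalIntegral.integral_const_mul, ← intervalIntegral.integral_const_mul,
      ← intervalIntegral.integral_add (i2.const_mul _) (i1.const_mul _)]
    refine intervalIntegral.integral_mono_on hle (hgr.intervalIntegrable hp2 hi')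
      ((i2.const_mul _).add (i1.const_mul _)) fun s hs => ?_
    have hm := hgr.mem_Icc hi'.le
    have h4 : p (u n i) ^ 2 ≤ C ^ 2 := by
      rw [← sq_abs]
      exact pow_le_pow_left₀ (abs_nonneg _) (hC _ hm) 2
    have h5 : (p (u n i) - p s) ^ 2 ≤ η := by
      rw [← sq_abs, ← Real.sq_sqrt hη.le]
      exact pow_le_pow_left₀ (abs_nonneg _) (h1 _ hm _ (hgr.mem_Icc_of_mem_cell hi' hs)
        (abs_sub_le_of_mem_cell (hn i hi') ⟨le_rfl, hle⟩ hs)) 2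
    calc (p (u n i) * e n i - p s * g s) ^ 2
        = (p (u n i) * (e n i - g s) + (p (u n i) - p s) * g s) ^ 2 := by ring
      _ ≤ 2 * (p (u n i) ^ 2 * (e n i - g s) ^ 2) + 2 * ((p (u n i) - p s) ^ 2 * g s ^ 2) := by
          nlinarith [sq_nonneg (p (u n i) * (e n i - g s) - (p (u n i) - p s) * g s)]
      _ ≤ 2 * (C ^ 2 * (e n i - g s) ^ 2) + 2 * (η * g s ^ 2) := by gcongr
      _ = _ := by ring
  linarith

/-! ### Itô's formula at a fixed time -/

theorem hasItoIntegral_partialX_mul [IsProbabilityMeasure P] (hW : IsBrownianReal W P) {T : ℝ}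
    {X h G : ℝ → Ω → ℝ} (hX : IsItoProcess P W T X h G) {F : ℝ → ℝ → ℝ} (hF : IsC12 F) {t : ℝ}
    (ht : t ∈ Icc 0 T) :
    HasItoIntegral P W t (fun s ω => partialX F s (X s ω) * G s ω)
      (fun ω => F t (X t ω) - F 0 (X 0 ω) - ∫ s in 0..t, (partialT F s (X s ω)
        + partialX F s (X s ω) * h s ω + 1 / 2 * partialXX F s (X s ω) * G s ω ^ 2)) := by
  obtain ⟨I, hI, hXI⟩ := hX.eq_integral
  obtain ⟨S, hS, -⟩ := hI.hasItoIntegral t ht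
  have hsub : Icc 0 t ⊆ Icc 0 T := Icc_subset_Icc_right ht.2
  have hmesh : ∀ n : ℕ, (0 : ℝ) < 1 / (n + 1) := fun n => by positivity
  choose N u hu hSu humesh using fun n => exists_isGrid ht.1 (Finset.univ.image (S n).τ) (by
    intro a ha
    obtain ⟨i, -, rfl⟩ := Finset.mem_image.1 ha
    exact (S n).τ_mem i) (hmesh n)
  replace hSu : ∀ n i, ∃ j ≤ N n, u n j = (S n).τ i := fun n i => hSu n _ (by simp)
  have huS : IsGridSeq t N u := by
    refine ⟨hu, fun δ hδ => ?_⟩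
    filter_upwards [tendsto_one_div_add_atTop_nhds_zero_nat.eventually (gt_mem_nhds hδ)]
      with n hn j hj
    exact (humesh n j hj).trans hn.le
  set e : ℕ → ℕ → Ω → ℝ := fun n j => (S n).val (u n j) with he
  set ξ : ℕ → ℕ → Ω → ℝ := fun n j ω =>
    W (u n (j + 1)).toNNReal ω - W (u n j).toNNReal ω with hξ
  have hem : ∀ n, ∀ i < N n, Measurable[augFiltration P W (u n i)] (e n i) := fun n i _ =>
    (S n).measurable_val le_rfl
  have hGm := aemeasurable_prod_mono hsub hX.diffusion_mem.aemeasurable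
  have hGL : ∀ᵐ ω ∂P, MemLp (fun s => G s ω) 2 (volume.restrict (Icc 0 t)) :=
    hX.diffusion_mem.ae_memLp.mono fun ω hω => hω.mono_measure (Measure.restrict_mono_set _ hsub)
  have hhL : ∀ᵐ ω ∂P, IntegrableOn (fun s => h s ω) (Icc 0 t) :=
    hX.drift_mem.ae_integrableOn.mono fun ω hω => hω.mono_set hsub
  have hXc : ∀ᵐ ω ∂P, ContinuousOn (fun s => X s ω) (Icc 0 t) :=
    hX.continuousOn.mono fun ω hω => hω.mono hsub
  have hXm : ∀ s ∈ Icc 0 t, Measurable[augFiltration P W s] (X s) := fun s hs =>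
    hX.measurable hW (hsub hs)
  have heG : ∀ᵐ ω ∂P, Tendsto (fun n => ∑ i ∈ Finset.range (N n),
      ∫ s in u n i..u n (i + 1), (e n i ω - G s ω) ^ 2) atTop (𝓝 0) := by
    filter_upwards [hS, hGL] with ω h1 h2
    have h3 := (ENNReal.tendsto_toReal ENNReal.zero_ne_top).comp h1
    refine h3.congr fun n => ?_
    rw [Function.comp_apply, (hu n).lintegral_sub_eq_ofReal h2 (e := fun i => e n i ω)
      fun i _ s hs => (S n).val_eq_of_mem_Ico (hu n) (hSu n) hs ω, ENNReal.toReal_ofReal]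
    exact Finset.sum_nonneg fun i hi => intervalIntegral.integral_nonneg
      ((hu n).lt i (Finset.mem_range.1 hi)).le fun _ _ => sq_nonneg _
  have hIt : ∀ s ∈ Icc 0 t, HasItoIntegral P W s G (I s) := fun s hs =>
    hI.hasItoIntegral s (hsub hs)
  have hcomp : ∀ {ψ : ℝ → ℝ → ℝ}, ContinuousOn (fun z : ℝ × ℝ => ψ z.1 z.2) (Ici 0 ×ˢ univ) →
      (∀ s ∈ Icc 0 t, Measurable[augFiltration P W s] (fun ω => ψ s (X s ω))) ∧
      ∀ᵐ ω ∂P, ContinuousOn (fun s => ψ s (X s ω)) (Icc 0 t) := fun hψ =>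
    ⟨fun s hs => (continuous_section hψ hs.1).measurable.comp (hXm s hs),
      hXc.mono fun ω hω => continuousOn_comp_path hψ hω⟩
  obtain ⟨hpm, hpc⟩ := hcomp hF.continuousOn_x
  obtain ⟨hφm, hφc⟩ := hcomp hF.continuousOn_xx
  set r : ℕ → ℕ → Ω → ℝ := fun n i => cellError W (u n) (e n) I i with hr
  have l0 : TendstoInMeasure P (fun n ω => ∑ i ∈ Finset.range (N n),
      partialX F (u n i) (X (u n i) ω) * r n i ω) atTop (fun _ => 0) := by
    refine tendstoInMeasure_zero_of_sq fun ε hε => ?_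
    have := tendsto_measure_sum_cellError hW ht.1 hGm hIt hS hu hSu (fun _ => {()})
      (fun n _ i ω => partialX F (u n i) (X (u n i) ω))
      (fun n _ i hi => hpm _ ((hu n).mem_Icc hi.le)) (by
        filter_upwards [hpc] with ω hω
        obtain ⟨C, hC⟩ := isCompact_Icc.exists_bound_of_continuousOn hω
        refine ⟨C ^ 2, fun n i hi => ?_⟩
        rw [Finset.sum_singleton, ← sq_abs]
        exact pow_le_pow_left₀ (abs_nonneg _) (hC _ ((hu n).mem_Icc hi.le)) 2) hε
    simpa only [Finset.sum_singleton] using this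
  have l1 : TendstoInMeasure P (fun n ω => ∑ i ∈ Finset.range (N n), r n i ω ^ 2) atTop
      (fun _ => 0) := by
    rw [tendstoInMeasure_iff_norm]
    intro ε hε
    -- The family index now runs over the cells, with Kronecker weights: the inner sums reduce to
    -- single errors and the outer one to `∑ r²`. For each `i` the squared weights add up to `1`.
    have h1 := tendsto_measure_sum_cellError hW ht.1 hGm hIt hS hu hSu
      (fun n => Finset.range (N n)) (fun n b i _ => if i = b then 1 else 0)
      (fun n _ i hi => measurable_const) (ae_of_all _ fun ω => ⟨1, fun n i hi => by
        simp [hi]⟩) hε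
    refine h1.congr fun n => ?_
    congr 1
    ext ω
    rw [mem_ofPred_eq, mem_ofPred_eq, sub_zero, Real.norm_eq_abs,
      abs_of_nonneg (Finset.sum_nonneg fun _ _ => sq_nonneg _)]
    refine iff_of_eq (congrArg _ (Finset.sum_congr rfl fun b hb => ?_))
    simp only [ite_mul, one_mul, zero_mul, Finset.sum_ite_eq', hb, if_true, hr]
    rfl
  have l2 := tendstoInMeasure_sum_quadratic hW huS e hem hGL heG
    (fun s ω => partialXX F s (X s ω)) hφm hφc
  have l3 := tendstoInMeasure_sum_quadratic hW huS e hem hGL heG (fun _ _ => 1)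
    (fun _ _ => measurable_const) (ae_of_all _ fun _ => continuousOn_const)
  -- The four error sums are coded as one family indexed by `j < 4` to obtain a common almost surely
  -- convergent subsequence.
  obtain ⟨ns, hns, hlim⟩ := exists_strictMono_tendsto_ae (P := P) (g := fun _ _ => 0)
    (f := fun j n ω => if j = 0 then ∑ i ∈ Finset.range (N n),
        partialX F (u n i) (X (u n i) ω) * r n i ω
      else if j = 1 then ∑ i ∈ Finset.range (N n), r n i ω ^ 2
      else if j = 2 then ∑ i ∈ Finset.range (N n),
        partialXX F (u n i) (X (u n i) ω) * e n i ω ^ 2 * (ξ n i ω ^ 2 - (u n (i + 1) - u n i))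
      else ∑ i ∈ Finset.range (N n), 1 * e n i ω ^ 2 * (ξ n i ω ^ 2 - (u n (i + 1) - u n i))) 4
    (fun j hj => by
      interval_cases j
      · simpa using l0
      · simpa using l1
      · simpa using l2
      · simpa using l3)
  have m0 := hlim 0 (by norm_num)
  have m1 := hlim 1 (by norm_num)
  have m2 := hlim 2 (by norm_num)
  have m3 := hlim 3 (by norm_num)
  simp only [if_true, one_ne_zero, if_false, OfNat.ofNat_ne_zero, OfNat.ofNat_ne_one,
    show (3 : ℕ) ≠ 2 by norm_num, one_mul] at m0 m1 m2 m3
  have hq : ∀ n, ∀ i < N n, Measurable[augFiltration P W (u n i)]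
      (fun ω => partialX F (u n i) (X (u n i) ω) * e n i ω) := fun n i hi =>
    (hpm _ ((hu n).mem_Icc hi.le)).mul (hem n i hi)
  -- The simple processes demanded by `HasItoIntegral` take the value `∂ₓF(u i, X_{u i}) e i` on
  -- cells. Their integrals are the Riemann-Itô sums of the pathwise lemma, and almost sure
  -- convergence along the subsequence yields convergence in probability.
  refine ⟨fun k => (hu (ns k)).simpleOfStep _ (hq (ns k)), ?_, ?_⟩
  · filter_upwards [hpc, hGL, heG] with ω h1 h2 h3
    have h4 := (huS.tendsto_sum_integral_mul_sub_sq h1 h2 h3).comp hns.tendsto_atTop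
    rw [← ENNReal.ofReal_zero]
    refine (ENNReal.tendsto_ofReal h4).congr fun k => ?_
    refine ((hu (ns k)).lintegral_sub_eq_ofReal (memLp_continuousOn_mul h1 h2) ?_).symm
    intro i hi s hs
    rw [IsGrid.simpleOfStep_val]
    exact (hu (ns k)).step_eq _ hi hs
  · refine tendstoInMeasure_of_tendsto_ae (fun k => (aemeasurable_of_augFiltration hW
      (SimpleProcess.measurable_integral _)).aestronglyMeasurable) ?_
    filter_upwards [hXc, hhL, hGL, heG, hXI, m0, m1, m2, m3]
      with ω hx hh hg hρ hXω h0 h1 h2 h3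
    simp only [IsGrid.simpleOfStep_integral]
    refine (huS.comp hns).tendsto_sum_partialX_mul hF (x := fun s => X s ω)
      (e := fun k i => e (ns k) i ω) (ξ := fun k i => ξ (ns k) i ω)
      (r := fun k i => r (ns k) i ω) hx hh hg (hρ.comp hns.tendsto_atTop) ?_ h0 h1 h2 h3
    intro k i hi
    have hgr := hu (ns k)
    have hII : ∀ j ≤ N (ns k), IntervalIntegrable (fun s => h s ω) volume 0 (u (ns k) j) := by
      intro j hj
      refine IntegrableOn.intervalIntegrable (hh.mono_set ?_)
      rw [uIcc_of_le (hgr.nonneg j)]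
      exact Icc_subset_Icc_right (hgr.le_last hj)
    have hi' : i < N (ns k) := hi
    simp only [Function.comp_apply]
    rw [← intervalIntegral.integral_interval_sub_left (hII _ hi') (hII _ hi'.le),
      hXω _ (hsub (hgr.mem_Icc hi')), hXω _ (hsub (hgr.mem_Icc hi'.le))]
    simp only [hr, hξ, cellError]
    ring

end ItoFormula

end

/-! ### From fixed times to the process `F(t, X_t)`. -/

theorem mainTheorem1 {Ω : Type*} [MeasurableSpace Ω] (P : Measure Ω) [IsProbabilityMeasure P]
    (W : ℝ≥0 → Ω → ℝ) (hW : IsBrownianReal W P)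
    (T : ℝ) (hT : 0 < T) (X h G : ℝ → Ω → ℝ)
    (hX : ItoFormula.IsItoProcess P W T X h G)
    (F : ℝ → ℝ → ℝ) (hF : ItoFormula.IsC12 F) :
    ItoFormula.IsItoProcess P W T
      (fun t ω => F t (X t ω))
      (fun t ω => ItoFormula.partialT F t (X t ω)
        + ItoFormula.partialX F t (X t ω) * h t ω
        + 1 / 2 * ItoFormula.partialXX F t (X t ω) * G t ω ^ 2)
      (fun t ω => ItoFormula.partialX F t (X t ω) * G t ω) := by
  have hXm : ∀ s ∈ Icc 0 T, Measurable[ItoFormula.augFiltration P W s] (X s) := fun s hs =>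
    hX.measurable hW hs
  have hXj := ItoFormula.aemeasurable_prod_of_continuousOn hX.continuousOn fun s hs =>
    ItoFormula.aemeasurable_of_augFiltration hW (hXm s hs)
  have hcomp : ∀ {ψ : ℝ → ℝ → ℝ}, ContinuousOn (fun z : ℝ × ℝ => ψ z.1 z.2) (Ici 0 ×ˢ univ) →
      ∀ s ∈ Icc 0 T, Measurable[ItoFormula.augFiltration P W s] (fun ω => ψ s (X s ω)) :=
    fun hψ s hs => (ItoFormula.continuous_section hψ hs.1).measurable.comp (hXm s hs)
  have hdrift_int : ∀ᵐ ω ∂P, IntegrableOn (fun s => ItoFormula.partialT F s (X s ω)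
        + ItoFormula.partialX F s (X s ω) * h s ω
        + 1 / 2 * ItoFormula.partialXX F s (X s ω) * G s ω ^ 2) (Icc 0 T) := by
    filter_upwards [hX.continuousOn, hX.drift_mem.ae_integrableOn, hX.diffusion_mem.ae_memLp]
      with ω h1 h2 h3
    have hct := ItoFormula.continuousOn_comp_path hF.continuousOn_t h1
    have hcx := ItoFormula.continuousOn_comp_path hF.continuousOn_x h1
    have hcxx := ItoFormula.continuousOn_comp_path hF.continuousOn_xx h1
    have hg2 : IntegrableOn (fun s => G s ω ^ 2) (Icc 0 T) := h3.integrable_sq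
    exact (hct.integrableOn_Icc.add (h2.continuousOn_mul hcx isCompact_Icc)).add
      (hg2.continuousOn_mul (continuousOn_const.mul hcxx) isCompact_Icc)
  refine ⟨?_, ?_, ?_, ?_, ?_⟩
  · filter_upwards [hX.continuousOn] with ω hω
    exact ItoFormula.continuousOn_comp_path hF.continuousOn hω
  · exact hcomp hF.continuousOn 0 ⟨le_rfl, hT.le⟩
  · refine ItoFormula.MemH.of_integrableOn (fun s hs => ?_) ?_ hdrift_int
    · exact ((hcomp hF.continuousOn_t s hs).add ((hcomp hF.continuousOn_x s hs).mul
        (hX.drift_mem.adapted s hs))).add (((hcomp hF.continuousOn_xx s hs).const_mul _).mul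
        ((hX.diffusion_mem.adapted s hs).pow_const 2))
    · exact ((ItoFormula.aemeasurable_comp_prod hF.continuousOn_t hXj).add
        ((ItoFormula.aemeasurable_comp_prod hF.continuousOn_x hXj).mul
          hX.drift_mem.aemeasurable)).add
        (((ItoFormula.aemeasurable_comp_prod hF.continuousOn_xx hXj).const_mul _).mul
          (hX.diffusion_mem.aemeasurable.pow_const 2))
  · refine ItoFormula.MemH.of_memLp (fun s hs => ?_) ?_ ?_
    · exact (hcomp hF.continuousOn_x s hs).mul (hX.diffusion_mem.adapted s hs)
    · exact (ItoFormula.aemeasurable_comp_prod hF.continuousOn_x hXj).mul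
        hX.diffusion_mem.aemeasurable
    · filter_upwards [hX.continuousOn, hX.diffusion_mem.ae_memLp] with ω h1 h2
      exact ItoFormula.memLp_continuousOn_mul
        (ItoFormula.continuousOn_comp_path hF.continuousOn_x h1) h2
  -- The continuous version of the Itô integral is taken to be `F(t, X_t) - F(0, X_0)` minus the
  -- drift integral. The integral equation is then an identity, and continuity follows from that of
  -- the path and of the primitive.
  · refine ⟨_, ⟨?_, fun t ht => ItoFormula.hasItoIntegral_partialX_mul hW hX hF ht⟩, ?_⟩
    · filter_upwards [hX.continuousOn, hdrift_int] with ω h1 h2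
      refine ((ItoFormula.continuousOn_comp_path hF.continuousOn h1).sub continuousOn_const).sub ?_
      have h3 := intervalIntegral.continuousOn_primitive_interval (μ := volume) (a := 0) (b := T)
        (by rw [uIcc_of_le hT.le]; exact h2)
      rwa [uIcc_of_le hT.le] at h3
    · refine ae_of_all _ fun ω t _ => ?_
      ring
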